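/- Let $n\ge i\ge 2$, let $R$ be an integral domain, let $q^{1/n}\in R$ be a unit, $q=(q^{1/n})^n$, and $[k]=\sum_{j=0}^{k-1}q^{-k+1+2j}$. Assume that $[1],\dots,[n-1]$ are units of $R$ and that, if $q$ is a root of unity, every prime divisor of its order is larger than $n$. Let $\mathcal{MOY}(SL_n)$ be the $R$-linear strict braided spherical category whose objects are the finite sequences in $\{1^\pm,\dots,n^\pm\}$ (the dual reverses a sequence and changes all signs) and which is generated by the trivalent vertices $k\otimes l\to k+l$ and $k+l\to k\otimes l$ ($k,l\ge1$, $k+l\le n$), together with crossings, caps and cups, subject to the isotopies of a braided spherical category (planar isotopy, Reidemeister II and III, sliding of strands over and under vertices, caps and cups, sphericality) and to the following relations together with their mirror images. Edges of colour $0$ are deleted and diagrams with an edge of colour $<0$ or $>n$ are zero. * Bubbles: $(k+l\to k\otimes l\to k+l)=\begin{bmatrix}k+l\\k\end{bmatrix}\mathrm{id}_{k+l}$, and the partial closure of the strand $l$ in $k\otimes l\to k+l\to k\otimes l$ is $\begin{bmatrix}n-k\\l\end{bmatrix}\mathrm{id}_k$ (for $k=0$: the circle of colour $l$ is $\begin{bmatrix}n\\l\end{bmatrix}$).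 * $6j$: the two trees $j\otimes k\otimes l\to j+k+l$ are equal, and so are the two trees $j+k+l\to j\otimes k\otimes l$. * Box: write $P_c$ for the ladder $k\otimes l\to c\otimes(k+l-c)\to k'\otimes l'$ with $c\le\min(k,k')$ and $Q_d$ for the ladder $k\otimes l\to d\otimes(k+l-d)\to k'\otimes l'$ with $d\ge\max(k,k')$, where $k+l=k'+l'$; then $P_c=\sum_d\begin{bmatrix}k'-l\\k+k'-c-d\end{bmatrix}Q_d$. * Braid: the positive crossing $k\otimes l\to l\otimes k$ equals $(-1)^{kl}q^{-kl/n}\sum_{c\ge0}(-q)^cP_c$ (with $k'=l$, $l'=k$), and the negative crossing is obtained from this by replacing $q^{1/n}$ with $q^{-1/n}$. For $m\ge1$ let $\mathcal{MOY}^m(SL_n)\subseteq\mathcal{MOY}(SL_n)$ be the subcategory whose objects are the sequences in $\{1^\pm\}$ and whose morphisms are the $R$-linear combinations of diagrams (with trivalent vertices, crossings, caps and cups) all of whose edges have colours at most $m$; it is an $R$-linear braided spherical category. Then $\mathcal{MOY}^i(SL_n)$ and $\mathcal{MOY}^{i-1}(SL_n)$ are equivalent as $R$-linear braided spherical categories.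 More precisely, there is an $R$-linear braided monoidal functor $\phi_i:\mathcal{MOY}^i(SL_n)\to\mathcal{MOY}^{i-1}(SL_n)$ that preserves the pivotal structures, is an equivalence of categories and is the identity on $\mathcal{MOY}^{i-1}(SL_n)\subseteq\mathcal{MOY}^i(SL_n)$, and that expands interior edges of colour $i$: for $1\le j,k\le i-1$, its value on a diagram does not change when a part $j\otimes(i-j)\to i\to k\otimes(i-k)$ of the diagram is replaced with the following combination of diagrams with colours at most $i-1$: * if $i\ge3$: $\dfrac{1}{[j][k]}\,T_k\circ\bigl(Q-[i-2]\,\mathrm{id}\bigr)\circ S_j$, where $S_j$ is the rung $j\otimes(i-j)\to1\otimes(i-1)$ of colour $j-1$, $Q$ is the ladder $1\otimes(i-1)\to2\otimes(i-2)\to1\otimes(i-1)$, and $T_k$ is the rung $1\otimes(i-1)\to k\otimes(i-k)$ of colour $k-1$; * if $i=2$: $q\,\mathrm{id}_{1\otimes1}-q^{1/n}X$, where $X$ is the positive crossing of two strands of colour $1$. -/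

import Mathlib

open CategoryTheory MonoidalCategory

universe u v w

/-! ### Quantum integers and quantum binomial coefficients -/

namespace Quantum

variable {R : Type u} [CommRing R]

/-- The quantum integer `[k] = ∑_{j < k} q^(-k + 1 + 2j)`. -/
def qint (q : Rˣ) (k : ℕ) : R :=
  ∑ j ∈ Finset.range k, ((q ^ (-(k : ℤ) + 1 + 2 * (j : ℤ)) : Rˣ) : R)

/-- The quantum factorial `[k]!`. -/
def qfact (q : Rˣ) : ℕ → R
  | 0 => 1
  | k + 1 => qint q (k + 1) * qfact q k

/-- The quantum binomial coefficient `[m choose t]` for `m ≥ 0`, as the value at `q` of the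
corresponding Laurent polynomial (see `qbinom_mul_qfact`). -/
def qbinom (q : Rˣ) : ℕ → ℕ → R
  | _, 0 => 1
  | 0, _ + 1 => 0
  | m + 1, t + 1 =>
      ((q ^ ((t : ℤ) + 1) : Rˣ) : R) * qbinom q m (t + 1)
        + ((q ^ ((t : ℤ) - (m : ℤ)) : Rˣ) : R) * qbinom q m t

/-- The quantum binomial coefficient `[m choose t] = ∏_{j=1}^{t} [m - j + 1] / [j]` for arbitrary
integers `m` and `t`: it is zero for `t < 0`, and for `m < 0` one has
`[m choose t] = (-1)^t [t - m - 1 choose t]`. -/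
def gbinom (q : Rˣ) : ℤ → ℤ → R
  | _, Int.negSucc _ => 0
  | Int.ofNat m, Int.ofNat t => qbinom q m t
  | Int.negSucc m, Int.ofNat t => (-1) ^ t * qbinom q (m + t) t

theorem qint_add (q : Rˣ) (a b : ℕ) :
    qint q (a + b) = ((q ^ (b : ℤ) : Rˣ) : R) * qint q a
      + ((q ^ (-(a : ℤ)) : Rˣ) : R) * qint q b := by
  unfold qint
  rw [add_comm a b, Finset.sum_range_add, Finset.mul_sum, Finset.mul_sum, add_comm]
  congr 1
  · refine Finset.sum_congr rfl fun j _ => ?_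
    rw [← Units.val_mul, ← zpow_add]
    congr 2
    push_cast
    ring
  · refine Finset.sum_congr rfl fun j _ => ?_
    rw [← Units.val_mul, ← zpow_add]
    congr 2
    push_cast
    ring

theorem qbinom_eq_zero (q : Rˣ) : ∀ {m t : ℕ}, m < t → qbinom q m t = 0
  | _, 0, h => absurd h (Nat.not_lt_zero _)
  | 0, t + 1, _ => by rw [qbinom]
  | m + 1, t + 1, h => by
      rw [qbinom, qbinom_eq_zero q (by omega : m < t + 1), qbinom_eq_zero q (by omega : m < t)]
      simp

/-- `[k + l choose k] [k]! [l]! = [k + l]!`. -/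
theorem qbinom_mul_qfact (q : Rˣ) (k l : ℕ) :
    qbinom q (k + l) k * (qfact q k * qfact q l) = qfact q (k + l) := by
  induction k generalizing l with
  | zero => simp [qbinom, qfact]
  | succ k ih =>
    induction l with
    | zero =>
      have h := ih 0
      simp only [Nat.add_zero, qfact, mul_one] at h ⊢
      rw [qbinom, qbinom_eq_zero q (Nat.lt_succ_self k)]
      simp only [sub_self, zpow_zero, Units.val_one, one_mul, mul_zero, zero_add]
      linear_combination qint q (k + 1) * h
    | succ l ihl =>
      have h := ih (l + 1)
      have e1 : k + 1 + (l + 1) = (k + (l + 1)) + 1 := by omega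
      have e2 : k + (l + 1) = k + 1 + l := by omega
      have e3 : k + (l + 1) + 1 = (l + 1) + (k + 1) := by omega
      rw [e1, qbinom]
      simp only [show ∀ m, qfact q (m + 1) = qint q (m + 1) * qfact q m from fun _ => rfl]
        at ihl ⊢
      rw [show qfact q (l + 1) = qint q (l + 1) * qfact q l from rfl] at h
      have hq := qint_add q (l + 1) (k + 1)
      rw [← e3] at hq
      rw [hq]
      have hz : ((k : ℤ) - ((k + (l + 1) : ℕ) : ℤ)) = -((l + 1 : ℕ) : ℤ) := by push_cast; ring
      have hz2 : ((k : ℤ) + 1) = ((k + 1 : ℕ) : ℤ) := by push_cast; ring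
      rw [hz, hz2]
      rw [← e2] at ihl
      linear_combination ((q ^ ((k + 1 : ℕ) : ℤ) : Rˣ) : R) * qint q (l + 1) * ihl
        + ((q ^ (-((l + 1 : ℕ) : ℤ)) : Rˣ) : R) * qint q (k + 1) * h

end Quantum

/-! ### Pivotal and spherical categories -/

namespace CategoryTheory

/-- A pivotal structure on a rigid monoidal category: isomorphisms `a_X : X ≅ X**`, natural in `X`,
such that `a_{X ⊗ Y} = a_X ⊗ a_Y` modulo the canonical isomorphism `(X ⊗ Y)** ≅ X** ⊗ Y**`. (Left
duals are obtained from right duals by means of `a`.) -/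
class PivotalCategory (C : Type u) [Category.{v} C] [MonoidalCategory C]
    [RightRigidCategory C] where
  pivot : ∀ X : C, X ≅ (Xᘁ)ᘁ
  pivot_naturality : ∀ {X Y : C} (f : X ⟶ Y), f ≫ (pivot Y).hom = (pivot X).hom ≫ (fᘁ)ᘁ
  pivot_tensor : ∀ X Y : C,
    (pivot (X ⊗ Y)).hom =
      ((pivot X).hom ⊗ₘ (pivot Y).hom) ≫ (rightDualTensorIso (Yᘁ) (Xᘁ)).inv ≫
        ((rightDualTensorIso X Y).hom)ᘁ

section Trace

variable {C : Type u} [Category.{v} C] [MonoidalCategory C] [RightRigidCategory C]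
  [PivotalCategory C]

/-- The left quantum trace `ev_X ∘ (id ⊗ f) ∘ coev'_X`. -/
def leftTrace {X : C} (f : X ⟶ X) : 𝟙_ C ⟶ 𝟙_ C :=
  η_ (Xᘁ) ((Xᘁ)ᘁ) ≫ Xᘁ ◁ (PivotalCategory.pivot X).inv ≫ Xᘁ ◁ f ≫ ε_ X (Xᘁ)

/-- The right quantum trace `ev'_X ∘ (f ⊗ id) ∘ coev_X`. -/
def rightTrace {X : C} (f : X ⟶ X) : 𝟙_ C ⟶ 𝟙_ C :=
  η_ X (Xᘁ) ≫ f ▷ Xᘁ ≫ (PivotalCategory.pivot X).hom ▷ Xᘁ ≫ ε_ (Xᘁ) ((Xᘁ)ᘁ)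

end Trace

/-- A spherical category is a pivotal category whose left and right traces agree. -/
class SphericalCategory (C : Type u) [Category.{v} C] [MonoidalCategory C]
    [RightRigidCategory C] extends PivotalCategory C where
  leftTrace_eq_rightTrace : ∀ {X : C} (f : X ⟶ X), leftTrace f = rightTrace f

section PreservesPivotal

variable {C : Type u} [Category.{v} C] [MonoidalCategory C] [RightRigidCategory C]
  {D : Type u} [Category.{v} D] [MonoidalCategory D] [RightRigidCategory D]

/-- A monoidal functor carries a dual pair to a dual pair. -/
@[reducible] def mapExactPairing (F : C ⥤ D) [F.Monoidal] (X : C) :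
    ExactPairing (F.obj X) (F.obj (Xᘁ)) where
  coevaluation' := Functor.LaxMonoidal.ε F ≫ F.map (η_ X (Xᘁ)) ≫ Functor.OplaxMonoidal.δ F X (Xᘁ)
  evaluation' := Functor.LaxMonoidal.μ F (Xᘁ) X ≫ F.map (ε_ X (Xᘁ)) ≫ Functor.OplaxMonoidal.η F
  coevaluation_evaluation' := by
    have h := congrArg F.map (ExactPairing.coevaluation_evaluation X (Xᘁ))
    simp only [Functor.map_comp] at h
    simp only [MonoidalCategory.whiskerLeft_comp, comp_whiskerRight, Category.assoc,
      Functor.LaxMonoidal.right_unitality, Functor.OplaxMonoidal.left_unitality]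
    simp only [← reassoc_of% h]
    simp only [Functor.Monoidal.map_whiskerLeft, Functor.Monoidal.map_whiskerRight,
      Functor.Monoidal.map_associator_inv, Category.assoc, Functor.Monoidal.μ_δ_assoc]
  evaluation_coevaluation' := by
    have h := congrArg F.map (ExactPairing.evaluation_coevaluation X (Xᘁ))
    simp only [Functor.map_comp] at h
    simp only [MonoidalCategory.whiskerLeft_comp, comp_whiskerRight, Category.assoc,
      Functor.LaxMonoidal.left_unitality, Functor.OplaxMonoidal.right_unitality]
    simp only [← reassoc_of% h]
    simp only [Functor.Monoidal.map_whiskerLeft, Functor.Monoidal.map_whiskerRight,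
      Functor.Monoidal.map_associator, Category.assoc, Functor.Monoidal.μ_δ_assoc]

/-- The canonical isomorphism `F(X)* ≅ F(X*)` for a monoidal functor `F`. -/
def mapDualIso (F : C ⥤ D) [F.Monoidal] (X : C) : (F.obj X)ᘁ ≅ F.obj (Xᘁ) :=
  rightDualIso HasRightDual.exact (mapExactPairing F X)

/-- A monoidal functor between pivotal categories preserves the pivotal structures if `F(a_X)` is
`a_{F(X)}` modulo the canonical isomorphism `F(X**) ≅ F(X)**`. -/
def PreservesPivotal [PivotalCategory C] [PivotalCategory D] (F : C ⥤ D) [F.Monoidal] : Prop :=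
  ∀ X : C, F.map (PivotalCategory.pivot X).hom ≫ (mapDualIso F (Xᘁ)).inv ≫
      ((mapDualIso F X).hom)ᘁ = (PivotalCategory.pivot (F.obj X)).hom

end PreservesPivotal

end CategoryTheory

/-! ### Webs: the free braided spherical category on trivalent vertices -/

namespace MOYCat

open Quantum

/-- A strand (boundary point of a diagram): a colour in `{1, …, n}` and a sign
(`true` is an arrow pointing up, `false` is an arrow pointing down). -/
structure Strand (n : ℕ) where
  color : ℕ
  up : Bool
  color_pos : 0 < color
  color_le : color ≤ n

/-- The strand with the opposite arrow. -/
def Strand.flip {n : ℕ} (s : Strand n) : Strand n :=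
  { s with up := !s.up }

theorem Strand.flip_flip {n : ℕ} (s : Strand n) : s.flip.flip = s := by
  cases s
  simp [Strand.flip]

/-- Sequences in `{1^±, …, n^±}`. -/
abbrev Word (n : ℕ) : Type := List (Strand n)

/-- The dual sequence: reversed, with all signs changed. -/
def dual {n : ℕ} (X : Word n) : Word n :=
  (X.map Strand.flip).reverse

theorem dual_dual {n : ℕ} (X : Word n) : dual (dual X) = X := by
  simp [dual, List.map_reverse, Function.comp_def, Strand.flip_flip]

theorem dual_append {n : ℕ} (X Y : Word n) : dual (X ++ Y) = dual Y ++ dual X := by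
  simp [dual]

/-- The upward strand of colour `k` as a sequence; an edge of colour `0` is no edge at all.
(The value for `k > n` is irrelevant.) -/
def str (n k : ℕ) : Word n :=
  if h : 0 < k ∧ k ≤ n then [⟨k, true, h.1, h.2⟩] else []

theorem str_zero (n : ℕ) : str n 0 = [] := by
  simp [str]

/-- Formal `R`-linear combinations of diagrams built by vertical and horizontal composition from
identities, trivalent vertices, crossings (`braid X Y` is the crossing of the parallel strands `X`
with the parallel strands `Y`, `braidInv X Y` is its inverse), caps `ev` and cups `coev`.
Diagrams are read from bottom to top: `comp f g` is `g` on top of `f`. -/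
inductive Tm (R : Type u) (n : ℕ) : Word n → Word n → Type u
  | zero {X Y : Word n} : Tm R n X Y
  | add {X Y : Word n} (f g : Tm R n X Y) : Tm R n X Y
  | smul {X Y : Word n} (r : R) (f : Tm R n X Y) : Tm R n X Y
  | eqv {X Y : Word n} (h : X = Y) : Tm R n X Y
  | comp {X Y Z : Word n} (f : Tm R n X Y) (g : Tm R n Y Z) : Tm R n X Z
  | tensor {X Y X' Y' : Word n} (f : Tm R n X Y) (g : Tm R n X' Y') : Tm R n (X ++ X') (Y ++ Y')
  | merge (k l : ℕ) (hk : 0 < k) (hl : 0 < l) (h : k + l ≤ n) :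
      Tm R n (str n k ++ str n l) (str n (k + l))
  | split (k l : ℕ) (hk : 0 < k) (hl : 0 < l) (h : k + l ≤ n) :
      Tm R n (str n (k + l)) (str n k ++ str n l)
  | braid (X Y : Word n) : Tm R n (X ++ Y) (Y ++ X)
  | braidInv (X Y : Word n) : Tm R n (Y ++ X) (X ++ Y)
  | ev (X : Word n) : Tm R n (dual X ++ X) []
  | coev (X : Word n) : Tm R n [] (X ++ dual X)

namespace Tm

variable {R : Type u} {n : ℕ}

/-- All edges of all diagrams in the linear combination have colours at most `i`. -/
def ColorLE (i : ℕ) : ∀ {X Y : Word n}, Tm R n X Y → Prop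
  | _, _, zero => True
  | _, _, add f g => f.ColorLE i ∧ g.ColorLE i
  | _, _, smul _ f => f.ColorLE i
  | X, _, eqv _ => ∀ s ∈ X, s.color ≤ i
  | _, _, comp f g => f.ColorLE i ∧ g.ColorLE i
  | _, _, tensor f g => f.ColorLE i ∧ g.ColorLE i
  | _, _, merge k l _ _ _ => k + l ≤ i
  | _, _, split k l _ _ _ => k + l ≤ i
  | _, _, braid X Y => (∀ s ∈ X, s.color ≤ i) ∧ ∀ s ∈ Y, s.color ≤ i
  | _, _, braidInv X Y => (∀ s ∈ X, s.color ≤ i) ∧ ∀ s ∈ Y, s.color ≤ i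
  | _, _, ev X => ∀ s ∈ X, s.color ≤ i
  | _, _, coev X => ∀ s ∈ X, s.color ≤ i

theorem ColorLE.mono {i j : ℕ} (hij : i ≤ j) {X Y : Word n} (f : Tm R n X Y)
    (hf : f.ColorLE i) : f.ColorLE j := by
  induction f with
  | zero => trivial
  | add f g ihf ihg => exact ⟨ihf hf.1, ihg hf.2⟩
  | smul r f ih => exact ih hf
  | eqv h => exact fun s hs => (hf s hs).trans hij
  | comp f g ihf ihg => exact ⟨ihf hf.1, ihg hf.2⟩
  | tensor f g ihf ihg => exact ⟨ihf hf.1, ihg hf.2⟩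
  | merge k l => exact le_trans hf hij
  | split k l => exact le_trans hf hij
  | braid X Y => exact ⟨fun s hs => (hf.1 s hs).trans hij, fun s hs => (hf.2 s hs).trans hij⟩
  | braidInv X Y => exact ⟨fun s hs => (hf.1 s hs).trans hij, fun s hs => (hf.2 s hs).trans hij⟩
  | ev X => exact fun s hs => (hf s hs).trans hij
  | coev X => exact fun s hs => (hf s hs).trans hij

/-- The identity diagram. -/
def idn (X : Word n) : Tm R n X X := eqv rfl

/-- `f` with identity strands `W` on its left. -/
def wl (W : Word n) {X Y : Word n} (f : Tm R n X Y) : Tm R n (W ++ X) (W ++ Y) :=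
  tensor (idn W) f

/-- `f` with identity strands `W` on its right. -/
def wr {X Y : Word n} (f : Tm R n X Y) (W : Word n) : Tm R n (X ++ W) (Y ++ W) :=
  tensor f (idn W)

/-- The identification `(X ++ Y) ++ Z = X ++ (Y ++ Z)`. -/
def asc (X Y Z : Word n) : Tm R n ((X ++ Y) ++ Z) (X ++ (Y ++ Z)) :=
  eqv (List.append_assoc X Y Z)

/-- The identification `X ++ (Y ++ Z) = (X ++ Y) ++ Z`. -/
def ascInv (X Y Z : Word n) : Tm R n (X ++ (Y ++ Z)) ((X ++ Y) ++ Z) :=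
  eqv (List.append_assoc X Y Z).symm

/-- Rotation of a diagram by a half turn, with a cup and a cap. -/
def rot {X Y : Word n} (f : Tm R n X Y) : Tm R n (dual Y) (dual X) :=
  comp (eqv (List.append_nil (dual Y)).symm) <|
  comp (wl (dual Y) (coev X)) <|
  comp (wl (dual Y) (wr f (dual X))) <|
  comp (ascInv (dual Y) Y (dual X)) <|
  wr (ev Y) (dual X)

/-- The cap `X ++ X* → ∅`. -/
def ev' (X : Word n) : Tm R n (X ++ dual X) [] :=
  comp (wr (eqv (dual_dual X).symm) (dual X)) (ev (dual X))

/-- The cup `∅ → X* ++ X`. -/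
def coev' (X : Word n) : Tm R n [] (dual X ++ X) :=
  comp (coev (dual X)) (wl (dual X) (eqv (dual_dual X)))

/-- `f 0 + … + f (m - 1)`. -/
def sum {X Y : Word n} (f : ℕ → Tm R n X Y) : ℕ → Tm R n X Y
  | 0 => zero
  | m + 1 => add (sum f m) (f m)

/-- The merging vertex `(k, l) → k + l`, with the conventions that edges of colour `0` are deleted
and that diagrams with an edge of colour `> n` are zero. -/
def mrg (k l : ℕ) : Tm R n (str n k ++ str n l) (str n (k + l)) :=
  if h : 0 < k ∧ 0 < l ∧ k + l ≤ n then merge k l h.1 h.2.1 h.2.2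
  else if hk : k = 0 then eqv (by subst hk; simp [str_zero])
  else if hl : l = 0 then eqv (by subst hl; simp [str_zero])
  else zero

/-- The splitting vertex `k + l → (k, l)`, with the same conventions. -/
def spl (k l : ℕ) : Tm R n (str n (k + l)) (str n k ++ str n l) :=
  if h : 0 < k ∧ 0 < l ∧ k + l ≤ n then split k l h.1 h.2.1 h.2.2
  else if hk : k = 0 then eqv (by subst hk; simp [str_zero])
  else if hl : l = 0 then eqv (by subst hl; simp [str_zero])
  else zero

/-- The rung `(c + a, l) → (c, a + l)` of colour `a` that runs to the right. -/
def rungR (c a l : ℕ) : Tm R n (str n (c + a) ++ str n l) (str n c ++ str n (a + l)) :=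
  comp (wr (spl c a) (str n l)) <|
  comp (asc (str n c) (str n a) (str n l)) <|
  wl (str n c) (mrg a l)

/-- The rung `(c, a + l) → (c + a, l)` of colour `a` that runs to the left. -/
def rungL (c a l : ℕ) : Tm R n (str n c ++ str n (a + l)) (str n (c + a) ++ str n l) :=
  comp (wl (str n c) (spl a l)) <|
  comp (ascInv (str n c) (str n a) (str n l)) <|
  wr (mrg c a) (str n l)

/-- The square `(k, l) → (c, k + l - c) → (k', l')`: first a rung to the right, then a rung to the
left. It is zero if the colours do not fit. -/
def squareRL (k l k' l' c : ℕ) : Tm R n (str n k ++ str n l) (str n k' ++ str n l') :=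
  if h : k + l = k' + l' ∧ c ≤ k ∧ c ≤ k' then
    comp (eqv (by rw [show c + (k - c) = k by omega]) :
      Tm R n (str n k ++ str n l) (str n (c + (k - c)) ++ str n l)) <|
    comp (rungR c (k - c) l) <|
    comp (eqv (by rw [show k - c + l = k' - c + l' by omega]) :
      Tm R n (str n c ++ str n (k - c + l)) (str n c ++ str n (k' - c + l'))) <|
    comp (rungL c (k' - c) l')
      (eqv (by rw [show c + (k' - c) = k' by omega]))
  else zero

/-- The square `(k, l) → (d, k + l - d) → (k', l')`: first a rung to the left, then a rung to the
right. It is zero if the colours do not fit. -/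
def squareLR (k l k' l' d : ℕ) : Tm R n (str n k ++ str n l) (str n k' ++ str n l') :=
  if h : k + l = k' + l' ∧ k ≤ d ∧ k' ≤ d ∧ d ≤ k + l then
    comp (eqv (by rw [show d - k + (k + l - d) = l by omega]) :
      Tm R n (str n k ++ str n l) (str n k ++ str n (d - k + (k + l - d)))) <|
    comp (rungL k (d - k) (k + l - d)) <|
    comp (eqv (by rw [show k + (d - k) = k' + (d - k') by omega]) :
      Tm R n (str n (k + (d - k)) ++ str n (k + l - d))
        (str n (k' + (d - k')) ++ str n (k + l - d))) <|
    comp (rungR k' (d - k') (k + l - d))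
      (eqv (by rw [show d - k' + (k + l - d) = l' by omega]))
  else zero

end Tm

open Tm

/-- The relations of the MOY category, where `t = q^(1/n)`. The first groups say that diagrams are
the morphisms of the free `R`-linear strict braided spherical category on the trivalent vertices;
the last group, from `bubble` on, consists of the MOY relations. -/
inductive Rel {R : Type u} [CommRing R] {n : ℕ} (t : Rˣ) :
    ∀ {X Y : Word n}, Tm R n X Y → Tm R n X Y → Prop
  -- congruence
  | refl {X Y} (f : Tm R n X Y) : Rel t f f
  | symm {X Y} {f g : Tm R n X Y} : Rel t f g → Rel t g f
  | trans {X Y} {f g h : Tm R n X Y} : Rel t f g → Rel t g h → Rel t f h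
  | add_congr {X Y} {f f' g g' : Tm R n X Y} :
      Rel t f f' → Rel t g g' → Rel t (add f g) (add f' g')
  | smul_congr {X Y} (r : R) {f f' : Tm R n X Y} : Rel t f f' → Rel t (smul r f) (smul r f')
  | comp_congr {X Y Z} {f f' : Tm R n X Y} {g g' : Tm R n Y Z} :
      Rel t f f' → Rel t g g' → Rel t (comp f g) (comp f' g')
  | tensor_congr {X Y X' Y'} {f f' : Tm R n X Y} {g g' : Tm R n X' Y'} :
      Rel t f f' → Rel t g g' → Rel t (tensor f g) (tensor f' g')
  -- `R`-linear category
  | add_assoc {X Y} (f g h : Tm R n X Y) : Rel t (add (add f g) h) (add f (add g h))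
  | add_comm {X Y} (f g : Tm R n X Y) : Rel t (add f g) (add g f)
  | zero_add {X Y} (f : Tm R n X Y) : Rel t (add zero f) f
  | smul_add {X Y} (r : R) (f g : Tm R n X Y) :
      Rel t (smul r (add f g)) (add (smul r f) (smul r g))
  | add_smul {X Y} (r s : R) (f : Tm R n X Y) :
      Rel t (smul (r + s) f) (add (smul r f) (smul s f))
  | mul_smul {X Y} (r s : R) (f : Tm R n X Y) : Rel t (smul (r * s) f) (smul r (smul s f))
  | one_smul {X Y} (f : Tm R n X Y) : Rel t (smul 1 f) f
  | zero_smul {X Y} (f : Tm R n X Y) : Rel t (smul 0 f) zero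
  | id_comp {X Y} (f : Tm R n X Y) : Rel t (comp (idn X) f) f
  | comp_id {X Y} (f : Tm R n X Y) : Rel t (comp f (idn Y)) f
  | comp_assoc {X Y Z W} (f : Tm R n X Y) (g : Tm R n Y Z) (h : Tm R n Z W) :
      Rel t (comp (comp f g) h) (comp f (comp g h))
  | add_comp {X Y Z} (f f' : Tm R n X Y) (g : Tm R n Y Z) :
      Rel t (comp (add f f') g) (add (comp f g) (comp f' g))
  | comp_add {X Y Z} (f : Tm R n X Y) (g g' : Tm R n Y Z) :
      Rel t (comp f (add g g')) (add (comp f g) (comp f g'))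
  | smul_comp {X Y Z} (r : R) (f : Tm R n X Y) (g : Tm R n Y Z) :
      Rel t (comp (smul r f) g) (smul r (comp f g))
  | comp_smul {X Y Z} (r : R) (f : Tm R n X Y) (g : Tm R n Y Z) :
      Rel t (comp f (smul r g)) (smul r (comp f g))
  -- strict monoidal structure, bilinear on morphisms
  | add_tensor {X Y X' Y'} (f f' : Tm R n X Y) (g : Tm R n X' Y') :
      Rel t (tensor (add f f') g) (add (tensor f g) (tensor f' g))
  | tensor_add {X Y X' Y'} (f : Tm R n X Y) (g g' : Tm R n X' Y') :
      Rel t (tensor f (add g g')) (add (tensor f g) (tensor f g'))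
  | smul_tensor {X Y X' Y'} (r : R) (f : Tm R n X Y) (g : Tm R n X' Y') :
      Rel t (tensor (smul r f) g) (smul r (tensor f g))
  | tensor_smul {X Y X' Y'} (r : R) (f : Tm R n X Y) (g : Tm R n X' Y') :
      Rel t (tensor f (smul r g)) (smul r (tensor f g))
  | tensor_id (X Y : Word n) : Rel t (tensor (idn X) (idn Y)) (idn (X ++ Y))
  | tensor_comp {X Y Z X' Y' Z'} (f : Tm R n X Y) (g : Tm R n Y Z) (f' : Tm R n X' Y')
      (g' : Tm R n Y' Z') :
      Rel t (comp (tensor f f') (tensor g g')) (tensor (comp f g) (comp f' g'))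
  | tensor_assoc {X Y X' Y' X'' Y''} (f : Tm R n X Y) (g : Tm R n X' Y') (h : Tm R n X'' Y'') :
      Rel t (comp (tensor (tensor f g) h) (asc Y Y' Y''))
        (comp (asc X X' X'') (tensor f (tensor g h)))
  | nil_tensor {X Y} (f : Tm R n X Y) : Rel t (wl [] f) f
  | tensor_nil {X Y} (f : Tm R n X Y) :
      Rel t (comp (wr f []) (eqv (List.append_nil Y))) (comp (eqv (List.append_nil X)) f)
  -- duality: straightening of strands, and caps over parallel strands
  | zigzag (X : Word n) :
      Rel t (comp (wr (coev X) X) (comp (asc X (dual X) X) (wl X (ev X))))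
        (eqv (List.append_nil X).symm)
  | zigzag_dual (X : Word n) :
      Rel t (comp (wl (dual X) (coev X)) (comp (ascInv (dual X) X (dual X)) (wr (ev X) (dual X))))
        (eqv (List.append_nil (dual X)))
  | ev_append (X Y : Word n) :
      Rel t (ev (X ++ Y))
        (comp (eqv (by simp [dual_append]) :
            Tm R n (dual (X ++ Y) ++ (X ++ Y)) (dual Y ++ ((dual X ++ X) ++ Y))) <|
          comp (wl (dual Y) (wr (ev X) Y)) (ev Y))
  -- a full turn does not change a diagram
  | rot_rot {X Y} (f : Tm R n X Y) :
      Rel t (comp (eqv (dual_dual X).symm) (rot (rot f))) (comp f (eqv (dual_dual Y).symm))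
  -- closing a diagram on the left or on the right gives the same
  | spherical {X} (f : Tm R n X X) :
      Rel t (comp (coev' X) (comp (wl (dual X) f) (ev X)))
        (comp (coev X) (comp (wr f (dual X)) (ev' X)))
  -- braiding: naturality contains the third Reidemeister move, and that strands move over and under
  -- vertices, cups and caps; invertibility is the second Reidemeister move
  | braid_braidInv (X Y : Word n) : Rel t (comp (braid X Y) (braidInv X Y)) (idn (X ++ Y))
  | braidInv_braid (X Y : Word n) : Rel t (comp (braidInv X Y) (braid X Y)) (idn (Y ++ X))
  | braid_natural {X Y X' Y'} (f : Tm R n X Y) (g : Tm R n X' Y') :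
      Rel t (comp (tensor f g) (braid Y Y')) (comp (braid X X') (tensor g f))
  | hexagon_forward (X Y Z : Word n) :
      Rel t (comp (asc X Y Z) (comp (braid X (Y ++ Z)) (asc Y Z X)))
        (comp (wr (braid X Y) Z) (comp (asc Y X Z) (wl Y (braid X Z))))
  | hexagon_reverse (X Y Z : Word n) :
      Rel t (comp (ascInv X Y Z) (comp (braid (X ++ Y) Z) (ascInv Z X Y)))
        (comp (wl X (braid Y Z)) (comp (ascInv X Z Y) (wr (braid X Z) Y)))
  -- bubble relations (for `k = 0` the second one evaluates the circle of colour `l`)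
  | bubble (k l : ℕ) (h : k + l ≤ n) :
      Rel t (comp (spl k l) (mrg k l)) (smul (qbinom (t ^ n) (k + l) k) (idn (str n (k + l))))
  | bubble_right (k l : ℕ) (h : k + l ≤ n) :
      Rel t (comp (eqv (List.append_nil (str n k)).symm) <|
          comp (wl (str n k) (coev (str n l))) <|
          comp (ascInv (str n k) (str n l) (dual (str n l))) <|
          comp (wr (comp (mrg k l) (spl k l)) (dual (str n l))) <|
          comp (asc (str n k) (str n l) (dual (str n l))) <|
          comp (wl (str n k) (ev' (str n l))) <|
          eqv (List.append_nil (str n k)))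
        (smul (qbinom (t ^ n) (n - k) l) (idn (str n k)))
  | bubble_left (k l : ℕ) (h : l + k ≤ n) :
      Rel t (comp (wr (coev' (str n l)) (str n k)) <|
          comp (asc (dual (str n l)) (str n l) (str n k)) <|
          comp (wl (dual (str n l)) (comp (mrg l k) (spl l k))) <|
          comp (ascInv (dual (str n l)) (str n l) (str n k)) <|
          wr (ev (str n l)) (str n k))
        (smul (qbinom (t ^ n) (n - k) l) (idn (str n k)))
  -- the 6j relation and its mirror image
  | merge_assoc (j k l : ℕ) (h : j + k + l ≤ n) :
      Rel t (comp (wr (mrg j k) (str n l)) (mrg (j + k) l))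
        (comp (asc (str n j) (str n k) (str n l)) <|
          comp (wl (str n j) (mrg k l)) <|
          comp (mrg j (k + l)) (eqv (by rw [Nat.add_assoc])))
  | split_assoc (j k l : ℕ) (h : j + k + l ≤ n) :
      Rel t (comp (spl (j + k) l) (wr (spl j k) (str n l)))
        (comp (eqv (by rw [Nat.add_assoc])) <|
          comp (spl j (k + l)) <|
          comp (wl (str n j) (spl k l)) (ascInv (str n j) (str n k) (str n l)))
  -- the box relation and its mirror image
  | box (k l k' l' c : ℕ) (hk : k ≤ n) (hl : l ≤ n) (hk' : k' ≤ n) (hl' : l' ≤ n)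
      (h : k + l = k' + l') (hc : c ≤ k) (hc' : c ≤ k') :
      Rel t (squareRL k l k' l' c)
        (sum (fun d => smul (gbinom (t ^ n) ((k' : ℤ) - l) ((k : ℤ) + k' - c - d))
          (squareLR k l k' l' d)) (k + l + 1))
  | box_mirror (k l k' l' d : ℕ) (hk : k ≤ n) (hl : l ≤ n) (hk' : k' ≤ n) (hl' : l' ≤ n)
      (h : k + l = k' + l') (hd : k ≤ d) (hd' : k' ≤ d) (hd'' : d ≤ k + l) :
      Rel t (squareLR k l k' l' d)
        (sum (fun c => smul (gbinom (t ^ n) ((l : ℤ) - k') ((c : ℤ) + d - k - k'))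
          (squareRL k l k' l' c)) (k + l + 1))
  -- the braid relation for positive crossings, its mirror image, and the same for negative crossings
  | braid_eq (k l : ℕ) (hk : k ≤ n) (hl : l ≤ n) :
      Rel t (braid (str n k) (str n l))
        (smul ((-1) ^ (k * l) * ((t⁻¹ ^ (k * l) : Rˣ) : R))
          (sum (fun c => smul ((-((t ^ n : Rˣ) : R)) ^ c) (squareRL k l l k c)) (k + l + 1)))
  | braid_eq_mirror (k l : ℕ) (hk : k ≤ n) (hl : l ≤ n) :
      Rel t (braid (str n k) (str n l))
        (smul ((-1) ^ (k * l) * ((t⁻¹ ^ (k * l) : Rˣ) : R))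
          (sum (fun d => smul ((-((t ^ n : Rˣ) : R)) ^ (k + l - d)) (squareLR k l l k d))
            (k + l + 1)))
  | braidInv_eq (k l : ℕ) (hk : k ≤ n) (hl : l ≤ n) :
      Rel t (braidInv (str n l) (str n k))
        (smul ((-1) ^ (k * l) * ((t ^ (k * l) : Rˣ) : R))
          (sum (fun c => smul ((-(((t ^ n)⁻¹ : Rˣ) : R)) ^ c) (squareRL k l l k c)) (k + l + 1)))
  | braidInv_eq_mirror (k l : ℕ) (hk : k ≤ n) (hl : l ≤ n) :
      Rel t (braidInv (str n l) (str n k))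
        (smul ((-1) ^ (k * l) * ((t ^ (k * l) : Rˣ) : R))
          (sum (fun d => smul ((-(((t ^ n)⁻¹ : Rˣ) : R)) ^ (k + l - d)) (squareLR k l l k d))
            (k + l + 1)))

/-- The category `MOY(SL_n)` over `R`, with `t = q^(1/n)`: objects are sequences in
`{1^±, …, n^±}`. -/
def MOY (R : Type u) [CommRing R] (n : ℕ) (_t : Rˣ) : Type := Word n

section Category

variable {R : Type u} [CommRing R] {n : ℕ} {t : Rˣ}

/-- Linear combinations of diagrams modulo the relations. -/
def homSetoid (t : Rˣ) (X Y : Word n) : Setoid (Tm R n X Y) where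
  r := Rel t
  iseqv := ⟨Rel.refl, Rel.symm, Rel.trans⟩

/-- Morphisms of `MOY(SL_n)`. -/
def MHom (t : Rˣ) (X Y : Word n) : Type u := Quotient (homSetoid t X Y)

/-- The morphism represented by a linear combination of diagrams. -/
def mk (t : Rˣ) {X Y : Word n} (f : Tm R n X Y) : MHom t X Y := Quotient.mk (homSetoid t X Y) f

theorem mk_eq {X Y : Word n} {f g : Tm R n X Y} (h : Rel t f g) : mk t f = mk t g :=
  Quotient.sound (s := homSetoid t X Y) h

theorem mk_surj {X Y : Word n} (f : MHom t X Y) : ∃ g : Tm R n X Y, mk t g = f :=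
  Quotient.exists_rep f

/-- Vertical composition. -/
def MHom.comp {X Y Z : Word n} (f : MHom t X Y) (g : MHom t Y Z) : MHom t X Z :=
  Quotient.map₂ Tm.comp (fun _ _ h _ _ h' => Rel.comp_congr h h') f g

/-- Horizontal composition. -/
def MHom.tensor {X Y X' Y' : Word n} (f : MHom t X Y) (g : MHom t X' Y') :
    MHom t (X ++ X') (Y ++ Y') :=
  Quotient.map₂ Tm.tensor (fun _ _ h _ _ h' => Rel.tensor_congr h h') f g

instance (X Y : Word n) : Add (MHom t X Y) where
  add f g := Quotient.map₂ Tm.add (fun _ _ h _ _ h' => Rel.add_congr h h') f g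

instance (X Y : Word n) : Zero (MHom t X Y) where
  zero := mk t zero

instance (X Y : Word n) : SMul R (MHom t X Y) where
  smul r f := Quotient.map (Tm.smul r) (fun _ _ h => Rel.smul_congr r h) f

instance (X Y : Word n) : Neg (MHom t X Y) where
  neg f := (-1 : R) • f

instance MHom.addCommGroup (X Y : Word n) : AddCommGroup (MHom t X Y) where
  nsmul := nsmulRec
  zsmul := zsmulRec
  add_assoc := by rintro ⟨f⟩ ⟨g⟩ ⟨h⟩; exact mk_eq (Rel.add_assoc f g h)
  add_comm := by rintro ⟨f⟩ ⟨g⟩; exact mk_eq (Rel.add_comm f g)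
  zero_add := by rintro ⟨f⟩; exact mk_eq (Rel.zero_add f)
  add_zero := by rintro ⟨f⟩; exact mk_eq ((Rel.add_comm _ _).trans (Rel.zero_add f))
  neg_add_cancel := by
    rintro ⟨f⟩
    refine mk_eq ((Rel.add_congr (Rel.refl _) (Rel.one_smul f).symm).trans ?_)
    have h := (Rel.add_smul (t := t) (-1) 1 f).symm
    rw [neg_add_cancel] at h
    exact h.trans (Rel.zero_smul f)

instance MHom.module (X Y : Word n) : Module R (MHom t X Y) where
  one_smul := by rintro ⟨f⟩; exact mk_eq (Rel.one_smul f)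
  mul_smul := by rintro r s ⟨f⟩; exact mk_eq (Rel.mul_smul r s f)
  smul_add := by rintro r ⟨f⟩ ⟨g⟩; exact mk_eq (Rel.smul_add r f g)
  add_smul := by rintro r s ⟨f⟩; exact mk_eq (Rel.add_smul r s f)
  zero_smul := by rintro ⟨f⟩; exact mk_eq (Rel.zero_smul f)
  smul_zero r := by
    refine mk_eq ((Rel.smul_congr r (Rel.zero_smul (t := t) zero).symm).trans ?_)
    have h := (Rel.mul_smul (t := t) r 0 (zero : Tm R n X Y)).symm
    rw [mul_zero] at h
    exact h.trans (Rel.zero_smul _)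

theorem mk_add {X Y : Word n} (f g : Tm R n X Y) : mk t (f.add g) = mk t f + mk t g := rfl

theorem mk_smul {X Y : Word n} (r : R) (f : Tm R n X Y) : mk t (f.smul r) = r • mk t f := rfl

theorem mk_zero {X Y : Word n} : mk t (zero : Tm R n X Y) = 0 := rfl

instance : Category (MOY R n t) where
  Hom X Y := MHom (R := R) (n := n) t X Y
  id X := mk t (idn X)
  comp f g := f.comp g
  id_comp := by rintro X Y ⟨f⟩; exact mk_eq (Rel.id_comp f)
  comp_id := by rintro X Y ⟨f⟩; exact mk_eq (Rel.comp_id f)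
  assoc := by rintro X Y Z W ⟨f⟩ ⟨g⟩ ⟨h⟩; exact mk_eq (Rel.comp_assoc f g h)

/-- The morphism of `MOY(SL_n)` represented by a linear combination of diagrams. -/
def toHom (t : Rˣ) {X Y : Word n} (f : Tm R n X Y) : @Quiver.Hom (MOY R n t) _ X Y := mk t f

instance : Preadditive (MOY R n t) where
  homGroup X Y := MHom.addCommGroup (R := R) (n := n) (t := t) X Y
  add_comp := by rintro X Y Z ⟨f⟩ ⟨f'⟩ ⟨g⟩; exact mk_eq (Rel.add_comp f f' g)
  comp_add := by rintro X Y Z ⟨f⟩ ⟨g⟩ ⟨g'⟩; exact mk_eq (Rel.comp_add f g g')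

instance : Linear R (MOY R n t) where
  homModule X Y := MHom.module (R := R) (n := n) (t := t) X Y
  smul_comp := by rintro X Y Z r ⟨f⟩ ⟨g⟩; exact mk_eq (Rel.smul_comp r f g)
  comp_smul := by rintro X Y Z ⟨f⟩ r ⟨g⟩; exact mk_eq (Rel.comp_smul r f g)

theorem toHom_eqv_comp {X Y Z : Word n} (h : X = Y) (h' : Y = Z) :
    (toHom t (eqv h : Tm R n X Y)) ≫ toHom t (eqv h' : Tm R n Y Z) =
      toHom t (eqv (h.trans h')) := by
  subst h h'
  exact mk_eq (Rel.id_comp _)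

theorem toHom_eqv_refl {X : Word n} (h : X = X) :
    toHom t (eqv h : Tm R n X X) = @CategoryStruct.id (MOY R n t) _ X := rfl

/-- The isomorphism between equal sequences. -/
def eqvIso (t : Rˣ) {X Y : Word n} (h : X = Y) : @Iso (MOY R n t) _ X Y where
  hom := toHom t (eqv h)
  inv := toHom t (eqv h.symm)
  hom_inv_id := by rw [toHom_eqv_comp]; rfl
  inv_hom_id := by rw [toHom_eqv_comp]; rfl

instance : MonoidalCategoryStruct (MOY R n t) where
  tensorObj X Y := List.append X Y
  whiskerLeft X _ _ f := MHom.tensor (mk t (idn X)) f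
  whiskerRight f Y := MHom.tensor f (mk t (idn Y))
  tensorHom f g := MHom.tensor f g
  tensorUnit := ([] : Word n)
  associator X Y Z := eqvIso t (List.append_assoc X Y Z)
  leftUnitor X := eqvIso t (List.nil_append (α := Strand n) X)
  rightUnitor X := eqvIso t (List.append_nil X)

theorem eqv_tensor {X Y X' Y' : Word n} (h : X = Y) (h' : X' = Y') :
    (MHom.tensor (toHom t (eqv h : Tm R n X Y)) (toHom t (eqv h' : Tm R n X' Y'))
      : MHom t (X ++ X') (Y ++ Y')) = toHom t (eqv (by rw [h, h'])) := by
  subst h h'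
  exact mk_eq (Rel.tensor_id _ _)

instance : MonoidalCategory (MOY R n t) :=
  MonoidalCategory.ofTensorHom
    (id_tensorHom_id := fun X Y => mk_eq (Rel.tensor_id X Y))
    (id_tensorHom := fun _ _ _ _ => rfl)
    (tensorHom_id := fun _ _ => rfl)
    (tensorHom_comp_tensorHom := by
      rintro X Y Z X' Y' Z' ⟨f⟩ ⟨f'⟩ ⟨g⟩ ⟨g'⟩
      exact mk_eq (Rel.tensor_comp f g f' g'))
    (associator_naturality := by
      rintro X X' X'' Y Y' Y'' ⟨f⟩ ⟨g⟩ ⟨h⟩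
      exact mk_eq (Rel.tensor_assoc f g h))
    (leftUnitor_naturality := by
      rintro X Y ⟨f⟩
      exact mk_eq ((Rel.comp_id _).trans ((Rel.nil_tensor f).trans (Rel.id_comp f).symm)))
    (rightUnitor_naturality := by
      rintro X Y ⟨f⟩
      exact mk_eq (Rel.tensor_nil f))
    (pentagon := fun W X Y Z => by
      have e1 := eqv_tensor (t := t) (List.append_assoc W X Y) (rfl : (Z : Word n) = Z)
      have e2 := eqv_tensor (t := t) (rfl : (W : Word n) = W) (List.append_assoc X Y Z)
      refine (congrArg₂ (fun a b => MHom.comp a (MHom.comp _ b)) e1 e2).trans ?_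
      refine (congrArg (MHom.comp _) (toHom_eqv_comp _ _)).trans ?_
      exact (toHom_eqv_comp _ _).trans (toHom_eqv_comp _ _).symm)
    (triangle := fun X Y => by
      have e1 := eqv_tensor (t := t) (List.append_nil X) (rfl : (Y : Word n) = Y)
      have e2 := eqv_tensor (t := t) (rfl : (X : Word n) = X) (List.nil_append (α := Strand n) Y)
      refine (congrArg (MHom.comp _) e2).trans ?_
      exact (toHom_eqv_comp _ _).trans e1.symm)

instance : MonoidalPreadditive (MOY R n t) where
  whiskerLeft_zero {X Y Z} := by
    refine mk_eq (((Rel.tensor_congr (Rel.refl (idn X)) (Rel.zero_smul (t := t)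
      (zero : Tm R n Y Z)).symm).trans (Rel.tensor_smul 0 _ _)).trans (Rel.zero_smul _))
  zero_whiskerRight {X Y Z} := by
    refine mk_eq (((Rel.tensor_congr (Rel.zero_smul (t := t)
      (zero : Tm R n Y Z)).symm (Rel.refl (idn X))).trans (Rel.smul_tensor 0 _ _)).trans
      (Rel.zero_smul _))
  whiskerLeft_add := by
    rintro X Y Z ⟨f⟩ ⟨g⟩
    exact mk_eq (Rel.tensor_add _ f g)
  add_whiskerRight := by
    rintro X Y Z ⟨f⟩ ⟨g⟩
    exact mk_eq (Rel.add_tensor f g _)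

instance : MonoidalLinear R (MOY R n t) where
  whiskerLeft_smul := by
    rintro X Y Z r ⟨f⟩
    exact mk_eq (Rel.tensor_smul r _ f)
  smul_whiskerRight := by
    rintro r X Y ⟨f⟩ Z
    exact mk_eq (Rel.smul_tensor r f _)

instance : BraidedCategory (MOY R n t) where
  braiding X Y :=
    { hom := toHom t (braid (R := R) X Y)
      inv := toHom t (braidInv (R := R) X Y)
      hom_inv_id := mk_eq (Rel.braid_braidInv X Y)
      inv_hom_id := mk_eq (Rel.braidInv_braid X Y) }
  braiding_naturality_right := by
    rintro X Y Z ⟨f⟩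
    exact mk_eq (Rel.braid_natural (idn X) f)
  braiding_naturality_left := by
    rintro X Y ⟨f⟩ Z
    exact mk_eq (Rel.braid_natural f (idn Z))
  hexagon_forward X Y Z := mk_eq (Rel.hexagon_forward (R := R) (n := n) X Y Z)
  hexagon_reverse X Y Z := mk_eq (Rel.hexagon_reverse (R := R) (n := n) X Y Z)

end Category

section Rigid

variable {R : Type u} [CommRing R] {n : ℕ} {t : Rˣ}

instance : RightRigidCategory (MOY R n t) where
  rightDual X :=
    { rightDual := dual (n := n) X
      exact :=
        { coevaluation' := toHom t (coev (R := R) X)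
          evaluation' := toHom t (ev (R := R) X)
          coevaluation_evaluation' :=
            Eq.trans (mk_eq (Rel.zigzag_dual (R := R) (n := n) X)) (toHom_eqv_comp _ _).symm
          evaluation_coevaluation' :=
            Eq.trans (mk_eq (Rel.zigzag (R := R) (n := n) X)) (toHom_eqv_comp _ _).symm } }

theorem rightAdjointMate_toHom {X Y : MOY R n t} (f : Tm R n X Y) :
    rightAdjointMate (toHom t f : X ⟶ Y) = toHom t (rot f) := by
  have h : (λ_ (Xᘁ : MOY R n t)).hom = 𝟙 _ := rfl
  unfold rightAdjointMate
  rw [h, Category.comp_id]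
  rfl

theorem eqv_whiskerRight {X Y : MOY R n t} (h : X = Y) (Z : MOY R n t) :
    (toHom t (eqv h) : X ⟶ Y) ▷ Z = toHom t (eqv (congrArg (· ⊗ Z) h)) :=
  eqv_tensor h rfl

theorem eqv_whiskerLeft {X Y : MOY R n t} (h : X = Y) (Z : MOY R n t) :
    Z ◁ (toHom t (eqv h) : X ⟶ Y) = toHom t (eqv (congrArg (Z ⊗ ·) h)) :=
  eqv_tensor rfl h

theorem eqv_comp {X Y Z : MOY R n t} (h : X = Y) (h' : Y = Z) :
    (toHom t (eqv h) : X ⟶ Y) ≫ (toHom t (eqv h') : Y ⟶ Z) = toHom t (eqv (h.trans h')) :=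
  toHom_eqv_comp h h'

theorem mate_eqv {X Y : MOY R n t} (h : X = Y) :
    rightAdjointMate (toHom t (eqv h) : X ⟶ Y) =
      toHom t (eqv (congrArg (dual (n := n)) h.symm)) := by
  subst h
  exact rightAdjointMate_id

theorem rightDualIso_hom_eq {C : Type u} [Category.{v} C] [MonoidalCategory C] {X Y₁ Y₂ : C}
    (p₁ : ExactPairing X Y₁) (p₂ : ExactPairing X Y₂) (g : Y₁ ⟶ Y₂)
    (hg : g ▷ X ≫ p₂.evaluation' = p₁.evaluation') : (rightDualIso p₁ p₂).hom = g := by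
  have h := @rightAdjointMate_comp_evaluation C _ _ X X ⟨Y₂⟩ ⟨Y₁⟩ (𝟙 X)
  rw [MonoidalCategory.whiskerLeft_id, Category.id_comp] at h
  have h2 : (rightDualIso p₁ p₂).hom ▷ X ≫ p₂.evaluation' = g ▷ X ≫ p₂.evaluation' :=
    h.trans hg.symm
  have h3 := congrArg (@tensorRightHomEquiv C _ _ Y₁ X Y₂ (𝟙_ C) p₂) h2
  have e := fun f : Y₁ ⟶ Y₂ =>
    @tensorRightHomEquiv_whiskerRight_comp_evaluation C _ _ X Y₁ ⟨Y₂⟩ f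
  exact (cancel_mono _).1 (((e _).symm.trans h3).trans (e _))

theorem tensor_evaluation_eq {C : Type u} [Category.{v} C] [MonoidalCategory C] (X Y : C)
    [HasRightDual X] [HasRightDual Y] {Z : C} (g : Z ⟶ Yᘁ ⊗ Xᘁ) :
    g ▷ (X ⊗ Y) ≫ (ExactPairing.tensor : ExactPairing (X ⊗ Y) (Yᘁ ⊗ Xᘁ)).evaluation' =
      (g ▷ (X ⊗ Y) ≫ (α_ (Yᘁ) (Xᘁ) (X ⊗ Y)).hom ≫ Yᘁ ◁ (α_ (Xᘁ) X Y).inv) ≫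
        Yᘁ ◁ (ε_ X (Xᘁ) ▷ Y) ≫ Yᘁ ◁ (λ_ Y).hom ≫ ε_ Y (Yᘁ) := by
  change _ ≫ (𝟙 _ ⊗≫ _ ◁ (_ ▷ _) ⊗≫ _) = _
  simp [monoidalComp]

theorem α_eq (X Y Z : MOY R n t) : (X ⊗ Y) ⊗ Z = X ⊗ (Y ⊗ Z) :=
  List.append_assoc (α := Strand n) X Y Z

theorem rightDualTensorIso_hom (X Y : MOY R n t) :
    (rightDualTensorIso X Y).hom = toHom t (eqv (R := R) (dual_append X Y)) := by
  refine rightDualIso_hom_eq _ _ _ ?_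
  refine (tensor_evaluation_eq X Y _).trans ?_
  have e1 := eqv_whiskerRight (t := t) (dual_append X Y) (X ⊗ Y)
  have e2 : Yᘁ ◁ (α_ (Xᘁ) X Y).inv =
      toHom t (eqv (congrArg (Yᘁ ⊗ ·) (α_eq (Xᘁ) X Y).symm)) :=
    eqv_whiskerLeft (α_eq (Xᘁ) X Y).symm (Yᘁ)
  have e3 : Yᘁ ◁ (λ_ Y).hom = 𝟙 (Yᘁ ⊗ Y) := MonoidalCategory.whiskerLeft_id (Yᘁ) Y
  refine (congrArg₂ (fun a b => a ≫ Yᘁ ◁ (ε_ X (Xᘁ) ▷ Y) ≫ b)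
    (congrArg₂ (fun a b => a ≫ (α_ (Yᘁ) (Xᘁ) (X ⊗ Y)).hom ≫ b) e1 e2)
    ((congrArg (fun a => a ≫ ε_ Y (Yᘁ)) e3).trans (Category.id_comp _))).trans ?_
  refine (congrArg (fun a => a ≫ Yᘁ ◁ (ε_ X (Xᘁ) ▷ Y) ≫ ε_ Y (Yᘁ))
    ((congrArg (fun a => _ ≫ a) (toHom_eqv_comp _ _)).trans (toHom_eqv_comp _ _))).trans ?_
  exact (mk_eq (Rel.ev_append (R := R) (t := t) X Y)).symm

theorem rightDualTensorIso_inv (X Y : MOY R n t) :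
    (rightDualTensorIso X Y).inv = toHom t (eqv (R := R) (dual_append X Y).symm) := by
  have h : rightDualTensorIso X Y = eqvIso t (dual_append X Y) :=
    Iso.ext (rightDualTensorIso_hom X Y)
  rw [h]
  rfl

instance : SphericalCategory (MOY R n t) where
  pivot X := eqvIso t (dual_dual (n := n) X).symm
  pivot_naturality := by
    rintro X Y ⟨f⟩
    have e : rightAdjointMate (rightAdjointMate (toHom t f : X ⟶ Y)) = toHom t (rot (rot f)) :=
      (congrArg rightAdjointMate (rightAdjointMate_toHom f)).trans (rightAdjointMate_toHom (rot f))
    exact (mk_eq (Rel.rot_rot f)).symm.trans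
      (congrArg (fun a => (eqvIso t (dual_dual (n := n) X).symm).hom ≫ a) e.symm)
  pivot_tensor X Y := by
    refine Eq.trans ?_ (congrArg₂ (fun a b => a ≫ b) (eqv_tensor (dual_dual (n := n) X).symm
      (dual_dual (n := n) Y).symm) (congrArg₂ (fun a b => a ≫ b) (rightDualTensorIso_inv _ _)
      ((congrArg rightAdjointMate (rightDualTensorIso_hom X Y)).trans (mate_eqv _)))).symm
    exact ((congrArg (fun a => _ ≫ a) (toHom_eqv_comp _ _)).trans (toHom_eqv_comp _ _)).symm
  leftTrace_eq_rightTrace := by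
    rintro X ⟨f⟩
    refine Eq.trans ?_ ((mk_eq (Rel.spherical f)).trans ?_)
    · exact (Category.assoc _ _ _).symm
    · rfl

end Rigid

/-! ### The subcategories `MOY^i(SL_n)` -/

section Sub

variable {R : Type u} [CommRing R] {n : ℕ} {t : Rˣ}

/-- All strands of the sequence have colours with the property `p`. -/
def HasColors (p : ℕ → Prop) (X : Word n) : Prop := ∀ s ∈ X, p s.color

/-- The morphisms of `MOY(SL_n)` that are linear combinations of diagrams all of whose edges have
colours at most `i`. -/
def IsColorLE (i : ℕ) {X Y : MOY R n t} (f : X ⟶ Y) : Prop :=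
  ∃ g : Tm R n X Y, toHom t g = f ∧ g.ColorLE i

/-- `MOY^i(SL_n)`: the objects are the sequences in `{1^±}`, the morphisms are those of `MOY(SL_n)`
that are linear combinations of diagrams with colours at most `i`. (The strands of the objects have
colour `1`, so that `i = 0` has no meaning of its own; it is treated as `i = 1`.) -/
structure MOYSub (R : Type u) [CommRing R] (n : ℕ) (t : Rˣ) (i : ℕ) where
  word : MOY R n t
  color_eq_one : HasColors (n := n) (· = 1) word

theorem color_le_of_eq_one {X : Word n} (hX : ∀ s ∈ X, s.color = 1) (i : ℕ) :
    ∀ s ∈ X, s.color ≤ max i 1 :=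
  fun s hs => (hX s hs).le.trans (le_max_right i 1)

theorem color_append {p : ℕ → Prop} {X Y : Word n} (hX : ∀ s ∈ X, p s.color)
    (hY : ∀ s ∈ Y, p s.color) : ∀ s ∈ X ++ Y, p s.color := by
  intro s hs
  rcases List.mem_append.1 hs with h | h
  exacts [hX s h, hY s h]

theorem color_dual {p : ℕ → Prop} {X : Word n} (hX : ∀ s ∈ X, p s.color) :
    ∀ s ∈ dual X, p s.color := by
  intro s hs
  simp only [dual, List.mem_reverse, List.mem_map] at hs
  obtain ⟨a, ha, rfl⟩ := hs
  exact hX a ha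

variable {i : ℕ}

theorem isColorLE_eqv {X Y : MOY R n t} (h : X = Y) (hX : HasColors (n := n) (· ≤ i) X) :
    IsColorLE i (toHom t (eqv h) : X ⟶ Y) := ⟨eqv h, rfl, hX⟩

theorem IsColorLE.comp {X Y Z : MOY R n t} {f : X ⟶ Y} {g : Y ⟶ Z} (hf : IsColorLE i f)
    (hg : IsColorLE i g) : IsColorLE i (f ≫ g) := by
  obtain ⟨f, rfl, hf⟩ := hf
  obtain ⟨g, rfl, hg⟩ := hg
  exact ⟨Tm.comp f g, rfl, hf, hg⟩

theorem IsColorLE.tensor {X Y X' Y' : MOY R n t} {f : X ⟶ Y} {g : X' ⟶ Y'} (hf : IsColorLE i f)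
    (hg : IsColorLE i g) : IsColorLE i (f ⊗ₘ g) := by
  obtain ⟨f, rfl, hf⟩ := hf
  obtain ⟨g, rfl, hg⟩ := hg
  exact ⟨Tm.tensor f g, rfl, hf, hg⟩

theorem IsColorLE.add {X Y : MOY R n t} {f g : X ⟶ Y} (hf : IsColorLE i f)
    (hg : IsColorLE i g) : IsColorLE i (f + g) := by
  obtain ⟨f, rfl, hf⟩ := hf
  obtain ⟨g, rfl, hg⟩ := hg
  exact ⟨Tm.add f g, rfl, hf, hg⟩

theorem IsColorLE.smul (r : R) {X Y : MOY R n t} {f : X ⟶ Y} (hf : IsColorLE i f) :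
    IsColorLE i (r • f) := by
  obtain ⟨f, rfl, hf⟩ := hf
  exact ⟨Tm.smul r f, rfl, hf⟩

theorem isColorLE_zero {X Y : MOY R n t} : IsColorLE i (0 : X ⟶ Y) := ⟨zero, rfl, trivial⟩

/-- The linear combinations of diagrams with colours at most `i`, as a submodule. -/
def colorLE (i : ℕ) (X Y : MOY R n t) : Submodule R (X ⟶ Y) where
  carrier := {f | IsColorLE i f}
  add_mem' := IsColorLE.add
  zero_mem' := isColorLE_zero
  smul_mem' r _ := IsColorLE.smul r

instance : Category (MOYSub R n t i) where
  Hom X Y := colorLE (max i 1) X.word Y.word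
  id X := ⟨𝟙 X.word, isColorLE_eqv rfl (color_le_of_eq_one X.color_eq_one i)⟩
  comp f g := ⟨f.1 ≫ g.1, f.2.comp g.2⟩
  id_comp f := Subtype.ext (Category.id_comp f.1)
  comp_id f := Subtype.ext (Category.comp_id f.1)
  assoc f g h := Subtype.ext (Category.assoc f.1 g.1 h.1)

instance : Preadditive (MOYSub R n t i) where
  homGroup X Y := inferInstanceAs (AddCommGroup (colorLE (max i 1) X.word Y.word))
  add_comp _ _ _ f f' g := Subtype.ext (Preadditive.add_comp _ _ _ f.1 f'.1 g.1)
  comp_add _ _ _ f g g' := Subtype.ext (Preadditive.comp_add _ _ _ f.1 g.1 g'.1)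

instance : Linear R (MOYSub R n t i) where
  homModule X Y := inferInstanceAs (Module R (colorLE (max i 1) X.word Y.word))
  smul_comp _ _ _ r f g := Subtype.ext (Linear.smul_comp _ _ _ r f.1 g.1)
  comp_smul _ _ _ f r g := Subtype.ext (Linear.comp_smul _ _ _ f.1 r g.1)

/-- Sequences in `{1^±}` that are equal are isomorphic in `MOY^i(SL_n)`. -/
def subIso {X Y : MOYSub R n t i} (h : X.word = Y.word) : X ≅ Y where
  hom := ⟨toHom t (eqv h), isColorLE_eqv h (color_le_of_eq_one X.color_eq_one i)⟩
  inv := ⟨toHom t (eqv h.symm), isColorLE_eqv h.symm (color_le_of_eq_one Y.color_eq_one i)⟩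
  hom_inv_id := Subtype.ext (eqvIso t h).hom_inv_id
  inv_hom_id := Subtype.ext (eqvIso t h).inv_hom_id

instance : MonoidalCategoryStruct (MOYSub R n t i) where
  tensorObj X Y := ⟨X.word ⊗ Y.word, color_append (p := (· = 1)) X.color_eq_one Y.color_eq_one⟩
  whiskerLeft X _ _ f := ⟨X.word ◁ f.1, IsColorLE.tensor
    (isColorLE_eqv rfl (color_le_of_eq_one X.color_eq_one i)) f.2⟩
  whiskerRight f Y := ⟨f.1 ▷ Y.word, IsColorLE.tensor f.2
    (isColorLE_eqv rfl (color_le_of_eq_one Y.color_eq_one i))⟩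
  tensorHom f g := ⟨f.1 ⊗ₘ g.1, f.2.tensor g.2⟩
  tensorUnit := ⟨𝟙_ (MOY R n t), by intro s hs; cases hs⟩
  associator X Y Z := subIso (α_eq X.word Y.word Z.word)
  leftUnitor X := subIso (List.nil_append (α := Strand n) X.word)
  rightUnitor X := subIso (List.append_nil (α := Strand n) X.word)

instance : MonoidalCategory (MOYSub R n t i) where
  tensorHom_def f g := Subtype.ext (MonoidalCategory.tensorHom_def f.1 g.1)
  id_tensorHom_id X Y := Subtype.ext (MonoidalCategory.id_tensorHom_id X.word Y.word)
  tensorHom_comp_tensorHom f g f' g' :=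
    Subtype.ext (MonoidalCategory.tensorHom_comp_tensorHom f.1 g.1 f'.1 g'.1)
  whiskerLeft_id X Y := Subtype.ext (MonoidalCategory.whiskerLeft_id X.word Y.word)
  id_whiskerRight X Y := Subtype.ext (MonoidalCategory.id_whiskerRight X.word Y.word)
  associator_naturality f g h :=
    Subtype.ext (MonoidalCategory.associator_naturality f.1 g.1 h.1)
  leftUnitor_naturality f := Subtype.ext (MonoidalCategory.leftUnitor_naturality f.1)
  rightUnitor_naturality f := Subtype.ext (MonoidalCategory.rightUnitor_naturality f.1)
  pentagon W X Y Z := Subtype.ext (MonoidalCategory.pentagon W.word X.word Y.word Z.word)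
  triangle X Y := Subtype.ext (MonoidalCategory.triangle X.word Y.word)

instance : BraidedCategory (MOYSub R n t i) where
  braiding X Y :=
    { hom := ⟨(β_ X.word Y.word).hom, braid (R := R) X.word Y.word, rfl,
        color_le_of_eq_one X.color_eq_one i, color_le_of_eq_one Y.color_eq_one i⟩
      inv := ⟨(β_ X.word Y.word).inv, braidInv (R := R) X.word Y.word, rfl,
        color_le_of_eq_one X.color_eq_one i, color_le_of_eq_one Y.color_eq_one i⟩
      hom_inv_id := Subtype.ext (β_ X.word Y.word).hom_inv_id
      inv_hom_id := Subtype.ext (β_ X.word Y.word).inv_hom_id }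
  braiding_naturality_right X _ _ f :=
    Subtype.ext (BraidedCategory.braiding_naturality_right X.word f.1)
  braiding_naturality_left f Z :=
    Subtype.ext (BraidedCategory.braiding_naturality_left f.1 Z.word)
  hexagon_forward X Y Z := Subtype.ext (BraidedCategory.hexagon_forward X.word Y.word Z.word)
  hexagon_reverse X Y Z := Subtype.ext (BraidedCategory.hexagon_reverse X.word Y.word Z.word)

instance : MonoidalPreadditive (MOYSub R n t i) where
  whiskerLeft_zero := Subtype.ext MonoidalPreadditive.whiskerLeft_zero
  zero_whiskerRight := Subtype.ext MonoidalPreadditive.zero_whiskerRight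
  whiskerLeft_add f g := Subtype.ext (MonoidalPreadditive.whiskerLeft_add f.1 g.1)
  add_whiskerRight f g := Subtype.ext (MonoidalPreadditive.add_whiskerRight f.1 g.1)

instance : MonoidalLinear R (MOYSub R n t i) where
  whiskerLeft_smul X _ _ r f := Subtype.ext (MonoidalLinear.whiskerLeft_smul X.word r f.1)
  smul_whiskerRight r _ _ f X := Subtype.ext (MonoidalLinear.smul_whiskerRight r f.1 X.word)

instance : RightRigidCategory (MOYSub R n t i) where
  rightDual X :=
    { rightDual := ⟨(X.word)ᘁ, color_dual (p := (· = 1)) X.color_eq_one⟩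
      exact :=
        { coevaluation' := ⟨η_ X.word (X.word)ᘁ, coev (R := R) X.word, rfl,
            color_le_of_eq_one X.color_eq_one i⟩
          evaluation' := ⟨ε_ X.word (X.word)ᘁ, ev (R := R) X.word, rfl,
            color_le_of_eq_one X.color_eq_one i⟩
          coevaluation_evaluation' :=
            Subtype.ext (ExactPairing.coevaluation_evaluation X.word (X.word)ᘁ)
          evaluation_coevaluation' :=
            Subtype.ext (ExactPairing.evaluation_coevaluation X.word (X.word)ᘁ) } }

instance : SphericalCategory (MOYSub R n t i) where
  pivot X := subIso (dual_dual (n := n) X.word).symm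
  pivot_naturality f := Subtype.ext (PivotalCategory.pivot_naturality f.1)
  pivot_tensor X Y := Subtype.ext (PivotalCategory.pivot_tensor X.word Y.word)
  leftTrace_eq_rightTrace f := Subtype.ext (SphericalCategory.leftTrace_eq_rightTrace f.1)

/-- The inclusion `MOY^j(SL_n) ⊆ MOY^i(SL_n)` for `j ≤ i`. -/
def incl (R : Type u) [CommRing R] (n : ℕ) (t : Rˣ) {j i : ℕ} (h : j ≤ i) :
    MOYSub R n t j ⥤ MOYSub R n t i where
  obj X := ⟨X.word, X.color_eq_one⟩
  map f := ⟨f.1, by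
    obtain ⟨g, hg, hc⟩ := f.2
    exact ⟨g, hg, ColorLE.mono (max_le_max_right 1 h) g hc⟩⟩
  map_id _ := rfl
  map_comp _ _ := rfl

/-- The diagram `(j, i - j) → i → (k, i - k)` with one interior edge, of colour `i`. -/
def edgeWeb (R : Type u) (n i j k : ℕ) (hj : j < i) (hk : k < i) :
    Tm R n (str n j ++ str n (i - j)) (str n k ++ str n (i - k)) :=
  comp (mrg j (i - j)) <|
  comp (eqv (by rw [show j + (i - j) = k + (i - k) by omega])) (spl k (i - k))

/-- The expansion of the edge of colour `i` in `edgeWeb`. For `i = 2` it is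
`q • id - q^(1/n) • (positive crossing)`. For `i ≥ 3` it is `1/([j][k])` times the composite of a
rung `(j, i - j) → (1, i - 1)`, of the difference of the square
`(1, i - 1) → (2, i - 2) → (1, i - 1)` and `[i - 2] • id`, and of a rung
`(1, i - 1) → (k, i - k)`. -/
noncomputable def edgeExpansion (t : Rˣ) (i j k : ℕ) (hj : 1 ≤ j) (hj' : j < i) (hk : 1 ≤ k)
    (hk' : k < i) : Tm R n (str n j ++ str n (i - j)) (str n k ++ str n (i - k)) :=
  if h : i = 2 then
    comp (eqv (by rw [show j = 1 by omega, show i - 1 = 1 by omega]) :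
      Tm R n (str n j ++ str n (i - j)) (str n 1 ++ str n 1)) <|
    comp (add (smul ((t ^ n : Rˣ) : R) (idn (str n 1 ++ str n 1)))
      (smul (-(t : R)) (braid (str n 1) (str n 1))))
    (eqv (by rw [show k = 1 by omega, show i - 1 = 1 by omega]))
  else
    smul (Ring.inverse (qint (t ^ n) j * qint (t ^ n) k)) <|
    comp (eqv (by rw [show 1 + (j - 1) = j by omega]) :
      Tm R n (str n j ++ str n (i - j)) (str n (1 + (j - 1)) ++ str n (i - j))) <|
    comp (rungR 1 (j - 1) (i - j)) <|
    comp (eqv (by rw [show j - 1 + (i - j) = i - 1 by omega]) :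
      Tm R n (str n 1 ++ str n (j - 1 + (i - j))) (str n 1 ++ str n (i - 1))) <|
    comp (add (squareLR 1 (i - 1) 1 (i - 1) 2)
      (smul (-qint (t ^ n) (i - 2)) (idn (str n 1 ++ str n (i - 1))))) <|
    comp (eqv (by rw [show k - 1 + (i - k) = i - 1 by omega]) :
      Tm R n (str n 1 ++ str n (i - 1)) (str n 1 ++ str n (k - 1 + (i - k)))) <|
    comp (rungL 1 (k - 1) (i - k))
      (eqv (by rw [show 1 + (k - 1) = k by omega]))

end Sub

end MOYCat

/-! Both categories have the same objects, and their morphisms form submodules of those of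
MOY(SL_n). So everything reduces to `isColorLE_pred`: a morphism with colours at most i between
sequences of colours at most i - 1 is already, in MOY(SL_n), a combination of diagrams with colours
at most i - 1. The functor is then the identity on underlying morphisms. It respects the expansion
of edges because the expansion is an identity of MOY(SL_n): by the box relation (for i = 2, the
braid relation) the edge (1, i - 1) → i → (1, i - 1) has colours at most i - 1, and the 6j and
bubble relations reduce the other edges to it (`edgeExpansion_eq_edgeWeb`).

A strand of colour i may also cross other strands or turn back before it splits. Hence every such
strand is exploded: let s be the split i → 1 ⊗ (i - 1) and p the merge back. The composite p ≫ s is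
an edge that can be expanded. Each generator f : X → Y is replaced by p ≫ f ≫ s, where p and s now
act on whole sequences, and this has small colours: crossings, cups and caps let s and p slide until
they meet. For compositions, the factor s ≫ p in the middle must be turned into the identity. If i <
n, this is a division by the unit [i].

If i = n, invertibility of [n] is not available. Next to a strand of colour 1, however, the box
relation loses the term with an edge of colour n + 1, and s followed by a small web and p is [n - 1]
times the identity. Thus W ⊗ f has small colours for W = 1⁻ ⊗ 1⁺ (`isColorLE_whiskerLeft`). If an
end of f is nonempty, W is created by a cup and absorbed by a strand, so f itself has small colours.

Closed diagrams remain. If such a diagram passes through a sequence with a strand of colour below n,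
it is cut there into two morphisms of the previous kind. Otherwise only strands of colour n are met.
These cross trivially and have circle value 1, so the diagram is a scalar modulo the first type
(`exists_add_smul_id_mem_thru`). This is proved by comparison with standard diagrams that cap off
each downward strand with one of many parallel upward strands. -/

namespace Quantum

variable {R : Type u} [CommRing R]

/-! ### Values of quantum integers and binomial coefficients -/

theorem qint_zero (q : Rˣ) : qint q 0 = 0 := by simp [qint]

theorem qint_one (q : Rˣ) : qint q 1 = 1 := by simp [qint]

theorem qbinom_one_right (q : Rˣ) (m : ℕ) : qbinom q m 1 = qint q m := by
  induction m with
  | zero => simp [qbinom, qint_zero]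
  | succ m ih =>
    rw [qbinom, qbinom, ih, qint_add, qint_one]
    simp

theorem qbinom_self (q : Rˣ) (m : ℕ) : qbinom q m m = 1 := by
  induction m with
  | zero => simp [qbinom]
  | succ m ih => simp [qbinom, ih, qbinom_eq_zero q (Nat.lt_succ_self m)]

end Quantum

/-! ### Vertices and squares as morphisms, and the expansion of an interior edge -/

namespace MOYCat

open Quantum Tm

variable {R : Type u} [CommRing R] {n : ℕ} {t : Rˣ}

theorem toHom_eqv {X Y : MOY R n t} (h : X = Y) :
    toHom t (eqv h : Tm R n X Y) = eqToHom h := by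
  subst h
  rfl

theorem associator_hom_eq (X Y Z : MOY R n t) : (α_ X Y Z).hom = eqToHom (α_eq X Y Z) :=
  toHom_eqv _

theorem associator_inv_eq (X Y Z : MOY R n t) : (α_ X Y Z).inv = eqToHom (α_eq X Y Z).symm :=
  toHom_eqv _

theorem rightUnitor_hom_eq (X : MOY R n t) :
    (ρ_ X).hom = eqToHom (show X ⊗ 𝟙_ _ = X from List.append_nil (α := Strand n) X) := toHom_eqv _

theorem rightUnitor_inv_eq (X : MOY R n t) :
    (ρ_ X).inv = eqToHom (show X = X ⊗ 𝟙_ _ from (List.append_nil (α := Strand n) X).symm) := toHom_eqv _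

/-- The upward strand of colour `k` as an object. -/
def col (k : ℕ) : MOY R n t := str n k

/-- The merging vertex as a morphism. -/
def mg (k l : ℕ) : (col k ⊗ col l : MOY R n t) ⟶ col (k + l) := toHom t (mrg k l)

/-- The splitting vertex as a morphism. -/
def sp (k l : ℕ) : (col (k + l) : MOY R n t) ⟶ col k ⊗ col l := toHom t (spl k l)

theorem col_congr {k k' : ℕ} (h : k = k') : (col k : MOY R n t) = col k' := by rw [h]

theorem col_tensor_congr {k k' l l' : ℕ} (h : k = k') (h' : l = l') :
    (col k ⊗ col l : MOY R n t) = col k' ⊗ col l' := by rw [h, h']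

theorem eqToHom_mg {k k' l l' : ℕ} (h : k = k') (h' : l = l') :
    eqToHom (col_tensor_congr h h') ≫ mg k' l' =
      (mg k l : (col k ⊗ col l : MOY R n t) ⟶ _) ≫ eqToHom (by rw [h, h']) := by
  subst h h'
  simp

theorem sp_eqToHom {k k' l l' : ℕ} (h : k = k') (h' : l = l') :
    sp k l ≫ eqToHom (col_tensor_congr h h') =
      eqToHom (by rw [h, h']) ≫ (sp k' l' : (col (k' + l') : MOY R n t) ⟶ _) := by
  subst h h'
  simp

theorem mg_zero_left (l : ℕ) :
    (mg 0 l : (col 0 ⊗ col l : MOY R n t) ⟶ _) = eqToHom (by simp [col, str_zero]; rfl) := by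
  unfold mg mrg
  rw [dif_neg (by simp), dif_pos rfl]
  exact toHom_eqv _

theorem sp_zero_left (l : ℕ) :
    (sp 0 l : (col (0 + l) : MOY R n t) ⟶ _) = eqToHom (by simp [col, str_zero]; rfl) := by
  unfold sp spl
  rw [dif_neg (by simp), dif_pos rfl]
  exact toHom_eqv _

theorem sp_zero_right (l : ℕ) :
    (sp l 0 : (col (l + 0) : MOY R n t) ⟶ _) =
      eqToHom (by simp [col, str_zero]; exact (List.append_nil _).symm) := by
  unfold sp spl
  rw [dif_neg (by simp)]
  split
  · exact toHom_eqv _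
  · exact toHom_eqv _

theorem mg_zero_right (l : ℕ) :
    (mg l 0 : (col l ⊗ col 0 : MOY R n t) ⟶ _) =
      eqToHom (by simp [col, str_zero]; exact (List.append_nil _)) := by
  unfold mg mrg
  rw [dif_neg (by simp)]
  split
  · exact toHom_eqv _
  · exact toHom_eqv _

theorem sp_mg (k l : ℕ) (h : k + l ≤ n) :
    (sp k l ≫ mg k l : (col (k + l) : MOY R n t) ⟶ _) = qbinom (t ^ n) (k + l) k • 𝟙 _ :=
  mk_eq (Rel.bubble k l h)

theorem mg_assoc (j k l : ℕ) (h : j + k + l ≤ n) :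
    (mg j k ▷ col l ≫ mg (j + k) l : ((col j ⊗ col k) ⊗ col l : MOY R n t) ⟶ _) =
      (α_ _ _ _).hom ≫ col j ◁ mg k l ≫ mg j (k + l) ≫ eqToHom (by rw [Nat.add_assoc]) := by
  rw [← toHom_eqv]
  exact mk_eq (Rel.merge_assoc j k l h)

theorem sp_assoc (j k l : ℕ) (h : j + k + l ≤ n) :
    (sp (j + k) l ≫ sp j k ▷ col l : (col (j + k + l) : MOY R n t) ⟶ _) =
      eqToHom (by rw [Nat.add_assoc]) ≫ sp j (k + l) ≫ col j ◁ sp k l ≫ (α_ _ _ _).inv := by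
  rw [← toHom_eqv]
  exact mk_eq (Rel.split_assoc j k l h)

theorem toHom_smul {X Y : MOY R n t} (r : R) (f : Tm R n X Y) :
    (toHom t (smul r f) : X ⟶ Y) = r • toHom t f := rfl

theorem toHom_sum {X Y : MOY R n t} (f : ℕ → Tm R n X Y) (m : ℕ) :
    (toHom t (Tm.sum f m) : X ⟶ Y) = ∑ j ∈ Finset.range m, toHom t (f j) := by
  induction m with
  | zero => rfl
  | succ m ih =>
    rw [Finset.sum_range_succ, ← ih]
    rfl

/-- The square `squareRL` as a morphism. -/
def sqRL (k l k' l' c : ℕ) : (col k ⊗ col l : MOY R n t) ⟶ col k' ⊗ col l' :=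
  toHom t (squareRL k l k' l' c)

/-- The square `squareLR` as a morphism. -/
def sqLR (k l k' l' d : ℕ) : (col k ⊗ col l : MOY R n t) ⟶ col k' ⊗ col l' :=
  toHom t (squareLR k l k' l' d)

/-- The rung colours are variables with equations, not differences, so that applications can supply
them in simplified form, such as `0`. -/
theorem sqRL_eq {k l k' l' c a b : ℕ} (h : k + l = k' + l' ∧ c ≤ k ∧ c ≤ k')
    (ha : a = k - c) (hb : b = k' - c) :
    (sqRL k l k' l' c : (col k ⊗ col l : MOY R n t) ⟶ _) =
      eqToHom (col_tensor_congr (show k = c + a by omega) rfl) ≫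
      sp c a ▷ col l ≫ (α_ _ _ _).hom ≫ col c ◁ mg a l ≫
      eqToHom (col_tensor_congr rfl (show a + l = b + l' by omega)) ≫
      col c ◁ sp b l' ≫ (α_ _ _ _).inv ≫ mg c b ▷ col l' ≫
      eqToHom (col_tensor_congr (show c + b = k' by omega) rfl) := by
  subst ha hb
  simp only [← toHom_eqv]
  unfold sqRL squareRL
  rw [dif_pos h]
  refine Eq.trans (b := toHom t (eqv _) ≫
    (sp c (k - c) ▷ col l ≫ (α_ _ _ _).hom ≫ col c ◁ mg (k - c) l) ≫
      toHom t (eqv _) ≫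
      (col c ◁ sp (k' - c) l' ≫ (α_ _ _ _).inv ≫ mg c (k' - c) ▷ col l') ≫
      toHom t (eqv _)) rfl ?_
  simp only [Category.assoc]

theorem sqLR_eq {k l k' l' d a b e : ℕ}
    (h : k + l = k' + l' ∧ k ≤ d ∧ k' ≤ d ∧ d ≤ k + l)
    (ha : a = d - k) (hb : b = d - k') (he : e = k + l - d) :
    (sqLR k l k' l' d : (col k ⊗ col l : MOY R n t) ⟶ _) =
      eqToHom (col_tensor_congr rfl (show l = a + e by omega)) ≫
      col k ◁ sp a e ≫ (α_ _ _ _).inv ≫ mg k a ▷ col e ≫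
      eqToHom (col_tensor_congr (show k + a = k' + b by omega) rfl) ≫
      sp k' b ▷ col e ≫ (α_ _ _ _).hom ≫ col k' ◁ mg b e ≫
      eqToHom (col_tensor_congr rfl (show b + e = l' by omega)) := by
  subst ha hb he
  simp only [← toHom_eqv]
  unfold sqLR squareLR
  rw [dif_pos h]
  refine Eq.trans (b := toHom t (eqv _) ≫
    (col k ◁ sp (d - k) (k + l - d) ≫ (α_ _ _ _).inv ≫ mg k (d - k) ▷ col (k + l - d)) ≫
      toHom t (eqv _) ≫
      (sp k' (d - k') ▷ col (k + l - d) ≫ (α_ _ _ _).hom ≫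
        col k' ◁ mg (d - k') (k + l - d)) ≫
      toHom t (eqv _)) rfl ?_
  simp only [Category.assoc]

theorem sqRL_of_not {k l k' l' c : ℕ} (h : ¬(k + l = k' + l' ∧ c ≤ k ∧ c ≤ k')) :
    (sqRL k l k' l' c : (col k ⊗ col l : MOY R n t) ⟶ _) = 0 := by
  unfold sqRL squareRL
  rw [dif_neg h]
  rfl

theorem sqLR_box_mirror {k l k' l' d : ℕ} (hk : k ≤ n) (hl : l ≤ n) (hk' : k' ≤ n) (hl' : l' ≤ n)
    (h : k + l = k' + l') (hd : k ≤ d) (hd' : k' ≤ d) (hd'' : d ≤ k + l) :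
    (sqLR k l k' l' d : (col k ⊗ col l : MOY R n t) ⟶ _) =
      ∑ c ∈ Finset.range (k + l + 1),
        gbinom (t ^ n) ((l : ℤ) - k') ((c : ℤ) + d - k - k') • sqRL k l k' l' c :=
  (mk_eq (Rel.box_mirror k l k' l' d hk hl hk' hl' h hd hd' hd'')).trans (toHom_sum _ _)

theorem braiding_col (k l : ℕ) (hk : k ≤ n) (hl : l ≤ n) :
    (β_ (col k) (col l : MOY R n t)).hom =
      ((-1) ^ (k * l) * ((t⁻¹ ^ (k * l) : Rˣ) : R)) •
        ∑ c ∈ Finset.range (k + l + 1), (-((t ^ n : Rˣ) : R)) ^ c • sqRL k l l k c :=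
  (mk_eq (Rel.braid_eq k l hk hl)).trans
    ((toHom_smul _ _).trans (congrArg _ (toHom_sum _ _)))

theorem col_zero : (col 0 : MOY R n t) = 𝟙_ _ := str_zero n

theorem nil_whiskerLeft {X Y : MOY R n t} (f : X ⟶ Y) :
    𝟙_ (MOY R n t) ◁ f = f :=
  (MonoidalCategory.id_whiskerLeft f).trans
    ((Category.id_comp (f ≫ 𝟙 Y)).trans (Category.comp_id f))

theorem whiskerRight_nil {X Y : MOY R n t} (f : X ⟶ Y) :
    f ▷ 𝟙_ (MOY R n t) =
      eqToHom (show X ⊗ 𝟙_ _ = X from List.append_nil (α := Strand n) X) ≫ f ≫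
        eqToHom (show Y = Y ⊗ 𝟙_ _ from (List.append_nil (α := Strand n) Y).symm) := by
  rw [MonoidalCategory.whiskerRight_id, rightUnitor_hom_eq, rightUnitor_inv_eq]

theorem zero_whiskerLeft_of_eq {Z X Y : MOY R n t} (h : Z = 𝟙_ _) (f : X ⟶ Y) :
    Z ◁ f = eqToHom (by rw [h]; rfl) ≫ f ≫ eqToHom (by rw [h]; rfl) := by
  subst h
  rw [nil_whiskerLeft]
  exact ((Category.id_comp (f ≫ 𝟙 Y)).trans (Category.comp_id f)).symm

/-- The left edge between the rungs has colour 0 and disappears; a merge and a split remain. -/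
theorem sqRL_zero {k l k' l' : ℕ} (h : k + l = k' + l') :
    (sqRL k l k' l' 0 : (col k ⊗ col l : MOY R n t) ⟶ _) =
      mg k l ≫ eqToHom (col_congr h) ≫ sp k' l' := by
  rw [sqRL_eq (a := k) (b := k') ⟨h, Nat.zero_le _, Nat.zero_le _⟩ rfl rfl,
    zero_whiskerLeft_of_eq col_zero, zero_whiskerLeft_of_eq col_zero, sp_zero_left, mg_zero_left,
    associator_hom_eq, associator_inv_eq]
  simp [eqToHom_whiskerRight]

/-- Both rungs have colour 0. -/
theorem sqRL_self (k l : ℕ) :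
    (sqRL k l k l k : (col k ⊗ col l : MOY R n t) ⟶ _) = 𝟙 _ := by
  rw [sqRL_eq (a := 0) (b := 0) ⟨rfl, le_rfl, le_rfl⟩ (by simp) (by simp), sp_zero_right,
    mg_zero_left, sp_zero_left, mg_zero_right, associator_hom_eq, associator_inv_eq]
  simp [eqToHom_whiskerRight, whiskerLeft_eqToHom]

theorem mg_of_lt {k l : ℕ} (hk : k ≠ 0) (hl : l ≠ 0) (h : n < k + l) :
    (mg k l : (col k ⊗ col l : MOY R n t) ⟶ _) = 0 := by
  unfold mg mrg
  rw [dif_neg (by omega), dif_neg hk, dif_neg hl]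
  rfl

/-- The right edge between the rungs would have colour `k + l - c > n`. -/
theorem sqRL_of_lt {k l k' l' c : ℕ} (hl : l ≠ 0) (hc : c < k) (h : n + c < k + l) :
    (sqRL k l k' l' c : (col k ⊗ col l : MOY R n t) ⟶ _) = 0 := by
  by_cases h' : k + l = k' + l' ∧ c ≤ k ∧ c ≤ k'
  · rw [sqRL_eq (a := k - c) (b := k' - c) h' rfl rfl, mg_of_lt (by omega) hl (by omega)]
    simp
  · exact sqRL_of_not h'

/-- The square through `(2, l)` differs from the web with an edge of colour `l + 1` by a multiple
of the identity. -/
theorem sqLR_two {l : ℕ} (hl : l + 1 ≤ n) (hl' : 1 ≤ l) :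
    (sqLR 1 l 1 l 2 : (col 1 ⊗ col l : MOY R n t) ⟶ _) =
      mg 1 l ≫ sp 1 l + qint (t ^ n) (l - 1) • 𝟙 _ := by
  -- The coefficients are `[l - 1 choose c]`. The terms with `c ≥ 2` vanish because `c` may not
  -- exceed the colour 1 of the left strand; `c = 0` is the web and `c = 1` the identity.
  rw [sqLR_box_mirror (by omega) (by omega) (by omega) (by omega) rfl (by omega) (by omega)
    (by omega), Finset.sum_eq_sum_sdiff_singleton_add (i := 0) (by simp),
    Finset.sum_eq_single 1, sqRL_zero rfl, sqRL_self]
  · have e1 : gbinom (t ^ n) ((l : ℤ) - (1 : ℕ)) (((1 : ℕ) : ℤ) + (2 : ℕ) - (1 : ℕ) - (1 : ℕ)) =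
        qint (t ^ n) (l - 1) := by
      have h1 : ((l : ℤ) - (1 : ℕ)) = Int.ofNat (l - 1) := by simp; omega
      rw [h1, show ((1 : ℕ) : ℤ) + (2 : ℕ) - (1 : ℕ) - (1 : ℕ) = Int.ofNat 1 by norm_num]
      exact qbinom_one_right _ _
    have e2 : gbinom (t ^ n) ((l : ℤ) - (1 : ℕ)) (((0 : ℕ) : ℤ) + (2 : ℕ) - (1 : ℕ) - (1 : ℕ)) =
        (1 : R) := by
      have h1 : ((l : ℤ) - (1 : ℕ)) = Int.ofNat (l - 1) := by simp; omega
      rw [h1, show ((0 : ℕ) : ℤ) + (2 : ℕ) - (1 : ℕ) - (1 : ℕ) = Int.ofNat 0 by norm_num]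
      simp [gbinom, qbinom]
    rw [e1, e2]
    simp [add_comm]
  · intro b hb hb1
    have : b ≠ 0 := by simpa using fun h => (Finset.mem_sdiff.1 hb).2 (by simp [h])
    rw [sqRL_of_not (by omega), smul_zero]
  · intro h
    simp at h

/-- The square through `(2, n - 1)` on `(1, n)` is a multiple of the identity. -/
theorem sqLR_two_top (hn : 1 ≤ n) :
    (sqLR 1 n 1 n 2 : (col 1 ⊗ col n : MOY R n t) ⟶ _) = qint (t ^ n) (n - 1) • 𝟙 _ := by
  -- In contrast to `sqLR_two`, the term `c = 0` also vanishes, since it contains an edge of colour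
  -- `n + 1`. Only the identity with coefficient `[n - 1]` is left.
  rw [sqLR_box_mirror (by omega) (by omega) (by omega) (by omega) rfl (by omega) (by omega)
    (by omega), Finset.sum_eq_single 1, sqRL_self]
  · have h1 : ((n : ℤ) - (1 : ℕ)) = Int.ofNat (n - 1) := by simp; omega
    rw [h1, show ((1 : ℕ) : ℤ) + (2 : ℕ) - (1 : ℕ) - (1 : ℕ) = Int.ofNat 1 by norm_num]
    congr 1
    exact qbinom_one_right _ _
  · intro b hb hb1
    rcases Nat.eq_zero_or_pos b with rfl | hb'
    · rw [sqRL_of_lt (by omega) (by omega) (by omega), smul_zero]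
    · rw [sqRL_of_not (by omega), smul_zero]
  · intro h
    simp at h

/-- In the braid relation for two strands of colour 1 only `c = 0` (the web) and `c = 1` (the
identity) contribute. -/
theorem braiding_col_one (hn : 1 ≤ n) :
    (β_ (col 1) (col 1 : MOY R n t)).hom =
      ((t⁻¹ : Rˣ) : R) • (((t ^ n : Rˣ) : R) • 𝟙 _ - mg 1 1 ≫ sp 1 1) := by
  rw [braiding_col 1 1 hn hn, Finset.sum_range_succ, Finset.sum_range_succ, Finset.sum_range_succ,
    Finset.sum_range_zero, sqRL_zero rfl, sqRL_self, sqRL_of_not (by omega)]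
  simp [smul_sub, ← sub_eq_add_neg]
  abel

theorem mg_sp_one (hn : 1 ≤ n) :
    (mg 1 1 ≫ sp 1 1 : (col 1 ⊗ col 1 : MOY R n t) ⟶ _) =
      ((t ^ n : Rˣ) : R) • 𝟙 _ + (-(t : R)) • (β_ (col 1) (col 1 : MOY R n t)).hom := by
  rw [braiding_col_one hn, smul_smul]
  simp

/-- The terms `c < n` of the braid relation contain an edge of colour `2 n - c > n`. The term `c =
n` is the identity with coefficient `(-1)^(n² + n) t^(-n²) (t^n)^n = 1`. -/
theorem braiding_col_top :
    (β_ (col n) (col n : MOY R n t)).hom = 𝟙 _ := by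
  rcases Nat.eq_zero_or_pos n with rfl | hn
  · rw [braiding_col 0 0 le_rfl le_rfl]
    simp [sqRL_self]
  rw [braiding_col n n le_rfl le_rfl, Finset.sum_eq_single n, sqRL_self, smul_smul]
  · convert one_smul R _ using 2
    rw [neg_pow ((t ^ n : Rˣ) : R), mul_mul_mul_comm, ← pow_add,
      Even.neg_one_pow (by rw [← Nat.mul_add_one]; exact Nat.even_mul_succ_self n), one_mul,
      ← Units.val_pow_eq_pow_val, ← Units.val_mul, ← pow_mul, ← mul_pow]
    simp
  · intro b hb hb'
    rcases lt_or_ge b n with h | h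
    · rw [sqRL_of_lt (by omega) h (by omega), smul_zero]
    · rw [sqRL_of_not (by omega), smul_zero]
  · intro h
    simp at h

theorem toHom_edgeWeb (i j k : ℕ) (hj : j < i) (hk : k < i) :
    toHom t (edgeWeb R n i j k hj hk) =
      (mg j (i - j) ≫ eqToHom (col_congr (by omega)) ≫ sp k (i - k) :
        (col j ⊗ col (i - j) : MOY R n t) ⟶ _) := by
  rw [← toHom_eqv]
  rfl

/-- The 6j relation moves the two merges together on the left; there `1 + a` splits and merges
again, which is a bubble of value `[1 + a]`. -/
theorem rungR_mg {a l : ℕ} (h : 1 + a + l ≤ n) :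
    (sp 1 a ▷ col l ≫ (α_ _ _ _).hom ≫ col 1 ◁ mg a l ≫ mg 1 (a + l) :
      (col (1 + a) ⊗ col l : MOY R n t) ⟶ _) =
      qint (t ^ n) (1 + a) • mg (1 + a) l ≫ eqToHom (col_congr (by omega)) := by
  have h1 := mg_assoc (R := R) (t := t) (n := n) 1 a l (by omega)
  have h2 : (sp 1 a ▷ col l ≫ mg 1 a ▷ col l ≫ mg (1 + a) l :
      (col (1 + a) ⊗ col l : MOY R n t) ⟶ _) = qint (t ^ n) (1 + a) • mg (1 + a) l := by
    rw [← comp_whiskerRight_assoc, sp_mg _ _ (by omega), MonoidalLinear.smul_whiskerRight]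
    have : qbinom (t ^ n) (1 + a) 1 = (qint (t ^ n) (1 + a) : R) := qbinom_one_right _ _
    simp [this]
  rw [h1] at h2
  rw [← Linear.smul_comp, ← h2]
  simp

theorem sp_rungL {a l : ℕ} (h : 1 + a + l ≤ n) :
    (sp 1 (a + l) ≫ col 1 ◁ sp a l ≫ (α_ _ _ _).inv ≫ mg 1 a ▷ col l :
      (col (1 + (a + l)) : MOY R n t) ⟶ _) =
      qint (t ^ n) (1 + a) • eqToHom (col_congr (by omega)) ≫ sp (1 + a) l := by
  have h1 := sp_assoc (R := R) (t := t) (n := n) 1 a l (by omega)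
  have h2 : (sp (1 + a) l ≫ sp 1 a ▷ col l ≫ mg 1 a ▷ col l :
      (col (1 + a + l) : MOY R n t) ⟶ _) = qint (t ^ n) (1 + a) • sp (1 + a) l := by
    rw [← comp_whiskerRight, sp_mg _ _ (by omega), MonoidalLinear.smul_whiskerRight]
    have : qbinom (t ^ n) (1 + a) 1 = (qint (t ^ n) (1 + a) : R) := qbinom_one_right _ _
    simp [this]
  rw [← Category.assoc, h1] at h2
  rw [← Linear.comp_smul, ← h2]
  simp

/-- By `sqLR_two` with `l = i - 1`, subtracting `[i - 2]` from the square leaves the edge of colour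
`i` between two copies of `(1, i - 1)`. The outer rungs are absorbed by its vertices and contribute
the factors `[j]` and `[k]`. -/
theorem expansion_eq {i j k : ℕ} (hi : 3 ≤ i) (hin : i ≤ n) (hj : 1 ≤ j) (hj' : j < i)
    (hk : 1 ≤ k) (hk' : k < i) :
    (eqToHom (col_tensor_congr (show j = 1 + (j - 1) by omega) rfl) ≫
      (sp 1 (j - 1) ▷ col (i - j) ≫ (α_ _ _ _).hom ≫ col 1 ◁ mg (j - 1) (i - j)) ≫
      eqToHom (col_tensor_congr rfl (show j - 1 + (i - j) = i - 1 by omega)) ≫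
      (sqLR 1 (i - 1) 1 (i - 1) 2 + (-qint (t ^ n) (i - 2)) • 𝟙 _) ≫
      eqToHom (col_tensor_congr rfl (show i - 1 = k - 1 + (i - k) by omega)) ≫
      (col 1 ◁ sp (k - 1) (i - k) ≫ (α_ _ _ _).inv ≫ mg 1 (k - 1) ▷ col (i - k)) ≫
      eqToHom (col_tensor_congr (show 1 + (k - 1) = k by omega) rfl) :
        (col j ⊗ col (i - j) : MOY R n t) ⟶ _) =
      (qint (t ^ n) j * qint (t ^ n) k) •
        (mg j (i - j) ≫ eqToHom (col_congr (by omega)) ≫ sp k (i - k)) := by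
  have h1 : (sqLR 1 (i - 1) 1 (i - 1) 2 + (-qint (t ^ n) (i - 2)) • 𝟙 _ :
      (col 1 ⊗ col (i - 1) : MOY R n t) ⟶ _) = mg 1 (i - 1) ≫ sp 1 (i - 1) := by
    rw [sqLR_two (by omega) (by omega), Nat.sub_sub, add_assoc, ← add_smul]
    simp
  have h2 := eqToHom_mg (R := R) (n := n) (t := t) (show 1 = 1 from rfl)
    (show j - 1 + (i - j) = i - 1 by omega)
  have h3 := sp_eqToHom (R := R) (n := n) (t := t) (show 1 = 1 from rfl)
    (show i - 1 = k - 1 + (i - k) by omega)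
  have h4 := rungR_mg (R := R) (n := n) (t := t) (a := j - 1) (l := i - j) (by omega)
  have h5 := sp_rungL (R := R) (n := n) (t := t) (a := k - 1) (l := i - k) (by omega)
  have h6 := eqToHom_mg (R := R) (n := n) (t := t) (show j = 1 + (j - 1) by omega)
    (show i - j = i - j from rfl)
  have h7 := sp_eqToHom (R := R) (n := n) (t := t) (show 1 + (k - 1) = k by omega)
    (show i - k = i - k from rfl)
  have h4' : qint (t ^ n) (1 + (j - 1)) = (qint (t ^ n) j : R) := by congr 1; omega
  have h5' : qint (t ^ n) (1 + (k - 1)) = (qint (t ^ n) k : R) := by congr 1; omega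
  rw [h1]
  simp only [Category.assoc]
  rw [reassoc_of% h2, reassoc_of% h3, reassoc_of% h4, reassoc_of% h5, h4', h5']
  simp only [Linear.smul_comp, Linear.comp_smul, Category.assoc, smul_smul]
  rw [reassoc_of% h6, h7, mul_comm]
  simp

/-- The expansion rule holds in MOY(SL_n) itself: for `i ≥ 3` by division of `expansion_eq` by the
unit `[j][k]`, for `i = 2` by solving the braid relation for the web. -/
theorem edgeExpansion_eq_edgeWeb {i j k : ℕ} (hi : 2 ≤ i) (hin : i ≤ n)
    (hunit : ∀ k : ℕ, 1 ≤ k → k < n → IsUnit (qint (t ^ n) k))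
    (hj : 1 ≤ j) (hj' : j < i) (hk : 1 ≤ k) (hk' : k < i) :
    toHom t (edgeWeb R n i j k hj' hk') = toHom t (edgeExpansion t i j k hj hj' hk hk') := by
  rw [toHom_edgeWeb]
  by_cases h2 : i = 2
  · subst h2
    obtain rfl : j = 1 := by omega
    obtain rfl : k = 1 := by omega
    unfold edgeExpansion
    rw [dif_pos rfl]
    have h := mg_sp_one (R := R) (n := n) (t := t) (by omega)
    refine Eq.trans (b := 𝟙 _ ≫ (mg 1 1 ≫ sp 1 1) ≫ 𝟙 _) (by simp) ?_
    rw [h]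
    rfl
  · unfold edgeExpansion
    rw [dif_neg h2]
    have h := expansion_eq (R := R) (n := n) (t := t) (by omega : 3 ≤ i) hin hj hj' hk hk'
    have hu := (hunit j hj (by omega)).mul (hunit k hk (by omega))
    have h' := congrArg (Ring.inverse (qint (t ^ n) j * qint (t ^ n) k) • ·) h
    simp only [smul_smul, Ring.inverse_mul_cancel _ hu, one_smul] at h'
    rw [← h']
    simp only [← toHom_eqv]
    rfl

/-! ### Colours that occur in the expansion -/

theorem color_str {k : ℕ} {s : Strand n} (hs : s ∈ str n k) : s.color = k := by
  unfold str at hs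
  split at hs
  · simp only [List.mem_singleton] at hs
    subst hs
    rfl
  · simp at hs

theorem color_str_le {k m : ℕ} (h : k ≤ m) : HasColors (n := n) (· ≤ m) (str n k) :=
  fun _ hs => (color_str hs).trans_le h

theorem color_str_append_le {k l m : ℕ} (h : k ≤ m) (h' : l ≤ m) :
    HasColors (n := n) (· ≤ m) (str n k ++ str n l) :=
  color_append (p := (· ≤ m)) (color_str_le h) (color_str_le h')

theorem colorLE_mrg {R : Type u} {k l m : ℕ} (h : k + l ≤ m) : (mrg k l : Tm R n _ _).ColorLE m := by
  unfold mrg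
  split_ifs
  · exact h
  · exact color_str_append_le (by omega) (by omega)
  · exact color_str_append_le (by omega) (by omega)
  · trivial

theorem colorLE_spl {R : Type u} {k l m : ℕ} (h : k + l ≤ m) : (spl k l : Tm R n _ _).ColorLE m := by
  unfold spl
  split_ifs
  · exact h
  · exact color_str_le (by omega)
  · exact color_str_le (by omega)
  · trivial

theorem colorLE_rungR {R : Type u} {c a l m : ℕ} (h : c + a ≤ m) (h' : a + l ≤ m) :
    (rungR c a l : Tm R n _ _).ColorLE m :=
  ⟨⟨colorLE_spl h, color_str_le (by omega)⟩,
    color_append (p := (· ≤ m)) (color_str_append_le (by omega) (by omega)) (color_str_le (by omega)),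
    color_str_le (by omega), colorLE_mrg h'⟩

theorem colorLE_rungL {R : Type u} {c a l m : ℕ} (h : c + a ≤ m) (h' : a + l ≤ m) :
    (rungL c a l : Tm R n _ _).ColorLE m :=
  ⟨⟨color_str_le (by omega), colorLE_spl h'⟩,
    color_append (p := (· ≤ m)) (color_str_le (by omega)) (color_str_append_le (by omega) (by omega)),
    colorLE_mrg h, color_str_le (by omega)⟩

theorem colorLE_squareLR {R : Type u} {k l k' l' d m : ℕ} (hl : l ≤ m) (hl' : l' ≤ m) (hd : d ≤ m) :
    (squareLR k l k' l' d : Tm R n _ _).ColorLE m := by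
  unfold squareLR
  split_ifs with h
  · refine ⟨color_str_append_le (by omega) (by omega), colorLE_rungL (by omega) (by omega),
      color_str_append_le (by omega) (by omega), colorLE_rungR (by omega) (by omega),
      color_str_append_le (by omega) (by omega)⟩
  · trivial

theorem colorLE_edgeExpansion {i j k : ℕ} (hi : 2 ≤ i) (hj : 1 ≤ j) (hj' : j < i) (hk : 1 ≤ k)
    (hk' : k < i) :
    (edgeExpansion (R := R) (n := n) t i j k hj hj' hk hk').ColorLE (i - 1) := by
  unfold edgeExpansion
  split_ifs with h
  · refine ⟨color_str_append_le (by omega) (by omega), ⟨?_, ?_⟩,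
      color_str_append_le (by omega) (by omega)⟩
    · exact color_str_append_le (by omega) (by omega)
    · exact ⟨color_str_le (by omega), color_str_le (by omega)⟩
  · refine ⟨color_str_append_le (by omega) (by omega), colorLE_rungR (by omega) (by omega),
      color_str_append_le (by omega) (by omega), ⟨?_, ?_⟩,
      color_str_append_le (by omega) (by omega), colorLE_rungL (by omega) (by omega),
      color_str_append_le (by omega) (by omega)⟩
    · exact colorLE_squareLR (by omega) (by omega) (by omega)
    · exact color_str_append_le (by omega) (by omega)

end MOYCat

/-! ### Conjugation by a crossing -/

namespace CategoryTheory

section ConjBraid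

variable {C : Type u} [Category.{v} C] [MonoidalCategory C] [BraidedCategory C]

/-- A morphism `W ⊗ B ⟶ W ⊗ B'` acting on `W ⊗ (A ⊗ B)`, where `W` passes in front of `A`. -/
def conjBraid (W A : C) {B B' : C} (g : W ⊗ B ⟶ W ⊗ B') : W ⊗ (A ⊗ B) ⟶ W ⊗ (A ⊗ B') :=
  (α_ W A B).inv ≫ (β_ W A).hom ▷ B ≫ (α_ A W B).hom ≫ A ◁ g ≫ (α_ A W B').inv ≫
    (β_ W A).inv ▷ B' ≫ (α_ W A B').hom

/-- A morphism that does not involve `W` slides through the crossing of `W` with `A`, and the two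
crossings cancel. -/
theorem conjBraid_whiskerLeft (W A : C) {B B' : C} (g : B ⟶ B') :
    conjBraid W A (W ◁ g) = W ◁ (A ◁ g) := by
  unfold conjBraid
  have h1 : (α_ A W B).hom ≫ A ◁ W ◁ g ≫ (α_ A W B').inv = (A ⊗ W) ◁ g := by simp
  have h2 : (β_ W A).hom ▷ B ≫ (A ⊗ W) ◁ g = (W ⊗ A) ◁ g ≫ (β_ W A).hom ▷ B' :=
    whisker_exchange _ _ |>.symm
  rw [reassoc_of% h1, reassoc_of% h2]
  simp

theorem conjBraid_comp (W A : C) {B B' B'' : C} (g : W ⊗ B ⟶ W ⊗ B') (g' : W ⊗ B' ⟶ W ⊗ B'') :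
    conjBraid W A (g ≫ g') = conjBraid W A g ≫ conjBraid W A g' := by
  unfold conjBraid
  simp

theorem conjBraid_id (W A B : C) : conjBraid W A (𝟙 (W ⊗ B)) = 𝟙 _ := by
  unfold conjBraid
  simp

/-- Colour bounds will be known for `W ◁ f` and `W ◁ g` only, not for `f` and `g`. So the single
strand word `W` has to serve both: it stands next to `f`, then crosses `A'` in order to stand next
to `g`. -/
theorem whiskerLeft_tensor_eq_conjBraid (W : C) {A A' B B' : C} (f : A ⟶ A') (g : B ⟶ B') :
    W ◁ (f ⊗ₘ g) =
      (α_ W A B).inv ≫ (W ◁ f) ▷ B ≫ (α_ W A' B).hom ≫ conjBraid W A' (W ◁ g) := by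
  rw [conjBraid_whiskerLeft, MonoidalCategory.tensorHom_def]
  simp

end ConjBraid

end CategoryTheory

/-! ### Stability of colour bounds, and explosions of strands -/

namespace MOYCat

open Quantum Tm

variable {R : Type u} [CommRing R] {n : ℕ} {t : Rˣ}

/-- All strands have colours at most `m`. -/
abbrev ColorsLE (m : ℕ) (X : MOY R n t) : Prop := HasColors (n := n) (· ≤ m) X

section Closure

variable {m : ℕ} {X Y Z X' Y' : MOY R n t}

theorem ColorsLE.tensor (hX : ColorsLE m X) (hY : ColorsLE m Y) : ColorsLE m (X ⊗ Y) :=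
  color_append (p := (· ≤ m)) hX hY

theorem ColorsLE.dual (hX : ColorsLE m X) : ColorsLE m (Xᘁ) :=
  color_dual (p := (· ≤ m)) hX

theorem ColorsLE.of_tensor_left (h : ColorsLE m (X ⊗ Y)) : ColorsLE m X :=
  fun s hs => h s (List.mem_append_left _ hs)

theorem ColorsLE.of_tensor_right (h : ColorsLE m (X ⊗ Y)) : ColorsLE m Y :=
  fun s hs => h s (List.mem_append_right _ hs)

theorem colorsLE_unit : ColorsLE m (𝟙_ (MOY R n t)) := fun s hs => by cases hs

theorem colorsLE_col {k : ℕ} (h : k ≤ m) : ColorsLE m (col k : MOY R n t) := color_str_le h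

theorem isColorLE_eqToHom (h : X = Y) (hX : ColorsLE m X) : IsColorLE m (eqToHom h) := by
  rw [← toHom_eqv]
  exact isColorLE_eqv h hX

theorem isColorLE_id (hX : ColorsLE m X) : IsColorLE m (𝟙 X) := isColorLE_eqv rfl hX

theorem IsColorLE.whiskerLeft {f : X ⟶ Y} (hf : IsColorLE m f) (hZ : ColorsLE m Z) :
    IsColorLE m (Z ◁ f) := IsColorLE.tensor (isColorLE_id hZ) hf

theorem IsColorLE.whiskerRight {f : X ⟶ Y} (hf : IsColorLE m f) (hZ : ColorsLE m Z) :
    IsColorLE m (f ▷ Z) := IsColorLE.tensor hf (isColorLE_id hZ)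

theorem isColorLE_associator_hom (hX : ColorsLE m X) (hY : ColorsLE m Y) (hZ : ColorsLE m Z) :
    IsColorLE m (α_ X Y Z).hom := isColorLE_eqv _ ((hX.tensor hY).tensor hZ)

theorem isColorLE_associator_inv (hX : ColorsLE m X) (hY : ColorsLE m Y) (hZ : ColorsLE m Z) :
    IsColorLE m (α_ X Y Z).inv := isColorLE_eqv _ (hX.tensor (hY.tensor hZ))

theorem isColorLE_braiding_hom (hX : ColorsLE m X) (hY : ColorsLE m Y) :
    IsColorLE m (β_ X Y).hom := ⟨Tm.braid (n := n) X Y, rfl, hX, hY⟩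

theorem isColorLE_braiding_inv (hX : ColorsLE m X) (hY : ColorsLE m Y) :
    IsColorLE m (β_ X Y).inv := ⟨Tm.braidInv (n := n) X Y, rfl, hX, hY⟩

theorem isColorLE_evaluation (hX : ColorsLE m X) : IsColorLE m (ε_ X Xᘁ) :=
  ⟨Tm.ev (n := n) X, rfl, hX⟩

theorem isColorLE_coevaluation (hX : ColorsLE m X) : IsColorLE m (η_ X Xᘁ) :=
  ⟨Tm.coev (n := n) X, rfl, hX⟩

theorem isColorLE_mg {k l : ℕ} (h : k + l ≤ m) :
    IsColorLE m (mg k l : (col k ⊗ col l : MOY R n t) ⟶ _) := ⟨mrg k l, rfl, colorLE_mrg h⟩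

theorem isColorLE_sp {k l : ℕ} (h : k + l ≤ m) :
    IsColorLE m (sp k l : (col (k + l) : MOY R n t) ⟶ _) := ⟨spl k l, rfl, colorLE_spl h⟩

theorem isColorLE_pivot_hom (hX : ColorsLE m X) : IsColorLE m (PivotalCategory.pivot X).hom :=
  isColorLE_eqv _ hX

theorem isColorLE_pivot_inv (hX : ColorsLE m X) : IsColorLE m (PivotalCategory.pivot X).inv :=
  isColorLE_eqv _ hX.dual.dual

theorem IsColorLE.mate {f : X ⟶ Y} (hf : IsColorLE m f) (hX : ColorsLE m X)
    (hY : ColorsLE m Y) : IsColorLE m (fᘁ) := by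
  unfold rightAdjointMate
  refine (isColorLE_eqv _ hY.dual).comp ?_
  refine ((isColorLE_coevaluation hX).whiskerLeft hY.dual).comp ?_
  refine ((hf.whiskerRight hX.dual).whiskerLeft hY.dual).comp ?_
  refine (isColorLE_associator_inv hY.dual hY hX.dual).comp ?_
  refine ((isColorLE_evaluation hY).whiskerRight hX.dual).comp ?_
  exact isColorLE_eqv _ hX.dual

theorem IsColorLE.conjBraid {W A B B' : MOY R n t} {g : W ⊗ B ⟶ W ⊗ B'} (hg : IsColorLE m g)
    (hW : ColorsLE m W) (hA : ColorsLE m A) (hB : ColorsLE m B) (hB' : ColorsLE m B') :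
    IsColorLE m (conjBraid W A g) := by
  unfold CategoryTheory.conjBraid
  refine (isColorLE_associator_inv hW hA hB).comp ?_
  refine ((isColorLE_braiding_hom hW hA).whiskerRight hB).comp ?_
  refine (isColorLE_associator_hom hA hW hB).comp ?_
  refine (hg.whiskerLeft hA).comp ?_
  refine (isColorLE_associator_inv hA hW hB').comp ?_
  refine ((isColorLE_braiding_inv hW hA).whiskerRight hB').comp ?_
  exact isColorLE_associator_hom hW hA hB'

end Closure

/-- The ends of the morphism have colours at most `i`, or the morphism is zero. -/
def EndsLE (i : ℕ) {X Y : MOY R n t} (f : X ⟶ Y) : Prop :=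
  (ColorsLE i X ∧ ColorsLE i Y) ∨ f = 0

section EndsLE

variable {i : ℕ} {X Y Z X' Y' : MOY R n t}

theorem EndsLE.add {f g : X ⟶ Y} (hf : EndsLE i f) (hg : EndsLE i g) : EndsLE i (f + g) := by
  rcases hf with h | rfl
  · exact Or.inl h
  · rwa [zero_add]

theorem EndsLE.smul (r : R) {f : X ⟶ Y} (hf : EndsLE i f) : EndsLE i (r • f) := by
  rcases hf with h | rfl
  · exact Or.inl h
  · exact Or.inr (smul_zero r)

theorem EndsLE.comp {f : X ⟶ Y} {g : Y ⟶ Z} (hf : EndsLE i f) (hg : EndsLE i g) :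
    EndsLE i (f ≫ g) := by
  rcases hf with h | rfl
  · rcases hg with h' | rfl
    · exact Or.inl ⟨h.1, h'.2⟩
    · exact Or.inr Limits.comp_zero
  · exact Or.inr Limits.zero_comp

theorem EndsLE.tensor {f : X ⟶ Y} {g : X' ⟶ Y'} (hf : EndsLE i f) (hg : EndsLE i g) :
    EndsLE i (f ⊗ₘ g) := by
  rcases hf with h | rfl
  · rcases hg with h' | rfl
    · exact Or.inl ⟨h.1.tensor h'.1, h.2.tensor h'.2⟩
    · refine Or.inr ?_
      rw [MonoidalCategory.tensorHom_def, MonoidalPreadditive.whiskerLeft_zero, Limits.comp_zero]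
  · refine Or.inr ?_
    rw [MonoidalCategory.tensorHom_def, MonoidalPreadditive.zero_whiskerRight, Limits.zero_comp]

end EndsLE

/-- `ColorLE` puts no condition on the ends of `zero`. Hence a composition can pass through a
sequence with colours above `i`, but a factor with such an end is the zero morphism. -/
theorem endsLE_toHom {i : ℕ} {X Y : Word n} (f : Tm R n X Y) (hf : f.ColorLE i) :
    EndsLE i (toHom t f) := by
  induction f with
  | zero => exact Or.inr rfl
  | add f g ihf ihg => exact (ihf hf.1).add (ihg hf.2)
  | smul r f ih => exact (ih hf).smul r
  | eqv h => subst h; exact Or.inl ⟨hf, hf⟩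
  | comp f g ihf ihg => exact (ihf hf.1).comp (ihg hf.2)
  | tensor f g ihf ihg => exact (ihf hf.1).tensor (ihg hf.2)
  | merge k l _ _ h =>
    have hkl : k + l ≤ i := hf
    exact Or.inl ⟨color_str_append_le (by omega) (by omega), color_str_le hf⟩
  | split k l _ _ h =>
    have hkl : k + l ≤ i := hf
    exact Or.inl ⟨color_str_le hf, color_str_append_le (by omega) (by omega)⟩
  | braid X Y => exact Or.inl ⟨ColorsLE.tensor hf.1 hf.2, ColorsLE.tensor hf.2 hf.1⟩
  | braidInv X Y => exact Or.inl ⟨ColorsLE.tensor hf.2 hf.1, ColorsLE.tensor hf.1 hf.2⟩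
  | ev X => exact Or.inl ⟨ColorsLE.tensor (ColorsLE.dual hf) hf, colorsLE_unit⟩
  | coev X => exact Or.inl ⟨colorsLE_unit, ColorsLE.tensor hf (ColorsLE.dual hf)⟩

/-- An object `E` with morphisms from and to `X`: strands of `X` are to be exploded in `E`. -/
structure Expl (X : MOY R n t) where
  E : MOY R n t
  s : X ⟶ E
  p : E ⟶ X

namespace Expl

variable {X Y Z : MOY R n t}

theorem ext_of_eqToHom {d d' : Expl X} (e : d.E = d'.E) (hs : d.s ≫ eqToHom e = d'.s)
    (hp : d.p = eqToHom e ≫ d'.p) : d = d' := by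
  obtain ⟨E, s, p⟩ := d
  obtain ⟨E', s', p'⟩ := d'
  obtain rfl : E = E' := e
  simp only [eqToHom_refl, Category.comp_id, Category.id_comp] at hs hp
  rw [hs, hp]

/-- Nothing is exploded. -/
def triv (X : MOY R n t) : Expl X := ⟨X, 𝟙 X, 𝟙 X⟩

/-- Explosion of parallel strands. -/
def tensor (d : Expl X) (d' : Expl Y) : Expl (X ⊗ Y) := ⟨d.E ⊗ d'.E, d.s ⊗ₘ d'.s, d.p ⊗ₘ d'.p⟩

/-- Explosion of the strands with the opposite arrows. -/
def dual (d : Expl X) : Expl (Xᘁ) := ⟨(d.E)ᘁ, (d.p)ᘁ, (d.s)ᘁ⟩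

/-- Explosion of an equal object. -/
def cast (h : X = Y) (d : Expl X) : Expl Y := ⟨d.E, eqToHom h.symm ≫ d.s, d.p ≫ eqToHom h⟩

theorem cast_rfl (h : X = X) (d : Expl X) : d.cast h = d := by
  simp [cast]

theorem triv_tensor_triv (X Y : MOY R n t) : (triv X).tensor (triv Y) = triv (X ⊗ Y) := by
  simp [triv, tensor]

theorem triv_unit_tensor (d : Expl X) : (triv (𝟙_ _)).tensor d = d := by
  refine ext_of_eqToHom (d := (triv (𝟙_ _)).tensor d) (d' := d) rfl ?_ ?_
  · refine (Category.comp_id _).trans ?_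
    exact (id_tensorHom _ _).trans (nil_whiskerLeft _)
  · refine Eq.trans ?_ (Category.id_comp _).symm
    exact (id_tensorHom _ _).trans (nil_whiskerLeft _)

theorem tensor_triv_unit (d : Expl X) :
    d.tensor (triv (𝟙_ _)) = d.cast (List.append_nil (α := Strand n) X).symm := by
  have hX : X ⊗ 𝟙_ (MOY R n t) = X := List.append_nil (α := Strand n) X
  have hE : d.E ⊗ 𝟙_ (MOY R n t) = d.E := List.append_nil (α := Strand n) d.E
  refine ext_of_eqToHom hE ?_ ?_
  · refine (congrArg (· ≫ _) ((tensorHom_id _ _).trans (whiskerRight_nil _))).trans ?_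
    change (eqToHom hX ≫ d.s ≫ eqToHom hE.symm) ≫ eqToHom hE = eqToHom hX ≫ d.s
    simp
  · exact (tensorHom_id _ _).trans (whiskerRight_nil _)

theorem tensor_assoc (d : Expl X) (d' : Expl Y) (d'' : Expl Z) :
    (d.tensor d').tensor d'' = (d.tensor (d'.tensor d'')).cast (α_eq X Y Z).symm := by
  refine ext_of_eqToHom (α_eq _ _ _) ?_ ?_
  · have := MonoidalCategory.associator_naturality d.s d'.s d''.s
    rw [associator_hom_eq, associator_hom_eq] at this
    exact this
  · have := MonoidalCategory.associator_naturality d.p d'.p d''.p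
    rw [associator_hom_eq, associator_hom_eq] at this
    dsimp only [cast, tensor]
    rw [← Category.assoc, ← this]
    simp

end Expl

/-- The explosion of the strand of colour `i` into strands of colours `1` and `i - 1`. -/
def mergeExpl (i : ℕ) (hi : 0 < i) : Expl (col i : MOY R n t) where
  E := col 1 ⊗ col (i - 1)
  s := eqToHom (col_congr (by omega)) ≫ sp 1 (i - 1)
  p := mg 1 (i - 1) ≫ eqToHom (col_congr (by omega))

/-- A single strand as an object. -/
def sg (x : Strand n) : MOY R n t := ([x] : Word n)

theorem hasColors_sg {p : ℕ → Prop} {x : Strand n} (h : p x.color) :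
    HasColors (n := n) p (sg x : MOY R n t) := by
  intro s hs
  obtain rfl : s = x := List.mem_singleton.1 hs
  exact h

theorem col_eq {c : ℕ} (h0 : 0 < c) (h1 : c ≤ n) :
    (col c : MOY R n t) = sg ⟨c, true, h0, h1⟩ := dif_pos ⟨h0, h1⟩

/-- Explosion of strands of colour `i`, other strands are kept. -/
def strandExpl (i : ℕ) : (x : Strand n) → Expl (R := R) (t := t) (sg x)
  | ⟨c, true, h0, h1⟩ =>
      if c = i then (mergeExpl c h0).cast (col_eq h0 h1)
      else Expl.triv (sg ⟨c, true, h0, h1⟩)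
  | ⟨c, false, h0, h1⟩ =>
      if c = i then ((mergeExpl c h0).cast (col_eq h0 h1)).dual
      else Expl.triv (sg ⟨c, false, h0, h1⟩)

/-- Explosion of the strands of colour `i` in a sequence. -/
def wordExpl (i : ℕ) : (X : MOY R n t) → Expl X
  | [] => Expl.triv (𝟙_ (MOY R n t))
  | x :: X => (strandExpl i x).tensor (wordExpl i X)

theorem wordExpl_cons (i : ℕ) (x : Strand n) (X : MOY R n t) :
    wordExpl i (List.cons x X : MOY R n t) = (strandExpl i x).tensor (wordExpl i X) := rfl

theorem wordExpl_tensor (i : ℕ) (X Y : MOY R n t) :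
    wordExpl i (X ⊗ Y) = (wordExpl i X).tensor (wordExpl i Y) := by
  induction X with
  | nil => exact (Expl.triv_unit_tensor _).symm
  | cons x X ih =>
    refine Eq.trans ?_ (Expl.tensor_assoc (strandExpl i x) (wordExpl i X) (wordExpl i Y)).symm
    refine (congrArg (Expl.tensor (strandExpl i x)) ih).trans ?_
    -- Since the left word is a single letter, both bracketings are the same list by unfolding, and
    -- the cast is trivial.
    exact (Expl.cast_rfl _ _).symm

theorem wordExpl_singleton (i : ℕ) (x : Strand n) :
    wordExpl (R := R) (t := t) i (sg x) = strandExpl i x :=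
  (Expl.tensor_triv_unit _).trans (Expl.cast_rfl _ _)

theorem strandExpl_true {i : ℕ} (h0 : 0 < i) (h1 : i ≤ n) :
    strandExpl (R := R) (t := t) i ⟨i, true, h0, h1⟩ = (mergeExpl i h0).cast (col_eq h0 h1) :=
  if_pos rfl

theorem strandExpl_false {i : ℕ} (h0 : 0 < i) (h1 : i ≤ n) :
    strandExpl (R := R) (t := t) i ⟨i, false, h0, h1⟩ =
      ((mergeExpl i h0).cast (col_eq h0 h1)).dual :=
  if_pos rfl

theorem strandExpl_false_eq_dual {i : ℕ} (h0 : 0 < i) (h1 : i ≤ n) :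
    strandExpl (R := R) (t := t) i ⟨i, false, h0, h1⟩ =
      (strandExpl i ⟨i, true, h0, h1⟩).dual := by
  rw [strandExpl_false, strandExpl_true]

theorem strandExpl_eq_triv {i : ℕ} {x : Strand n} (h : x.color ≠ i) :
    strandExpl (R := R) (t := t) i x = Expl.triv (sg x) := by
  rcases x with ⟨c, _ | _, h0, h1⟩
  · exact if_neg h
  · exact if_neg h

theorem wordExpl_eq_triv {i : ℕ} {X : MOY R n t} (h : HasColors (n := n) (· ≠ i) X) :
    wordExpl i X = Expl.triv X := by
  induction X with
  | nil => rfl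
  | cons x X ih =>
    refine (wordExpl_cons i x X).trans ?_
    rw [strandExpl_eq_triv (h x (List.mem_cons_self ..)),
      ih (fun s hs => h s (List.mem_cons_of_mem _ hs))]
    exact Expl.triv_tensor_triv _ _

theorem wordExpl_col {i : ℕ} (hi : 0 < i) (hin : i ≤ n) :
    wordExpl i (col i : MOY R n t) = mergeExpl i hi := by
  -- `col i` is defined by a case distinction and is a one-letter list only up to a proved equality.
  -- A variable object `Y` allows substitution of that equality in the dependent type.
  have h : ∀ (Y : MOY R n t) (e : Y = col i), Y = sg ⟨i, true, hi, hin⟩ →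
      wordExpl i Y = (mergeExpl i hi).cast e.symm := by
    intro Y e hY
    subst hY
    exact (wordExpl_singleton i _).trans (if_pos rfl)
  exact (h _ rfl (col_eq hi hin)).trans (Expl.cast_rfl _ _)

/-- This is how the MOY relations enter the reduction of colours from `i` to `i - 1`: a merge to `i`
that is directly followed by a split can be expanded. -/
theorem isColorLE_edge {i j k : ℕ} (hi : 2 ≤ i) (hin : i ≤ n)
    (hunit : ∀ k : ℕ, 1 ≤ k → k < n → IsUnit (qint (t ^ n) k))
    (hj : 1 ≤ j) (hj' : j < i) (hk : 1 ≤ k) (hk' : k < i) :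
    IsColorLE (i - 1) (mg j (i - j) ≫ eqToHom (col_congr (by omega)) ≫ sp k (i - k) :
      (col j ⊗ col (i - j) : MOY R n t) ⟶ _) := by
  rw [← toHom_edgeWeb (hj := hj') (hk := hk'), edgeExpansion_eq_edgeWeb hi hin hunit hj hj' hk hk']
  exact ⟨_, rfl, colorLE_edgeExpansion hi hj hj' hk hk'⟩

theorem rightDual_rightDual (X : MOY R n t) : ((Xᘁ : MOY R n t)ᘁ : MOY R n t) = X := dual_dual (n := n) X

theorem pivot_hom_eq (X : MOY R n t) :
    (PivotalCategory.pivot X).hom = eqToHom (rightDual_rightDual X).symm := toHom_eqv _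

theorem pivot_inv_eq (X : MOY R n t) :
    (PivotalCategory.pivot X).inv = eqToHom (rightDual_rightDual X) := toHom_eqv _

/-! ### Explosions with small colours, and their cups and caps -/

namespace Expl

variable {m : ℕ} {X : MOY R n t} (d : Expl X)

/-- The exploded object has small colours, and so have merging and exploding. -/
structure Low (m : ℕ) : Prop where
  colors : ColorsLE m d.E
  p_s : IsColorLE m (d.p ≫ d.s)

variable {d}

theorem Low.triv (hX : ColorsLE m X) : (triv X).Low m :=
  ⟨hX, (isColorLE_id hX).comp (isColorLE_id hX)⟩

theorem Low.tensor {Y : MOY R n t} {d' : Expl Y} (h : d.Low m) (h' : d'.Low m) :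
    (d.tensor d').Low m := by
  refine ⟨h.colors.tensor h'.colors, ?_⟩
  have : (d.tensor d').p ≫ (d.tensor d').s = (d.p ≫ d.s) ⊗ₘ (d'.p ≫ d'.s) :=
    tensorHom_comp_tensorHom _ _ _ _
  rw [this]
  exact h.p_s.tensor h'.p_s

theorem Low.dual (h : d.Low m) : d.dual.Low m := by
  refine ⟨h.colors.dual, ?_⟩
  have : d.dual.p ≫ d.dual.s = (d.p ≫ d.s)ᘁ := comp_rightAdjointMate.symm
  rw [this]
  exact h.p_s.mate h.colors h.colors

theorem Low.cast {Y : MOY R n t} (h : d.Low m) (e : X = Y) : (d.cast e).Low m := by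
  subst e
  rwa [cast_rfl]

/-- The dual of `s` on one leg of the cap slides to the other leg, where it becomes `s` and meets
`p`. -/
theorem Low.evaluation (h : d.Low m) : IsColorLE m ((d.dual.tensor d).p ≫ ε_ X Xᘁ) := by
  have : (d.dual.tensor d).p ≫ ε_ X Xᘁ = (d.E)ᘁ ◁ (d.p ≫ d.s) ≫ ε_ d.E (d.E)ᘁ := by
    change ((d.s)ᘁ ⊗ₘ d.p) ≫ _ = _
    rw [tensorHom_def', Category.assoc, rightAdjointMate_comp_evaluation]
    simp
  rw [this]
  exact (h.p_s.whiskerLeft h.colors.dual).comp (isColorLE_evaluation h.colors)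

theorem Low.coevaluation (h : d.Low m) : IsColorLE m (η_ X Xᘁ ≫ (d.tensor d.dual).s) := by
  have : η_ X Xᘁ ≫ (d.tensor d.dual).s = η_ d.E (d.E)ᘁ ≫ (d.p ≫ d.s) ▷ (d.E)ᘁ := by
    change _ ≫ (d.s ⊗ₘ (d.p)ᘁ) = _
    rw [tensorHom_def', coevaluation_comp_rightAdjointMate_assoc]
    simp
  rw [this]
  exact (isColorLE_coevaluation h.colors).comp (h.p_s.whiskerRight h.colors.dual)

/-- This serves caps over downward strands. Their dual strand is the double dual of an upward one,
so naturality of the pivotal structure is needed to let `s` slide around the cap. -/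
theorem Low.evaluation_dual (h : d.Low m) :
    IsColorLE m (((d.cast (rightDual_rightDual X).symm).tensor d.dual).p ≫ ε_ Xᘁ Xᘁᘁ) := by
  have e : ((d.cast (rightDual_rightDual X).symm).tensor d.dual).p ≫ ε_ Xᘁ Xᘁᘁ =
      (d.p ≫ d.s) ▷ (d.E)ᘁ ≫ (PivotalCategory.pivot d.E).hom ▷ _ ≫ ε_ (d.E)ᘁ (d.E)ᘁᘁ := by
    change ((d.p ≫ eqToHom (rightDual_rightDual X).symm) ⊗ₘ (d.s)ᘁ) ≫ _ = _
    rw [MonoidalCategory.tensorHom_def, Category.assoc, ← rightAdjointMate_comp_evaluation,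
      ← comp_whiskerRight_assoc, Category.assoc]
    have h1 := PivotalCategory.pivot_naturality d.s
    rw [pivot_hom_eq X] at h1
    rw [← h1]
    simp
  rw [e]
  exact (h.p_s.whiskerRight h.colors.dual).comp (((isColorLE_pivot_hom h.colors).whiskerRight
    h.colors.dual).comp (isColorLE_evaluation h.colors.dual))

theorem Low.coevaluation_dual (h : d.Low m) :
    IsColorLE m (η_ Xᘁ Xᘁᘁ ≫ (d.dual.tensor (d.cast (rightDual_rightDual X).symm)).s) := by
  have e : η_ Xᘁ Xᘁᘁ ≫ (d.dual.tensor (d.cast (rightDual_rightDual X).symm)).s =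
      η_ (d.E)ᘁ (d.E)ᘁᘁ ≫ _ ◁ (PivotalCategory.pivot d.E).inv ≫ (d.E)ᘁ ◁ (d.p ≫ d.s) := by
    change _ ≫ ((d.p)ᘁ ⊗ₘ (eqToHom (rightDual_rightDual X) ≫ d.s)) = _
    rw [MonoidalCategory.tensorHom_def, ← coevaluation_comp_rightAdjointMate_assoc,
      ← MonoidalCategory.whiskerLeft_comp, ← MonoidalCategory.whiskerLeft_comp]
    have h1 := PivotalCategory.pivot_naturality d.p
    have h2 : (d.p)ᘁᘁ ≫ (PivotalCategory.pivot X).inv =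
        (PivotalCategory.pivot d.E).inv ≫ d.p := by
      rw [Iso.comp_inv_eq, Category.assoc, h1, Iso.inv_hom_id_assoc]
    rw [pivot_inv_eq X] at h2
    rw [reassoc_of% h2]
  rw [e]
  exact (isColorLE_coevaluation h.colors.dual).comp (((isColorLE_pivot_inv h.colors).whiskerLeft
    h.colors.dual).comp (h.p_s.whiskerLeft h.colors.dual))

end Expl

theorem rightDual_tensor (X Y : MOY R n t) : ((X ⊗ Y)ᘁ : MOY R n t) = Yᘁ ⊗ Xᘁ :=
  dual_append (n := n) X Y

theorem rightDual_tensor_tensor (X Y : MOY R n t) :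
    (X ⊗ Y)ᘁ ⊗ (X ⊗ Y) = Yᘁ ⊗ ((Xᘁ ⊗ X) ⊗ Y) := by
  rw [rightDual_tensor, α_eq, α_eq]

theorem tensor_rightDual_tensor (X Y : MOY R n t) :
    X ⊗ ((Y ⊗ Yᘁ) ⊗ Xᘁ) = (X ⊗ Y) ⊗ (X ⊗ Y)ᘁ := by
  rw [rightDual_tensor, α_eq, α_eq]

theorem evaluation_tensor (X Y : MOY R n t) :
    ε_ (X ⊗ Y) (X ⊗ Y)ᘁ =
      eqToHom (rightDual_tensor_tensor X Y) ≫ Yᘁ ◁ (ε_ X Xᘁ ▷ Y) ≫ ε_ Y Yᘁ := by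
  rw [← toHom_eqv]
  exact mk_eq (Rel.ev_append (R := R) (n := n) X Y)

/-- The defining relations contain such a formula for caps only. A dual pair is determined by its
cap, and the comparison of the two duals of `X ⊗ Y` is the identification of words
(`rightDualTensorIso_hom`), so the formula for cups follows. -/
theorem coevaluation_tensor (X Y : MOY R n t) :
    η_ (X ⊗ Y) (X ⊗ Y)ᘁ =
      η_ X Xᘁ ≫ X ◁ (η_ Y Yᘁ ▷ Xᘁ) ≫ eqToHom (tensor_rightDual_tensor X Y) := by
  have h : η_ (X ⊗ Y) (X ⊗ Y)ᘁ ≫ (X ⊗ Y) ◁ (rightDualTensorIso X Y).hom =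
      (ExactPairing.tensor : ExactPairing (X ⊗ Y) (Yᘁ ⊗ Xᘁ)).coevaluation' ≫ 𝟙 _ ▷ _ :=
    @coevaluation_comp_rightAdjointMate (MOY R n t) _ _ (X ⊗ Y) (X ⊗ Y) hasRightDualTensor
      inferInstance (𝟙 _)
  have h2 : (ExactPairing.tensor : ExactPairing (X ⊗ Y) (Yᘁ ⊗ Xᘁ)).coevaluation' =
      η_ X Xᘁ ≫ X ◁ (η_ Y Yᘁ ▷ Xᘁ) ≫
        eqToHom (by rw [α_eq, α_eq]) := by
    refine (ExactPairing.tensor_coevaluation (X₁ := X) (X₂ := Y) (Y₁ := Xᘁ) (Y₂ := Yᘁ)).trans ?_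
    simp [monoidalComp, associator_hom_eq, associator_inv_eq, rightUnitor_inv_eq,
      eqToHom_whiskerRight]
  have h3 : (rightDualTensorIso X Y).hom = eqToHom (rightDual_tensor X Y) :=
    (rightDualTensorIso_hom X Y).trans (toHom_eqv _)
  rw [h3, whiskerLeft_eqToHom, h2, id_whiskerRight, Category.comp_id,
    comp_eqToHom_iff] at h
  rw [h]
  simp

end MOYCat

namespace CategoryTheory

/-- The explosion of the right factor is undone while `W` stands between the two factors; then `W`
returns and undoes the left one. For this `p'` slides past `g`, so that `s'`, `g'`, `p'` become
adjacent. -/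
theorem undo_tensor {C : Type u} [Category.{v} C] [MonoidalCategory C] [BraidedCategory C]
    {W X Y E E' : C} {s : X ⟶ E} {p : E ⟶ X} {s' : Y ⟶ E'} {p' : E' ⟶ Y}
    {g : W ⊗ E ⟶ W ⊗ E} {g' : W ⊗ E' ⟶ W ⊗ E'} (e : W ◁ s ≫ g ≫ W ◁ p = 𝟙 _)
    (e' : W ◁ s' ≫ g' ≫ W ◁ p' = 𝟙 _) :
    W ◁ (s ⊗ₘ s') ≫ (conjBraid W E g' ≫ (α_ _ _ _).inv ≫ g ▷ E' ≫ (α_ _ _ _).hom) ≫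
      W ◁ (p ⊗ₘ p') = 𝟙 _ := by
  have h1 : (α_ _ _ _).inv ≫ g ▷ E' ≫ (α_ _ _ _).hom ≫ W ◁ (p ⊗ₘ p') =
      W ◁ (E ◁ p') ≫ (α_ _ _ _).inv ≫ (g ≫ W ◁ p) ▷ Y ≫ (α_ _ _ _).hom := by
    rw [tensorHom_def']
    have := whisker_exchange g p'
    simp only [comp_whiskerRight, Category.assoc, MonoidalCategory.whiskerLeft_comp,
      tensor_whiskerLeft] at this ⊢
    simp only [← cancel_mono (α_ W E Y).hom, Category.assoc, Iso.inv_hom_id,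
      Category.comp_id] at this
    rw [← reassoc_of% this]
    simp
  have h2 : W ◁ (s ⊗ₘ s') = (α_ _ _ _).inv ≫ (W ◁ s) ▷ Y ≫ (α_ _ _ _).hom ≫
      W ◁ (E ◁ s') := by
    rw [MonoidalCategory.tensorHom_def]
    simp
  have h3 : W ◁ (E ◁ s') ≫ conjBraid W E g' ≫ W ◁ (E ◁ p') = 𝟙 _ := by
    rw [← conjBraid_whiskerLeft, ← conjBraid_whiskerLeft, ← conjBraid_comp, ← conjBraid_comp, e',
      conjBraid_id]
  simp only [Category.assoc]
  rw [h1, h2]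
  simp only [Category.assoc]
  rw [reassoc_of% h3, Iso.hom_inv_id_assoc, ← comp_whiskerRight_assoc, e]
  simp

end CategoryTheory

/-! ### Diagrams between exploded sequences, in the presence of an auxiliary object -/

namespace MOYCat

open Quantum Tm

variable {R : Type u} [CommRing R] {n : ℕ} {t : Rˣ}

/-- In the presence of `W`, an explosion can be undone after a morphism of small colours. -/
def Expl.Undone (m : ℕ) (W : MOY R n t) {X : MOY R n t} (d : Expl X) : Prop :=
  ∃ h : W ⊗ d.E ⟶ W ⊗ d.E, IsColorLE m h ∧ W ◁ d.s ≫ h ≫ W ◁ d.p = 𝟙 _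

theorem Expl.Undone.triv {m : ℕ} {W X : MOY R n t} (hW : ColorsLE m W) (hX : ColorsLE m X) :
    (Expl.triv X).Undone m W :=
  ⟨𝟙 _, isColorLE_id (hW.tensor hX), by simp [Expl.triv]⟩

theorem Expl.Undone.cast {m : ℕ} {W X Y : MOY R n t} {d : Expl X} (h : d.Undone m W) (e : X = Y) :
    (d.cast e).Undone m W := by
  subst e
  rwa [cast_rfl]

theorem Expl.Undone.tensor {m : ℕ} {W X Y : MOY R n t} {d : Expl X} {d' : Expl Y}
    (hW : ColorsLE m W) (hd : ColorsLE m d.E) (hd' : ColorsLE m d'.E)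
    (h : d.Undone m W) (h' : d'.Undone m W) : (d.tensor d').Undone m W := by
  obtain ⟨g, hg, e⟩ := h
  obtain ⟨g', hg', e'⟩ := h'
  refine ⟨conjBraid W d.E g' ≫ (α_ _ _ _).inv ≫ g ▷ d'.E ≫ (α_ _ _ _).hom,
    (hg'.conjBraid hW hd hd' hd').comp ((isColorLE_associator_inv hW hd hd').comp
      ((hg.whiskerRight hd').comp (isColorLE_associator_hom hW hd hd'))), undo_tensor e e'⟩

/-- The strand word `W` allows to undo explosions of strands of colour `i`. -/
structure Undoes (i : ℕ) (W : MOY R n t) : Prop where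
  colors : ColorsLE (i - 1) W
  undone : ∀ x : Strand n, x.color = i → (strandExpl i x).Undone (i - 1) W

/-- The exploded morphism has small colours, in the presence of `W`. -/
def Good (i : ℕ) (W : MOY R n t) {X Y : MOY R n t} (f : X ⟶ Y) : Prop :=
  IsColorLE (i - 1) (W ◁ ((wordExpl i X).p ≫ f ≫ (wordExpl i Y).s))

section

variable {i : ℕ} (hi : 2 ≤ i) (hin : i ≤ n)
  (hunit : ∀ k : ℕ, 1 ≤ k → k < n → IsUnit (qint (t ^ n) k))

include hi hin hunit in
-- Here `p ≫ s` is the interior edge of `isColorLE_edge` with `j = k = 1`.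
theorem low_mergeExpl : (mergeExpl i (by omega) : Expl (col i : MOY R n t)).Low (i - 1) := by
  refine ⟨(colorsLE_col (by omega)).tensor (colorsLE_col le_rfl), ?_⟩
  have h := isColorLE_edge (R := R) (n := n) (t := t) hi hin hunit (j := 1) (k := 1) le_rfl
    (by omega) le_rfl (by omega)
  simpa [mergeExpl] using h

include hi hin hunit in
theorem low_strandExpl (x : Strand n) (hx : x.color ≤ i) :
    (strandExpl (R := R) (t := t) i x).Low (i - 1) := by
  by_cases h : x.color = i
  · rcases x with ⟨c, _ | _, h0, h1⟩
    · obtain rfl : c = i := h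
      rw [strandExpl_false]
      exact ((low_mergeExpl hi hin hunit).cast _).dual
    · obtain rfl : c = i := h
      rw [strandExpl_true]
      exact (low_mergeExpl hi hin hunit).cast _
  · rw [strandExpl_eq_triv h]
    exact Expl.Low.triv (hasColors_sg (by omega))

include hi hin hunit in
theorem low_wordExpl (X : MOY R n t) (hX : ColorsLE i X) : (wordExpl i X).Low (i - 1) := by
  induction X with
  | nil => exact Expl.Low.triv colorsLE_unit
  | cons x X ih =>
    exact (low_strandExpl hi hin hunit x (hX x (List.mem_cons_self ..))).tensor
      (ih fun s hs => hX s (List.mem_cons_of_mem _ hs))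

variable {W : MOY R n t} (hW : Undoes i W)

include hi hin hunit hW in
theorem undone_wordExpl (X : MOY R n t) (hX : ColorsLE i X) :
    (wordExpl i X).Undone (i - 1) W := by
  induction X with
  | nil => exact Expl.Undone.triv hW.colors colorsLE_unit
  | cons x X ih =>
    have hx : x.color ≤ i := hX x (List.mem_cons_self ..)
    have hX' : ColorsLE (R := R) (t := t) i X := fun s hs => hX s (List.mem_cons_of_mem _ hs)
    refine Expl.Undone.tensor hW.colors (low_strandExpl hi hin hunit x hx).colors
      (low_wordExpl hi hin hunit X hX').colors ?_ (ih hX')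
    by_cases h : x.color = i
    · exact hW.undone x h
    · rw [strandExpl_eq_triv h]
      exact Expl.Undone.triv hW.colors (hasColors_sg (by omega))

end

namespace Good

variable {i : ℕ} {W X Y Z X' Y' : MOY R n t}

theorem zero : Good i W (0 : X ⟶ Y) := by
  unfold Good
  simp only [Limits.zero_comp, Limits.comp_zero, MonoidalPreadditive.whiskerLeft_zero]
  exact isColorLE_zero

theorem add {f g : X ⟶ Y} (hf : Good i W f) (hg : Good i W g) : Good i W (f + g) := by
  unfold Good at *
  simpa only [Preadditive.add_comp, Preadditive.comp_add, MonoidalPreadditive.whiskerLeft_add]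
    using hf.add hg

theorem smul (r : R) {f : X ⟶ Y} (hf : Good i W f) : Good i W (r • f) := by
  unfold Good at *
  simpa only [Linear.smul_comp, Linear.comp_smul, MonoidalLinear.whiskerLeft_smul]
    using hf.smul r

theorem comp_of_eq_zero {f : X ⟶ Y} {g : Y ⟶ Z} (h : f = 0) : Good i W (f ≫ g) := by
  rw [h, Limits.zero_comp]
  exact zero

variable (hi : 2 ≤ i) (hin : i ≤ n)
  (hunit : ∀ k : ℕ, 1 ≤ k → k < n → IsUnit (qint (t ^ n) k)) (hW : Undoes i W)

include hi hin hunit hW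

/-- Next to `W`, the identity of `Y` can be replaced with `s`, a morphism of small colours, and `p`.
This cuts the exploded composite into three pieces of small colours. -/
theorem comp (hY : ColorsLE i Y) {f : X ⟶ Y} {g : Y ⟶ Z} (hf : Good i W f) (hg : Good i W g) :
    Good i W (f ≫ g) := by
  obtain ⟨h, hh, e⟩ := undone_wordExpl hi hin hunit hW Y hY
  unfold Good at *
  have : W ◁ ((wordExpl i X).p ≫ (f ≫ g) ≫ (wordExpl i Z).s) =
      W ◁ ((wordExpl i X).p ≫ f ≫ (wordExpl i Y).s) ≫ h ≫
        W ◁ ((wordExpl i Y).p ≫ g ≫ (wordExpl i Z).s) := by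
    simp only [MonoidalCategory.whiskerLeft_comp, Category.assoc]
    rw [reassoc_of% e]
  rw [this]
  exact hf.comp (hh.comp hg)

theorem tensor {f : X ⟶ Y} {g : X' ⟶ Y'} (hY : ColorsLE i Y) (hX' : ColorsLE i X')
    (hY' : ColorsLE i Y') (hX : ColorsLE i X)
    (hf : Good i W f) (hg : Good i W g) : Good i W (f ⊗ₘ g) := by
  unfold Good at *
  rw [wordExpl_tensor, wordExpl_tensor]
  have : ((wordExpl i X).tensor (wordExpl i X')).p ≫ (f ⊗ₘ g) ≫
      ((wordExpl i Y).tensor (wordExpl i Y')).s =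
      ((wordExpl i X).p ≫ f ≫ (wordExpl i Y).s) ⊗ₘ ((wordExpl i X').p ≫ g ≫ (wordExpl i Y').s) := by
    change (_ ⊗ₘ _) ≫ (f ⊗ₘ g) ≫ (_ ⊗ₘ _) = _
    rw [tensorHom_comp_tensorHom, tensorHom_comp_tensorHom]
  rw [this]
  refine Eq.mp (congrArg _ (whiskerLeft_tensor_eq_conjBraid W _ _).symm) ?_
  have cX := (low_wordExpl hi hin hunit X hX).colors
  have cY := (low_wordExpl hi hin hunit Y hY).colors
  have cX' := (low_wordExpl hi hin hunit X' hX').colors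
  have cY' := (low_wordExpl hi hin hunit Y' hY').colors
  exact (isColorLE_associator_inv hW.colors cX cX').comp ((hf.whiskerRight cX').comp
    ((isColorLE_associator_hom hW.colors cY cX').comp (hg.conjBraid hW.colors cY cX' cY')))

theorem eqToHom (h : X = Y) (hX : ColorsLE i X) : Good i W (CategoryTheory.eqToHom h) := by
  subst h
  unfold Good
  simpa using (low_wordExpl hi hin hunit X hX).p_s.whiskerLeft hW.colors

end Good

theorem hasColors_ne_of_lt {i : ℕ} {X : MOY R n t} (h : HasColors (n := n) (· < i) X) :
    HasColors (n := n) (· ≠ i) X := fun s hs => (h s hs).ne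

section

variable {i : ℕ} {W : MOY R n t} (hi : 2 ≤ i) (hin : i ≤ n)
  (hunit : ∀ k : ℕ, 1 ≤ k → k < n → IsUnit (qint (t ^ n) k)) (hW : Undoes i W)

namespace Good

include hi hin hunit hW

/-- The merges slide through the crossing by naturality and meet the splits; what is left crosses
only strands of small colours. -/
theorem braiding_hom {X Y : MOY R n t} (hX : ColorsLE i X) (hY : ColorsLE i Y) :
    Good i W (β_ X Y).hom := by
  have lX := low_wordExpl hi hin hunit X hX
  have lY := low_wordExpl hi hin hunit Y hY
  unfold Good
  rw [wordExpl_tensor, wordExpl_tensor]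
  have : ((wordExpl i X).tensor (wordExpl i Y)).p ≫ (β_ X Y).hom ≫
      ((wordExpl i Y).tensor (wordExpl i X)).s =
      (β_ (wordExpl i X).E (wordExpl i Y).E).hom ≫
        (((wordExpl i Y).p ≫ (wordExpl i Y).s) ⊗ₘ ((wordExpl i X).p ≫ (wordExpl i X).s)) := by
    change (_ ⊗ₘ _) ≫ _ ≫ (_ ⊗ₘ _) = _
    rw [BraidedCategory.braiding_naturality_assoc, tensorHom_comp_tensorHom]
  rw [this]
  exact ((isColorLE_braiding_hom lX.colors lY.colors).comp (lY.p_s.tensor lX.p_s)).whiskerLeft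
    hW.colors

theorem braiding_inv {X Y : MOY R n t} (hX : ColorsLE i X) (hY : ColorsLE i Y) :
    Good i W (β_ X Y).inv := by
  have lX := low_wordExpl hi hin hunit X hX
  have lY := low_wordExpl hi hin hunit Y hY
  unfold Good
  rw [wordExpl_tensor, wordExpl_tensor]
  have : ((wordExpl i Y).tensor (wordExpl i X)).p ≫ (β_ X Y).inv ≫
      ((wordExpl i X).tensor (wordExpl i Y)).s =
      (β_ (wordExpl i X).E (wordExpl i Y).E).inv ≫
        (((wordExpl i X).p ≫ (wordExpl i X).s) ⊗ₘ ((wordExpl i Y).p ≫ (wordExpl i Y).s)) := by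
    change (_ ⊗ₘ _) ≫ _ ≫ (_ ⊗ₘ _) = _
    rw [BraidedCategory.braiding_inv_naturality_assoc, tensorHom_comp_tensorHom]
  rw [this]
  exact ((isColorLE_braiding_inv lX.colors lY.colors).comp (lX.p_s.tensor lY.p_s)).whiskerLeft
    hW.colors

/-- Downward strands are exploded by the dual of the explosion of upward strands. So for colour `i`
the cap over an upward strand is the case of `Low.evaluation`, and over a downward strand that of
`Low.evaluation_dual`. -/
theorem evaluation_strand (x : Strand n) (hx : x.color ≤ i) :
    Good i W (ε_ (sg x) (sg x : MOY R n t)ᘁ) := by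
  have key : IsColorLE (i - 1) (((strandExpl (R := R) (t := t) i x.flip).tensor
      (strandExpl i x)).p ≫ ε_ (sg x) (sg x : MOY R n t)ᘁ) := by
    by_cases hc : x.color = i
    · rcases x with ⟨c, _ | _, h0, h1⟩
      · obtain rfl : c = i := hc
        have h := (low_strandExpl hi hin hunit ⟨c, true, h0, h1⟩ le_rfl).evaluation_dual
        exact Eq.mp (congrArg₂ (fun (d' : Expl (sg ⟨c, true, h0, h1⟩))
          (d : Expl (sg ⟨c, false, h0, h1⟩)) => IsColorLE (c - 1) ((d'.tensor d).p ≫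
            ε_ (sg ⟨c, false, h0, h1⟩) (sg ⟨c, false, h0, h1⟩ : MOY R n t)ᘁ))
          (Expl.cast_rfl rfl _) (strandExpl_false_eq_dual h0 h1).symm) h
      · obtain rfl : c = i := hc
        have h := (low_strandExpl hi hin hunit ⟨c, true, h0, h1⟩ le_rfl).evaluation
        exact Eq.mp (congrArg (fun d' : Expl (sg ⟨c, false, h0, h1⟩) => IsColorLE (c - 1)
          ((d'.tensor (strandExpl c ⟨c, true, h0, h1⟩)).p ≫
            ε_ (sg ⟨c, true, h0, h1⟩) (sg ⟨c, true, h0, h1⟩ : MOY R n t)ᘁ))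
          (strandExpl_false_eq_dual h0 h1).symm) h
    · have h := isColorLE_evaluation (R := R) (t := t) (X := sg x) (m := i - 1)
        (hasColors_sg (by omega))
      rw [strandExpl_eq_triv hc, strandExpl_eq_triv (x := x.flip) hc, Expl.triv_tensor_triv]
      exact Eq.mp (congrArg _ (Category.id_comp _).symm) h
  have h : wordExpl (R := R) (t := t) i (sg x.flip ⊗ sg x) =
      (strandExpl i x.flip).tensor (strandExpl i x) := by
    rw [wordExpl_tensor, wordExpl_singleton, wordExpl_singleton]
  rw [← h] at key
  refine IsColorLE.whiskerLeft ?_ hW.colors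
  exact Eq.mp (congrArg _ (congrArg (_ ≫ ·) (Category.comp_id _).symm)) key

theorem coevaluation_strand (x : Strand n) (hx : x.color ≤ i) :
    Good i W (η_ (sg x) (sg x : MOY R n t)ᘁ) := by
  have key : IsColorLE (i - 1) (η_ (sg x) (sg x : MOY R n t)ᘁ ≫
      ((strandExpl (R := R) (t := t) i x).tensor (strandExpl i x.flip)).s) := by
    by_cases hc : x.color = i
    · rcases x with ⟨c, _ | _, h0, h1⟩
      · obtain rfl : c = i := hc
        have h := (low_strandExpl hi hin hunit ⟨c, true, h0, h1⟩ le_rfl).coevaluation_dual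
        exact Eq.mp (congrArg₂ (fun (d' : Expl (sg ⟨c, true, h0, h1⟩))
          (d : Expl (sg ⟨c, false, h0, h1⟩)) => IsColorLE (c - 1)
            (η_ (sg ⟨c, false, h0, h1⟩) (sg ⟨c, false, h0, h1⟩ : MOY R n t)ᘁ ≫
              (d.tensor d').s))
          (Expl.cast_rfl rfl _) (strandExpl_false_eq_dual h0 h1).symm) h
      · obtain rfl : c = i := hc
        have h := (low_strandExpl hi hin hunit ⟨c, true, h0, h1⟩ le_rfl).coevaluation
        exact Eq.mp (congrArg (fun d' : Expl (sg ⟨c, false, h0, h1⟩) => IsColorLE (c - 1)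
          (η_ (sg ⟨c, true, h0, h1⟩) (sg ⟨c, true, h0, h1⟩ : MOY R n t)ᘁ ≫
            ((strandExpl c ⟨c, true, h0, h1⟩).tensor d').s))
          (strandExpl_false_eq_dual h0 h1).symm) h
    · have h := isColorLE_coevaluation (R := R) (t := t) (X := sg x) (m := i - 1)
        (hasColors_sg (by omega))
      rw [strandExpl_eq_triv hc, strandExpl_eq_triv (x := x.flip) hc, Expl.triv_tensor_triv]
      exact Eq.mp (congrArg _ (Category.comp_id _).symm) h
  have h : wordExpl (R := R) (t := t) i (sg x ⊗ sg x.flip) =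
      (strandExpl i x).tensor (strandExpl i x.flip) := by
    rw [wordExpl_tensor, wordExpl_singleton, wordExpl_singleton]
  rw [← h] at key
  refine IsColorLE.whiskerLeft ?_ hW.colors
  exact Eq.mp (congrArg _ (Category.id_comp _).symm) key

theorem whiskerLeft {X Y Z : MOY R n t} {f : X ⟶ Y} (hX : ColorsLE i X) (hY : ColorsLE i Y)
    (hZ : ColorsLE i Z) (hf : Good i W f) : Good i W (Z ◁ f) := by
  rw [← id_tensorHom]
  exact tensor hi hin hunit hW hZ hX hY hZ (eqToHom hi hin hunit hW rfl hZ) hf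

theorem whiskerRight {X Y Z : MOY R n t} {f : X ⟶ Y} (hX : ColorsLE i X) (hY : ColorsLE i Y)
    (hZ : ColorsLE i Z) (hf : Good i W f) : Good i W (f ▷ Z) := by
  rw [← tensorHom_id]
  exact tensor hi hin hunit hW hY hZ hZ hX hf (eqToHom hi hin hunit hW rfl hZ)

theorem evaluation (X : MOY R n t) (hX : ColorsLE i X) : Good i W (ε_ X Xᘁ) := by
  induction X with
  | nil =>
    refine IsColorLE.whiskerLeft ?_ hW.colors
    exact (isColorLE_id colorsLE_unit).comp ((isColorLE_evaluation colorsLE_unit).comp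
      (isColorLE_id colorsLE_unit))
  | cons x X ih =>
    have hx : ColorsLE (R := R) (t := t) i (sg x) := hasColors_sg (hX x (List.mem_cons_self ..))
    have hX' : ColorsLE (R := R) (t := t) i X := fun s hs => hX s (List.mem_cons_of_mem _ hs)
    have h := evaluation_strand hi hin hunit hW x (hX x (List.mem_cons_self ..))
    have e := evaluation_tensor (R := R) (t := t) (sg x) X
    refine Eq.mp (congrArg (Good i W) e.symm) ?_
    refine comp hi hin hunit hW (hX'.dual.tensor ((hx.dual.tensor hx).tensor hX'))
      (eqToHom hi hin hunit hW _ ((hx.tensor hX').dual.tensor (hx.tensor hX'))) ?_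
    refine comp hi hin hunit hW (hX'.dual.tensor (colorsLE_unit.tensor hX')) ?_ (ih hX')
    exact whiskerLeft hi hin hunit hW ((hx.dual.tensor hx).tensor hX') (colorsLE_unit.tensor hX')
      hX'.dual (whiskerRight hi hin hunit hW (hx.dual.tensor hx) colorsLE_unit hX' h)

theorem coevaluation (X : MOY R n t) (hX : ColorsLE i X) : Good i W (η_ X Xᘁ) := by
  induction X with
  | nil =>
    refine IsColorLE.whiskerLeft ?_ hW.colors
    exact (isColorLE_id colorsLE_unit).comp ((isColorLE_coevaluation colorsLE_unit).comp
      (isColorLE_id colorsLE_unit))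
  | cons x X ih =>
    have hx : ColorsLE (R := R) (t := t) i (sg x) := hasColors_sg (hX x (List.mem_cons_self ..))
    have hX' : ColorsLE (R := R) (t := t) i X := fun s hs => hX s (List.mem_cons_of_mem _ hs)
    have h := coevaluation_strand hi hin hunit hW x (hX x (List.mem_cons_self ..))
    have e := coevaluation_tensor (R := R) (t := t) (sg x) X
    refine Eq.mp (congrArg (Good i W) e.symm) ?_
    refine comp hi hin hunit hW (hx.tensor hx.dual) h ?_
    refine comp hi hin hunit hW (hx.tensor ((hX'.tensor hX'.dual).tensor hx.dual)) ?_
      (eqToHom hi hin hunit hW _ (hx.tensor ((hX'.tensor hX'.dual).tensor hx.dual)))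
    exact whiskerLeft hi hin hunit hW (colorsLE_unit.tensor hx.dual)
      ((hX'.tensor hX'.dual).tensor hx.dual) hx
      (whiskerRight hi hin hunit hW colorsLE_unit (hX'.tensor hX'.dual) hx.dual (ih hX'))

/-- The colours `k` and `l` are smaller than `i`, so at most the target is exploded. If `k + l = i`,
the vertex followed by the explosion is an interior edge that `isColorLE_edge` expands. -/
theorem mg {k l : ℕ} (hk : 0 < k) (hl : 0 < l) (h : k + l ≤ i) :
    Good i W (MOYCat.mg k l : (col k ⊗ col l : MOY R n t) ⟶ _) := by
  have h1 : wordExpl i (col k ⊗ col l : MOY R n t) = Expl.triv _ := by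
    refine wordExpl_eq_triv (hasColors_ne_of_lt fun s hs => ?_)
    exact Nat.lt_of_le_pred (by omega)
      (((colorsLE_col (by omega)).tensor (colorsLE_col (by omega)) :
        ColorsLE (i - 1) (col k ⊗ col l : MOY R n t)) s hs)
  refine IsColorLE.whiskerLeft ?_ hW.colors
  rw [h1]
  rcases h.lt_or_eq with h2 | h2
  · have h3 : wordExpl i (col (k + l) : MOY R n t) = Expl.triv _ := by
      refine wordExpl_eq_triv (hasColors_ne_of_lt fun s hs => ?_)
      exact Nat.lt_of_le_pred (by omega)
        ((colorsLE_col (by omega) : ColorsLE (i - 1) (col (k + l) : MOY R n t)) s hs)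
    rw [h3]
    have := isColorLE_mg (R := R) (n := n) (t := t) (k := k) (l := l) (m := i - 1) (by omega)
    simpa [Expl.triv] using this
  · subst h2
    rw [wordExpl_col (by omega) hin]
    have h3 := isColorLE_edge (R := R) (n := n) (t := t) hi hin hunit (j := k) (k := 1) hk
      (by omega) le_rfl (by omega)
    have h4 := eqToHom_mg (R := R) (n := n) (t := t) (k := k) rfl
      (show l = k + l - k by omega)
    have h5 := ((isColorLE_eqToHom (col_tensor_congr rfl (show l = k + l - k by omega))
      ((colorsLE_col (by omega)).tensor (colorsLE_col (by omega)))).comp h3)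
    rw [reassoc_of% h4, eqToHom_trans_assoc] at h5
    simpa [Expl.triv, mergeExpl] using h5

theorem sp {k l : ℕ} (hk : 0 < k) (hl : 0 < l) (h : k + l ≤ i) :
    Good i W (MOYCat.sp k l : (col (k + l) : MOY R n t) ⟶ _) := by
  have h1 : wordExpl i (col k ⊗ col l : MOY R n t) = Expl.triv _ := by
    refine wordExpl_eq_triv (hasColors_ne_of_lt fun s hs => ?_)
    exact Nat.lt_of_le_pred (by omega)
      (((colorsLE_col (by omega)).tensor (colorsLE_col (by omega)) :
        ColorsLE (i - 1) (col k ⊗ col l : MOY R n t)) s hs)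
  refine IsColorLE.whiskerLeft ?_ hW.colors
  rw [h1]
  rcases h.lt_or_eq with h2 | h2
  · have h3 : wordExpl i (col (k + l) : MOY R n t) = Expl.triv _ := by
      refine wordExpl_eq_triv (hasColors_ne_of_lt fun s hs => ?_)
      exact Nat.lt_of_le_pred (by omega)
        ((colorsLE_col (by omega) : ColorsLE (i - 1) (col (k + l) : MOY R n t)) s hs)
    rw [h3]
    have := isColorLE_sp (R := R) (n := n) (t := t) (k := k) (l := l) (m := i - 1) (by omega)
    simpa [Expl.triv] using this
  · subst h2
    rw [wordExpl_col (by omega) hin]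
    have h3 := isColorLE_edge (R := R) (n := n) (t := t) hi hin hunit (j := 1) (k := k) le_rfl
      (by omega) hk (by omega)
    have h4 := sp_eqToHom (R := R) (n := n) (t := t) (k := k) rfl
      (show k + l - k = l by omega)
    have h5 := h3.comp (isColorLE_eqToHom (col_tensor_congr rfl (show k + l - k = l by omega))
      ((colorsLE_col (by omega)).tensor (colorsLE_col (by omega))))
    rw [Category.assoc, Category.assoc, h4, eqToHom_trans_assoc] at h5
    simpa [Expl.triv, mergeExpl] using h5

end Good

include hi hin hunit hW in
theorem good_toHom {X Y : Word n} (f : Tm R n X Y) (hf : f.ColorLE i) :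
    Good i W (toHom t f) := by
  induction f with
  | zero => exact Good.zero
  | add f g ihf ihg => exact (ihf hf.1).add (ihg hf.2)
  | smul r f ih => exact (ih hf).smul r
  | eqv h =>
    subst h
    exact Good.eqToHom hi hin hunit hW rfl hf
  | comp f g ihf ihg =>
    -- `Good.comp` needs colours at most `i` on the sequence in the middle; if they are not
    -- available, the first factor is zero.
    rcases endsLE_toHom (t := t) f hf.1 with h | h
    · exact (ihf hf.1).comp hi hin hunit hW h.2 (ihg hf.2)
    · exact Good.comp_of_eq_zero (g := toHom t g) h
  | tensor f g ihf ihg =>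
    rcases endsLE_toHom (t := t) (tensor f g) hf with h | h
    · exact (ihf hf.1).tensor hi hin hunit hW h.2.of_tensor_left h.1.of_tensor_right
        h.2.of_tensor_right h.1.of_tensor_left (ihg hf.2)
    · rw [h]
      exact Good.zero
  | merge k l hk hl h =>
    have e := Good.mg hi hin hunit hW hk hl hf
    unfold mg mrg at e
    rwa [dif_pos ⟨hk, hl, h⟩] at e
  | split k l hk hl h =>
    have e := Good.sp hi hin hunit hW hk hl hf
    unfold sp spl at e
    rwa [dif_pos ⟨hk, hl, h⟩] at e
  | braid X Y => exact Good.braiding_hom hi hin hunit hW hf.1 hf.2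
  | braidInv X Y => exact Good.braiding_inv hi hin hunit hW hf.1 hf.2
  | ev X => exact Good.evaluation hi hin hunit hW X hf
  | coev X => exact Good.coevaluation hi hin hunit hW X hf

/-- In the presence of `W`, morphisms with colours at most `i` between objects with smaller colours
have smaller colours. -/
theorem isColorLE_whiskerLeft (hi : 2 ≤ i) (hin : i ≤ n)
    (hunit : ∀ k : ℕ, 1 ≤ k → k < n → IsUnit (qint (t ^ n) k)) (hW : Undoes i W)
    {X Y : MOY R n t} (hX : ColorsLE (i - 1) X) (hY : ColorsLE (i - 1) Y) {f : X ⟶ Y}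
    (hf : IsColorLE i f) : IsColorLE (i - 1) (W ◁ f) := by
  obtain ⟨g, rfl, hg⟩ := hf
  have h := good_toHom hi hin hunit hW g hg
  unfold Good at h
  rw [wordExpl_eq_triv (fun s hs => by have := hX s hs; dsimp at this ⊢; omega),
    wordExpl_eq_triv (fun s hs => by have := hY s hs; dsimp at this ⊢; omega)] at h
  simpa [Expl.triv] using h

end

end MOYCat

/-! ### Duals of morphisms next to identity strands -/

namespace CategoryTheory

section Mate

variable {C : Type u} [Category.{v} C] [MonoidalCategory C]

theorem eq_rightAdjointMate {X Y : C} [HasRightDual X] [HasRightDual Y] {f : X ⟶ Y}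
    {g : Yᘁ ⟶ Xᘁ} (h : g ▷ X ≫ ε_ X Xᘁ = Yᘁ ◁ f ≫ ε_ Y Yᘁ) : g = fᘁ := by
  have h2 := h.trans (rightAdjointMate_comp_evaluation f).symm
  have h3 := congrArg (tensorRightHomEquiv Yᘁ X Xᘁ (𝟙_ C)) h2
  rw [tensorRightHomEquiv_whiskerRight_comp_evaluation,
    tensorRightHomEquiv_whiskerRight_comp_evaluation] at h3
  exact (cancel_mono _).1 h3

/-- The comparison of duals is a parameter `e`, subject only to the formula for the cap over `X ⊗
Z`, so that it can be chosen to be an equality of words. The dual is then identified by its defining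
property: it slides around the cap. -/
theorem rightAdjointMate_whiskerRight_of_evaluation [RightRigidCategory C] {X Y Z : C} (f : X ⟶ Y)
    (e : ∀ X : C, (X ⊗ Z)ᘁ ≅ Zᘁ ⊗ Xᘁ)
    (he : ∀ X : C, ε_ (X ⊗ Z) (X ⊗ Z)ᘁ = (e X).hom ▷ (X ⊗ Z) ≫ (α_ _ _ _).hom ≫
      Zᘁ ◁ (α_ _ _ _).inv ≫ Zᘁ ◁ (ε_ X Xᘁ ▷ Z) ≫ Zᘁ ◁ (λ_ Z).hom ≫ ε_ Z Zᘁ) :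
    (f ▷ Z)ᘁ = (e Y).hom ≫ Zᘁ ◁ fᘁ ≫ (e X).inv := by
  refine (eq_rightAdjointMate ?_).symm
  have h := rightAdjointMate_comp_evaluation f
  have h1 : Zᘁ ◁ (fᘁ ▷ X ▷ Z) ≫ Zᘁ ◁ (ε_ X Xᘁ ▷ Z) =
      Zᘁ ◁ ((Yᘁ ◁ f) ▷ Z) ≫ Zᘁ ◁ (ε_ Y Yᘁ ▷ Z) := by
    rw [← MonoidalCategory.whiskerLeft_comp, ← comp_whiskerRight, h]
    simp
  rw [he X, he Y]
  have h2 : (e X).inv ▷ (X ⊗ Z) ≫ (e X).hom ▷ (X ⊗ Z) = 𝟙 _ := by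
    rw [← comp_whiskerRight, Iso.inv_hom_id, id_whiskerRight]
  rw [comp_whiskerRight, comp_whiskerRight, Category.assoc, Category.assoc, reassoc_of% h2]
  have h3 : (HasRightDual.rightDual Z ◁ fᘁ) ▷ (X ⊗ Z) ≫ (α_ Zᘁ Xᘁ (X ⊗ Z)).hom ≫ Zᘁ ◁ (α_ Xᘁ X Z).inv =
      (α_ Zᘁ Yᘁ (X ⊗ Z)).hom ≫ Zᘁ ◁ (α_ Yᘁ X Z).inv ≫
        HasRightDual.rightDual Z ◁ (fᘁ ▷ X ▷ Z) := by
    simp [← MonoidalCategory.whiskerLeft_comp]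
  have h4 : (Zᘁ ⊗ Yᘁ) ◁ (f ▷ Z) ≫ (α_ Zᘁ Yᘁ (Y ⊗ Z)).hom ≫ Zᘁ ◁ (α_ Yᘁ Y Z).inv =
      (α_ Zᘁ Yᘁ (X ⊗ Z)).hom ≫ Zᘁ ◁ (α_ Yᘁ X Z).inv ≫ Zᘁ ◁ ((Yᘁ ◁ f) ▷ Z) := by
    simp [← MonoidalCategory.whiskerLeft_comp]
  rw [reassoc_of% h3, reassoc_of% h1, whisker_exchange_assoc, reassoc_of% h4]

end Mate

end CategoryTheory

/-! ### Objects that allow explosions to be undone -/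

namespace MOYCat

open Quantum Tm

variable {R : Type u} [CommRing R] {n : ℕ} {t : Rˣ}

theorem rightAdjointMate_whiskerRight {X Y Z : MOY R n t} (f : X ⟶ Y) :
    (f ▷ Z)ᘁ = eqToHom (rightDual_tensor Y Z) ≫ Zᘁ ◁ fᘁ ≫
      eqToHom (rightDual_tensor X Z).symm := by
  refine rightAdjointMate_whiskerRight_of_evaluation f
    (fun X => eqToIso (rightDual_tensor X Z)) fun X => ?_
  rw [evaluation_tensor]
  have h1 : Zᘁ ◁ (λ_ Z).hom = 𝟙 (Zᘁ ⊗ Z) := MonoidalCategory.whiskerLeft_id Zᘁ Z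
  have h2 : Zᘁ ◁ (ε_ X Xᘁ ▷ Z) ≫ Zᘁ ◁ (λ_ Z).hom ≫ ε_ Z Zᘁ =
      Zᘁ ◁ (ε_ X Xᘁ ▷ Z) ≫ ε_ Z Zᘁ :=
    congrArg (Zᘁ ◁ (ε_ X Xᘁ ▷ Z) ≫ ·) ((congrArg (· ≫ ε_ Z Zᘁ) h1).trans (Category.id_comp _))
  rw [h2, associator_hom_eq, associator_inv_eq]
  simp only [eqToHom_whiskerRight, whiskerLeft_eqToHom, eqToHom_trans_assoc, eqToIso.hom]

theorem rightAdjointMate_smul {X Y : MOY R n t} (r : R) (f : X ⟶ Y) : (r • f)ᘁ = r • fᘁ := by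
  unfold rightAdjointMate
  simp

namespace Expl.Undone

variable {m : ℕ} {W V X : MOY R n t} {d : Expl X}

theorem of_smul (hW : ColorsLE m W) (hd : ColorsLE m d.E) {c : R} (hc : IsUnit c)
    (h : d.s ≫ d.p = c • 𝟙 _) : d.Undone m W := by
  refine ⟨Ring.inverse c • 𝟙 _, (isColorLE_id (hW.tensor hd)).smul _, ?_⟩
  rw [Linear.smul_comp, Linear.comp_smul, Category.id_comp, ← MonoidalCategory.whiskerLeft_comp,
    h, MonoidalLinear.whiskerLeft_smul, smul_smul, Ring.inverse_mul_cancel _ hc]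
  simp

theorem of_iso (e : W ≅ V) (he : IsColorLE m e.hom) (he' : IsColorLE m e.inv)
    (hd : ColorsLE m d.E) (h : d.Undone m W) : d.Undone m V := by
  obtain ⟨g, hg, e'⟩ := h
  refine ⟨e.inv ▷ _ ≫ g ≫ e.hom ▷ _,
    (he'.whiskerRight hd).comp (hg.comp (he.whiskerRight hd)), ?_⟩
  simp only [Category.assoc]
  rw [← whisker_exchange, whisker_exchange_assoc, reassoc_of% e', ← comp_whiskerRight,
    Iso.inv_hom_id, id_whiskerRight]

theorem whiskerLeft (hV : ColorsLE m V) (hW : ColorsLE m W) (hd : ColorsLE m d.E)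
    (h : d.Undone m W) : d.Undone m (V ⊗ W) := by
  obtain ⟨g, hg, e'⟩ := h
  refine ⟨(α_ _ _ _).hom ≫ V ◁ g ≫ (α_ _ _ _).inv,
    (isColorLE_associator_hom hV hW hd).comp ((hg.whiskerLeft hV).comp
      (isColorLE_associator_inv hV hW hd)), ?_⟩
  simp only [tensor_whiskerLeft, Category.assoc, Iso.inv_hom_id_assoc]
  rw [← MonoidalCategory.whiskerLeft_comp_assoc, ← MonoidalCategory.whiskerLeft_comp_assoc,
    Category.assoc, e']
  simp

theorem swap (hV : ColorsLE m V) (hW : ColorsLE m W) (hd : ColorsLE m d.E)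
    (h : d.Undone m (V ⊗ W)) : d.Undone m (W ⊗ V) :=
  h.of_iso (β_ V W) (isColorLE_braiding_hom hV hW) (isColorLE_braiding_inv hV hW) hd

/-- Taking duals exchanges the roles of `s` and `p` and reverses tensor products. To end with `Wᘁ`
on the left, `W` is first braided to the right of the exploded object. -/
theorem dual (hW : ColorsLE m W) (hd : ColorsLE m d.E) (h : d.Undone m W) :
    d.dual.Undone m (Wᘁ) := by
  obtain ⟨g, hg, e⟩ := h
  have e1 : d.s ▷ W ≫ ((β_ d.E W).hom ≫ g ≫ (β_ d.E W).inv) ≫ d.p ▷ W = 𝟙 _ := by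
    simp only [Category.assoc]
    rw [BraidedCategory.braiding_naturality_left_assoc,
      ← BraidedCategory.braiding_inv_naturality_right, reassoc_of% e, Iso.hom_inv_id]
  have e2 := congrArg rightAdjointMate e1
  rw [comp_rightAdjointMate, comp_rightAdjointMate, rightAdjointMate_id,
    rightAdjointMate_whiskerRight, rightAdjointMate_whiskerRight] at e2
  have e3 := congrArg (fun z => eqToHom (rightDual_tensor X W).symm ≫ z ≫
    eqToHom (rightDual_tensor X W)) e2
  have e4 : Wᘁ ◁ (d.p)ᘁ ≫ (eqToHom (rightDual_tensor _ _).symm ≫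
      ((β_ d.E W).hom ≫ g ≫ (β_ d.E W).inv)ᘁ ≫ eqToHom (rightDual_tensor _ _)) ≫
        Wᘁ ◁ (d.s)ᘁ = 𝟙 (Wᘁ ⊗ Xᘁ) := by
    simpa using e3
  refine ⟨_, ?_, e4⟩
  refine (isColorLE_eqToHom _ (hW.dual.tensor hd.dual)).comp
    (IsColorLE.comp ?_ (isColorLE_eqToHom _ (hd.tensor hW).dual))
  exact ((isColorLE_braiding_hom hd hW).comp (hg.comp (isColorLE_braiding_inv hd hW))).mate
    (hd.tensor hW) (hd.tensor hW)

end Expl.Undone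

theorem mergeExpl_s_p {i : ℕ} (hi : 0 < i) (hin : i ≤ n) :
    (mergeExpl i hi : Expl (col i : MOY R n t)).s ≫ (mergeExpl i hi).p =
      (qint (t ^ n) i : R) • 𝟙 _ := by
  have h := sp_mg (R := R) (n := n) (t := t) 1 (i - 1) (by omega)
  simp only [mergeExpl, Category.assoc]
  rw [reassoc_of% h]
  have : qbinom (t ^ n) (1 + (i - 1)) 1 = (qint (t ^ n) i : R) := by
    rw [qbinom_one_right]
    congr 1
    omega
  simp [this]

namespace Expl

theorem cast_s_p {X Y : MOY R n t} (d : Expl X) (e : X = Y) {c : R} (h : d.s ≫ d.p = c • 𝟙 _) :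
    (d.cast e).s ≫ (d.cast e).p = c • 𝟙 _ := by
  subst e
  rwa [cast_rfl]

theorem dual_s_p {X : MOY R n t} (d : Expl X) {c : R} (h : d.s ≫ d.p = c • 𝟙 _) :
    d.dual.s ≫ d.dual.p = c • 𝟙 _ := by
  refine (comp_rightAdjointMate (f := d.s) (g := d.p)).symm.trans ?_
  rw [h, rightAdjointMate_smul, rightAdjointMate_id]

end Expl

theorem strandExpl_s_p {i : ℕ} (hi : 0 < i) (hin : i ≤ n) {x : Strand n} (hx : x.color = i) :
    (strandExpl (R := R) (t := t) i x).s ≫ (strandExpl i x).p = (qint (t ^ n) i : R) • 𝟙 _ := by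
  rcases x with ⟨c, _ | _, h0, h1⟩
  · obtain rfl : c = i := hx
    rw [strandExpl_false]
    exact Expl.dual_s_p _ (Expl.cast_s_p _ _ (mergeExpl_s_p hi hin))
  · obtain rfl : c = i := hx
    rw [strandExpl_true]
    exact Expl.cast_s_p _ _ (mergeExpl_s_p hi hin)

/-- Splitting and merging a strand of colour `i` is a bubble of value `[i]`, a unit for `i < n`. No
auxiliary strand is needed. -/
theorem undoes_unit {i : ℕ} (hi : 2 ≤ i) (hin : i < n)
    (hunit : ∀ k : ℕ, 1 ≤ k → k < n → IsUnit (qint (t ^ n) k)) :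
    Undoes i (𝟙_ (MOY R n t)) where
  colors := colorsLE_unit
  undone x hx := Expl.Undone.of_smul colorsLE_unit
    (low_strandExpl hi hin.le hunit x hx.le).colors (hunit i (by omega) hin)
    (strandExpl_s_p (by omega) hin.le hx)

/-- Interior edges of colour `i < n` can be expanded. -/
theorem isColorLE_pred_of_lt {i : ℕ} (hi : 2 ≤ i) (hin : i < n)
    (hunit : ∀ k : ℕ, 1 ≤ k → k < n → IsUnit (qint (t ^ n) k))
    {X Y : MOY R n t} (hX : ColorsLE (i - 1) X) (hY : ColorsLE (i - 1) Y) {f : X ⟶ Y}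
    (hf : IsColorLE i f) : IsColorLE (i - 1) f := by
  have h := isColorLE_whiskerLeft hi hin.le hunit (undoes_unit hi hin hunit) hX hY hf
  rw [nil_whiskerLeft] at h
  exact h

section

variable (hn : 2 ≤ n) (hunit : ∀ k : ℕ, 1 ≤ k → k < n → IsUnit (qint (t ^ n) k))

include hn in
-- Only `n = 2` is not immediate: the edge then has the colour `n` itself and is rewritten by a
-- crossing.
theorem isColorLE_mg_sp_one :
    IsColorLE (n - 1) (mg 1 1 ≫ sp 1 1 : (col 1 ⊗ col 1 : MOY R n t) ⟶ _) := by
  rcases hn.lt_or_eq with h | h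
  · exact (isColorLE_mg (by omega)).comp (isColorLE_sp (by omega))
  · rw [mg_sp_one (by omega)]
    have h1 : ColorsLE (n - 1) (col 1 : MOY R n t) := colorsLE_col (by omega)
    exact ((isColorLE_id (h1.tensor h1)).smul _).add ((isColorLE_braiding_hom h1 h1).smul _)

include hn hunit in
-- In the square `(1, n) → (2, n - 1) → (1, n)`, the first step splits `n` and the last one merges
-- it again; between them a web acts on the two strands of colour 1. By `sqLR_two_top` the square is
-- `[n - 1]`, a unit, so this web divided by `[n - 1]` undoes the explosion.
theorem undone_mergeExpl_top :
    (mergeExpl n (by omega) : Expl (col n : MOY R n t)).Undone (n - 1) (col 1) := by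
  have h1 : ColorsLE (n - 1) (col 1 : MOY R n t) := colorsLE_col (by omega)
  have h2 : ColorsLE (n - 1) (col (n - 1) : MOY R n t) := colorsLE_col le_rfl
  have e := sqLR_two_top (R := R) (n := n) (t := t) (by omega)
  rw [sqLR_eq (a := 1) (b := 1) (e := n - 1) (by omega) (by omega) (by omega) (by omega)] at e
  simp only [eqToHom_refl, Category.id_comp] at e
  refine ⟨Ring.inverse (qint (t ^ n) (n - 1)) • ((α_ _ _ _).inv ≫
    (mg 1 1 ≫ sp 1 1) ▷ col (n - 1) ≫ (α_ _ _ _).hom), ?_, ?_⟩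
  · exact ((isColorLE_associator_inv h1 h1 h2).comp
      (((isColorLE_mg_sp_one hn).whiskerRight h2).comp
        (isColorLE_associator_hom h1 h1 h2))).smul _
  · dsimp only [mergeExpl]
    rw [Linear.smul_comp, Linear.comp_smul]
    simp only [MonoidalCategory.whiskerLeft_comp, whiskerLeft_eqToHom, comp_whiskerRight,
      Category.assoc]
    rw [e, smul_smul, Ring.inverse_mul_cancel _ (hunit _ (by omega) (by omega)), one_smul]

include hn hunit in
/-- An upward strand of colour `1` next to a downward one allows to undo the explosion of strands
of the top colour `n`. -/
theorem undoes_top : Undoes n (sg ⟨1, false, one_pos, by omega⟩ ⊗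
    (sg ⟨1, false, one_pos, by omega⟩ : MOY R n t)ᘁ) := by
  have hc : ∀ b : Bool, ColorsLE (n - 1) (sg ⟨1, b, one_pos, by omega⟩ : MOY R n t) :=
    fun b => hasColors_sg (show 1 ≤ n - 1 by omega)
  have hE := low_strandExpl (R := R) (t := t) hn le_rfl hunit
  have hup : (strandExpl (R := R) (t := t) n ⟨n, true, by omega, le_rfl⟩).Undone (n - 1)
      (sg ⟨1, true, one_pos, by omega⟩) := by
    rw [strandExpl_true]
    have h := (undone_mergeExpl_top (R := R) hn hunit).cast (col_eq (by omega) le_rfl)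
    rwa [col_eq (c := 1) one_pos (by omega)] at h
  -- The second factor is an upward strand and serves the upward strands of colour `n`; by duality,
  -- the first factor serves the downward ones. The order makes the object the target of a cup.
  refine ⟨(hc _).tensor (hc _).dual, fun x hx => ?_⟩
  rcases x with ⟨c, _ | _, h0, h1⟩
  · obtain rfl : c = n := hx
    have h := hup.dual (hc _) (hE _ le_rfl).colors
    rw [strandExpl_false_eq_dual]
    refine Expl.Undone.swap (hc true) (hc false) (hE _ le_rfl).colors.dual ?_
    exact Expl.Undone.whiskerLeft (hc true) (hc false) (hE _ le_rfl).colors.dual h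
  · obtain rfl : c = n := hx
    exact hup.whiskerLeft (hc false) (hc true) (hE _ le_rfl).colors

end

/-- The morphism `c : 𝟙 ⟶ W` can be absorbed by `Y`, with colours at most `m`. -/
def Absorbs (m : ℕ) {W : MOY R n t} (c : 𝟙_ (MOY R n t) ⟶ W) (Y : MOY R n t) : Prop :=
  ∃ v : W ⊗ Y ⟶ Y, IsColorLE m v ∧ c ▷ Y ≫ v = (λ_ Y).hom

/-! ### Absorption of an auxiliary pair of strands -/

namespace Absorbs

variable {m : ℕ} {W X Y Z : MOY R n t} {c : 𝟙_ (MOY R n t) ⟶ W}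

theorem tensor_left (hW : ColorsLE m W) (hX : ColorsLE m X) (hY : ColorsLE m Y)
    (h : Absorbs m c Y) : Absorbs m c (X ⊗ Y) := by
  obtain ⟨v, hv, e⟩ := h
  refine ⟨(α_ _ _ _).inv ≫ (β_ W X).hom ▷ Y ≫ (α_ _ _ _).hom ≫ X ◁ v, ?_, ?_⟩
  · exact (isColorLE_associator_inv hW hX hY).comp
      (((isColorLE_braiding_hom hW hX).whiskerRight hY).comp
      ((isColorLE_associator_hom hX hW hY).comp (hv.whiskerLeft hX)))
  · rw [whiskerRight_tensor]
    simp only [Category.assoc, Iso.hom_inv_id_assoc]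
    rw [← comp_whiskerRight_assoc, BraidedCategory.braiding_naturality_left,
      comp_whiskerRight_assoc, associator_naturality_middle_assoc,
      ← MonoidalCategory.whiskerLeft_comp, e]
    simp [braiding_tensorUnit_left]

theorem tensor_right (hW : ColorsLE m W) (hX : ColorsLE m X) (hY : ColorsLE m Y)
    (h : Absorbs m c X) : Absorbs m c (X ⊗ Y) := by
  obtain ⟨v, hv, e⟩ := h
  refine ⟨(α_ _ _ _).inv ≫ v ▷ Y, (isColorLE_associator_inv hW hX hY).comp
    (hv.whiskerRight hY), ?_⟩
  rw [whiskerRight_tensor]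
  simp only [Category.assoc, Iso.hom_inv_id_assoc]
  rw [← comp_whiskerRight, e]
  simp

/-- The exploded object absorbs `c` between `s` and `p`; the remaining factor `s ≫ p = r` is divided
out. -/
theorem of_expl (hW : ColorsLE m W) {d : Expl X} (hs : IsColorLE m d.s) (hp : IsColorLE m d.p)
    {r : R} (hr : IsUnit r) (hd : d.s ≫ d.p = r • 𝟙 _) (h : Absorbs m c d.E) :
    Absorbs m c X := by
  obtain ⟨v, hv, e⟩ := h
  refine ⟨Ring.inverse r • (W ◁ d.s ≫ v ≫ d.p),
    ((hs.whiskerLeft hW).comp (hv.comp hp)).smul _, ?_⟩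
  rw [Linear.comp_smul, ← whisker_exchange_assoc, reassoc_of% e, leftUnitor_naturality_assoc, hd,
    Linear.comp_smul, smul_smul, Ring.inverse_mul_cancel _ hr]
  simp

theorem coevaluation_self (hm : ColorsLE m X) : Absorbs m (η_ X Xᘁ) X := by
  refine ⟨(α_ _ _ _).hom ≫ X ◁ ε_ X Xᘁ ≫ (ρ_ X).hom,
    (isColorLE_associator_hom hm hm.dual hm).comp
      (((isColorLE_evaluation hm).whiskerLeft hm).comp ?_), ?_⟩
  · rw [rightUnitor_hom_eq]
    exact isColorLE_eqToHom _ (hm.tensor colorsLE_unit)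
  · rw [ExactPairing.evaluation_coevaluation_assoc]
    simp

/-- The created pair is braided to the right of `Xᘁ`, which makes the second zigzag applicable; for
`X` itself the first zigzag suffices. -/
theorem coevaluation_dual (hm : ColorsLE m X) : Absorbs m (η_ X Xᘁ) Xᘁ := by
  refine ⟨(β_ (X ⊗ Xᘁ) Xᘁ).hom ≫ (α_ _ _ _).inv ≫ ε_ X Xᘁ ▷ Xᘁ ≫ (λ_ Xᘁ).hom,
    (isColorLE_braiding_hom (hm.tensor hm.dual) hm.dual).comp
      ((isColorLE_associator_inv hm.dual hm hm.dual).comp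
      (((isColorLE_evaluation hm).whiskerRight hm.dual).comp ?_)), ?_⟩
  · exact isColorLE_id hm.dual
  · rw [BraidedCategory.braiding_naturality_left_assoc,
      ExactPairing.coevaluation_evaluation_assoc]
    simp

end Absorbs

theorem isColorLE_mergeExpl {i : ℕ} (hi : 0 < i) :
    IsColorLE i (mergeExpl i hi : Expl (col i : MOY R n t)).s ∧
      IsColorLE i (mergeExpl i hi : Expl (col i : MOY R n t)).p :=
  ⟨(isColorLE_eqToHom _ (colorsLE_col le_rfl)).comp (isColorLE_sp (by omega)),
    (isColorLE_mg (by omega)).comp (isColorLE_eqToHom _ (colorsLE_col (by omega)))⟩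

theorem isColorLE_strandExpl (x : Strand n) :
    ColorsLE x.color (strandExpl (R := R) (t := t) x.color x).E ∧
      IsColorLE x.color (strandExpl (R := R) (t := t) x.color x).s ∧
      IsColorLE x.color (strandExpl (R := R) (t := t) x.color x).p := by
  rcases x with ⟨c, b, h0, h1⟩
  have hE : ColorsLE c (col 1 ⊗ col (c - 1) : MOY R n t) :=
    (colorsLE_col (by omega)).tensor (colorsLE_col (by omega))
  have hs : IsColorLE c (strandExpl (R := R) (t := t) c ⟨c, true, h0, h1⟩).s := by
    rw [strandExpl_true]
    exact (isColorLE_eqToHom _ (hasColors_sg le_rfl)).comp (isColorLE_mergeExpl h0).1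
  have hp : IsColorLE c (strandExpl (R := R) (t := t) c ⟨c, true, h0, h1⟩).p := by
    rw [strandExpl_true]
    exact (isColorLE_mergeExpl h0).2.comp (isColorLE_eqToHom _ (colorsLE_col le_rfl))
  have hE' : (strandExpl (R := R) (t := t) c ⟨c, true, h0, h1⟩).E = col 1 ⊗ col (c - 1) := by
    rw [strandExpl_true]
    rfl
  rw [← hE'] at hE
  cases b
  · dsimp only
    rw [strandExpl_false_eq_dual]
    exact ⟨hE.dual, hp.mate hE (hasColors_sg le_rfl), hs.mate (hasColors_sg le_rfl) hE⟩
  · exact ⟨hE, hs, hp⟩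

theorem IsColorLE.mono {i j : ℕ} (h : i ≤ j) {X Y : MOY R n t} {f : X ⟶ Y} (hf : IsColorLE i f) :
    IsColorLE j f := by
  obtain ⟨g, hg, hc⟩ := hf
  exact ⟨g, hg, ColorLE.mono h g hc⟩

/-- A strand of colour `c < n` explodes into strands of colours 1 and `c - 1` with `s ≫ p = [c]`, a
unit. The part of colour 1 straightens with the cup. -/
theorem absorbs_strand (hunit : ∀ k : ℕ, 1 ≤ k → k < n → IsUnit (qint (t ^ n) k)) (hn : 1 ≤ n)
    (x : Strand n) (hx : x.color < n) {m : ℕ} (hm : x.color ≤ m) :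
    Absorbs m (η_ (sg ⟨1, false, one_pos, hn⟩) (sg ⟨1, false, one_pos, hn⟩ : MOY R n t)ᘁ)
      (sg x) := by
  have h0 := x.color_pos
  have hs := isColorLE_strandExpl (R := R) (t := t) x
  have h1 : ∀ b : Bool, ColorsLE m (sg ⟨1, b, one_pos, hn⟩ : MOY R n t) := fun b =>
    hasColors_sg (show 1 ≤ m by omega)
  have h2 : ColorsLE m (col 1 : MOY R n t) := colorsLE_col (by omega)
  have h3 : ColorsLE m (col (x.color - 1) : MOY R n t) := colorsLE_col (by omega)
  refine Absorbs.of_expl ((h1 _).tensor (h1 _).dual) (hs.2.1.mono hm) (hs.2.2.mono hm)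
    (hunit _ h0 hx) (strandExpl_s_p h0 x.color_le rfl) ?_
  rcases x with ⟨c, _ | _, h0, hc⟩
  · dsimp only at *
    rw [strandExpl_false]
    have h := rightDual_tensor (R := R) (n := n) (t := t) (col 1) (col (c - 1))
    refine Eq.mp (congrArg (Absorbs m _) h.symm) ?_
    refine Absorbs.tensor_left ((h1 _).tensor (h1 _).dual) h3.dual h2.dual ?_
    have h4 : ((col 1 : MOY R n t)ᘁ : MOY R n t) = sg ⟨1, false, one_pos, hn⟩ :=
      congrArg (fun X : MOY R n t => (Xᘁ : MOY R n t)) (col_eq one_pos hn)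
    rw [h4]
    exact Absorbs.coevaluation_self (h1 false)
  · dsimp only at *
    rw [strandExpl_true]
    refine Absorbs.tensor_right ((h1 _).tensor (h1 _).dual) h2 h3 ?_
    rw [col_eq one_pos hn]
    exact Absorbs.coevaluation_dual (h1 false)

/-- Some strand of the sequence has a colour smaller than `n`. -/
def Mixed (X : MOY R n t) : Prop := ∃ x : Strand n, x ∈ (show Word n from X) ∧ x.color < n

theorem absorbs_of_mixed (hunit : ∀ k : ℕ, 1 ≤ k → k < n → IsUnit (qint (t ^ n) k)) (hn : 1 ≤ n)
    {m : ℕ} {X : MOY R n t} (hX : ColorsLE m X) (h : Mixed X) :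
    Absorbs m (η_ (sg ⟨1, false, one_pos, hn⟩) (sg ⟨1, false, one_pos, hn⟩ : MOY R n t)ᘁ) X := by
  obtain ⟨x, hx, hc⟩ := h
  obtain ⟨A, B, hAB⟩ := List.append_of_mem hx
  have e : X = (show MOY R n t from A) ⊗ (sg x ⊗ (show MOY R n t from B)) := hAB
  have hm : x.color ≤ m := hX x hx
  have h1 : ∀ b : Bool, ColorsLE m (sg ⟨1, b, one_pos, hn⟩ : MOY R n t) := fun b =>
    hasColors_sg (show 1 ≤ m by have := x.color_pos; omega)
  rw [e] at hX ⊢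
  exact Absorbs.tensor_left ((h1 _).tensor (h1 _).dual) hX.of_tensor_left hX.of_tensor_right
    (Absorbs.tensor_right ((h1 _).tensor (h1 _).dual) hX.of_tensor_right.of_tensor_left
      hX.of_tensor_right.of_tensor_right (absorbs_strand hunit hn x hc hm))

theorem mixed_of_colorsLE {X : MOY R n t} (hn : 1 ≤ n) (hX : ColorsLE (n - 1) X)
    (h : X ≠ 𝟙_ (MOY R n t)) : Mixed X := by
  obtain ⟨x, hx⟩ := List.exists_mem_of_ne_nil (show Word n from X) h
  have : x.color ≤ n - 1 := hX x hx
  exact ⟨x, hx, by omega⟩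

theorem isColorLE_top {X Y : MOY R n t} (f : X ⟶ Y) : IsColorLE n f := by
  obtain ⟨g, hg⟩ := mk_surj f
  refine ⟨g, hg, ?_⟩
  clear hg f
  induction g with
  | zero => trivial
  | add f g ihf ihg => exact ⟨ihf, ihg⟩
  | smul r f ih => exact ih
  | eqv h => exact fun s _ => s.color_le
  | comp f g ihf ihg => exact ⟨ihf, ihg⟩
  | tensor f g ihf ihg => exact ⟨ihf, ihg⟩
  | merge k l _ _ h => exact h
  | split k l _ _ h => exact h
  | braid X Y => exact ⟨fun s _ => s.color_le, fun s _ => s.color_le⟩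
  | braidInv X Y => exact ⟨fun s _ => s.color_le, fun s _ => s.color_le⟩
  | ev X => exact fun s _ => s.color_le
  | coev X => exact fun s _ => s.color_le

/-! ### Colour n: morphisms with a nonempty end -/

section

variable (hn : 2 ≤ n) (hunit : ∀ k : ℕ, 1 ≤ k → k < n → IsUnit (qint (t ^ n) k))
  {X Y : MOY R n t} (hX : ColorsLE (n - 1) X) (hY : ColorsLE (n - 1) Y)

include hn hunit hX hY

/-- A cup creates the auxiliary pair `W` next to `X`, the morphism `W ◁ f` has small colours, and a
strand of `Y` absorbs `W` again. -/
theorem isColorLE_of_right_ne_nil (h : Y ≠ 𝟙_ (MOY R n t)) (f : X ⟶ Y) : IsColorLE (n - 1) f := by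
  obtain ⟨v, hv, e⟩ := absorbs_of_mixed hunit (by omega) hY (mixed_of_colorsLE (by omega) hY h)
  have hW := undoes_top (R := R) (t := t) hn hunit
  have hf := isColorLE_whiskerLeft hn le_rfl hunit hW hX hY (isColorLE_top f)
  have h1 : ColorsLE (n - 1) (sg ⟨1, false, one_pos, by omega⟩ : MOY R n t) :=
    hasColors_sg (show 1 ≤ n - 1 by omega)
  have : f = (λ_ X).inv ≫ η_ _ _ ▷ X ≫ _ ◁ f ≫ v := by
    rw [← whisker_exchange_assoc, e]
    simp
  rw [this]
  exact (isColorLE_id hX).comp (((isColorLE_coevaluation h1).whiskerRight hX).comp (hf.comp hv))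

/-- A half turn exchanges source and target, and two half turns give `f` back. -/
theorem isColorLE_of_left_ne_nil (h : X ≠ 𝟙_ (MOY R n t)) (f : X ⟶ Y) : IsColorLE (n - 1) f := by
  have h1 := isColorLE_of_right_ne_nil hn hunit hY.dual hX.dual (fun e => h ?_) (fᘁ)
  · have h2 := PivotalCategory.pivot_naturality f
    have : f = (PivotalCategory.pivot X).hom ≫ (fᘁ)ᘁ ≫ (PivotalCategory.pivot Y).inv := by
      rw [← reassoc_of% h2, Iso.hom_inv_id, Category.comp_id]
    rw [this]
    exact (isColorLE_pivot_hom hX).comp ((h1.mate hY.dual hX.dual).comp (isColorLE_pivot_inv hY))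
  · have h3 := congrArg (fun Z : MOY R n t => (Zᘁ : MOY R n t)) e
    exact (rightDual_rightDual X).symm.trans h3

end

end MOYCat

/-! ### Objects whose self-crossing is trivial -/

namespace CategoryTheory

section SelfSymmetric

variable {C : Type u} [Category.{v} C] [MonoidalCategory C] (L D : C)
  [ExactPairing L D]

/-- The cap on the two leftmost strands. -/
def capLeft (P : C) : D ⊗ (L ⊗ P) ⟶ P := (α_ _ _ _).inv ≫ ε_ L D ▷ P ≫ (λ_ P).hom

theorem coevaluation_capLeft (P : C) :
    η_ L D ▷ (L ⊗ P) ≫ (α_ _ _ _).hom ≫ L ◁ capLeft L D P = (λ_ _).hom := by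
  have h := congrArg (fun z => (α_ _ _ _).inv ≫ (z ≫ (ρ_ L).hom) ▷ P)
    (ExactPairing.evaluation_coevaluation L D)
  have h1 : η_ L D ▷ (L ⊗ P) ≫ (α_ _ _ _).hom ≫ L ◁ capLeft L D P =
      (α_ _ _ _).inv ≫ ((η_ L D ▷ L ≫ (α_ _ _ _).hom ≫ L ◁ ε_ L D) ≫ (ρ_ L).hom) ▷ P := by
    unfold capLeft
    monoidal
  rw [h1, h]
  monoidal

variable [BraidedCategory C] {L} (hL : (β_ L L).hom = 𝟙 _)

include hL in
-- A strand `L` slides across the cap on `D ⊗ L`. It crosses both legs, but its crossing with the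
-- leg `L` is trivial.
theorem braiding_evaluation :
    (β_ L D).hom ▷ L ≫ ε_ L D ▷ L ≫ (λ_ L).hom = (α_ _ _ _).hom ≫ L ◁ ε_ L D ≫ (ρ_ L).hom := by
  have h := BraidedCategory.braiding_naturality_right L (ε_ L D)
  rw [BraidedCategory.braiding_tensor_right_hom, hL] at h
  have h2 := congrArg (fun z => (α_ _ _ _).hom ≫ z ≫ (λ_ L).hom) h
  simpa [braiding_tensorUnit_right] using h2.symm

include hL in
theorem braiding_evaluation' :
    (β_ D L).hom ▷ L ≫ (α_ _ _ _).hom ≫ L ◁ ε_ L D ≫ (ρ_ L).hom = ε_ L D ▷ L ≫ (λ_ L).hom := by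
  have h := BraidedCategory.braiding_naturality_left (ε_ L D) L
  rw [BraidedCategory.braiding_tensor_left_hom, hL] at h
  have h2 := congrArg (fun z => z ≫ (ρ_ L).hom) h
  simpa [braiding_tensorUnit_left] using h2.symm

include hL in
theorem braiding_capLeft (P : C) :
    (β_ L D).hom ▷ (L ⊗ P) ≫ (α_ _ _ _).hom ≫ capLeft L D (L ⊗ P) =
      (α_ _ _ _).hom ≫ L ◁ capLeft L D P := by
  have h := congrArg (fun z => (α_ _ _ _).inv ≫ z ▷ P) (braiding_evaluation D hL)
  have h1 : (β_ L D).hom ▷ (L ⊗ P) ≫ (α_ _ _ _).hom ≫ capLeft L D (L ⊗ P) =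
      (α_ _ _ _).inv ≫ ((β_ L D).hom ▷ L ≫ ε_ L D ▷ L ≫ (λ_ L).hom) ▷ P := by
    unfold capLeft
    monoidal
  rw [h1, h]
  unfold capLeft
  monoidal

include hL in
theorem braiding_capLeft' (P : C) :
    (β_ D L).hom ▷ (L ⊗ P) ≫ (α_ _ _ _).hom ≫ L ◁ capLeft L D P =
      (α_ _ _ _).hom ≫ capLeft L D (L ⊗ P) := by
  have h := congrArg (fun z => (α_ _ _ _).inv ≫ z ▷ P) (braiding_evaluation' D hL)
  have h1 : (β_ D L).hom ▷ (L ⊗ P) ≫ (α_ _ _ _).hom ≫ L ◁ capLeft L D P =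
      (α_ _ _ _).inv ≫ ((β_ D L).hom ▷ L ≫ (α_ _ _ _).hom ≫ L ◁ ε_ L D ≫ (ρ_ L).hom) ▷ P := by
    unfold capLeft
    monoidal
  rw [h1, h]
  unfold capLeft
  monoidal

theorem braiding_dual_evaluation :
    (β_ D D).hom ▷ L ≫ (α_ _ _ _).hom ≫ D ◁ (β_ D L).hom ≫ (α_ _ _ _).inv ≫ ε_ L D ▷ D ≫
      (λ_ D).hom = (α_ _ _ _).hom ≫ D ◁ ε_ L D ≫ (ρ_ D).hom := by
  have h := BraidedCategory.braiding_naturality_right D (ε_ L D)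
  rw [BraidedCategory.braiding_tensor_right_hom] at h
  have h2 := congrArg (fun z => (α_ _ _ _).hom ≫ z ≫ (λ_ D).hom) h
  simpa [braiding_tensorUnit_right] using h2.symm

include hL in
-- By `braiding_capLeft'` the two nested caps become two caps side by side, at the cost of a
-- crossing of `D` with `L`. In this form the crossing of `D` with `D` is removed by sliding a
-- strand across the first cap.
theorem braiding_dual_capLeft (P : C) :
    (β_ D D).hom ▷ (L ⊗ (L ⊗ P)) ≫ (α_ _ _ _).hom ≫ D ◁ capLeft L D (L ⊗ P) ≫ capLeft L D P =
      (α_ _ _ _).hom ≫ D ◁ capLeft L D (L ⊗ P) ≫ capLeft L D P := by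
  have e1 : D ◁ capLeft L D (L ⊗ P) ≫ capLeft L D P =
      D ◁ (α_ _ _ _).inv ≫ D ◁ (β_ D L).hom ▷ (L ⊗ P) ≫ D ◁ (α_ _ _ _).hom ≫
        (α_ _ _ _).inv ≫ ε_ L D ▷ (D ⊗ (L ⊗ P)) ≫ (λ_ _).hom ≫ capLeft L D P := by
    have h := braiding_capLeft' D hL P
    have h2 : capLeft L D (L ⊗ P) = (α_ _ _ _).inv ≫ (β_ D L).hom ▷ (L ⊗ P) ≫
        (α_ _ _ _).hom ≫ L ◁ capLeft L D P := by
      rw [h]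
      simp
    rw [h2]
    have h3 : D ◁ L ◁ capLeft L D P ≫ capLeft L D P =
        (α_ _ _ _).inv ≫ ε_ L D ▷ (D ⊗ (L ⊗ P)) ≫ (λ_ _).hom ≫ capLeft L D P := by
      rw [← leftUnitor_naturality, ← whisker_exchange_assoc]
      conv_lhs => rw [capLeft]
      simp [capLeft]
    simp only [MonoidalCategory.whiskerLeft_comp, Category.assoc]
    rw [h3]
  have e2 := congrArg (fun z => (α_ _ _ _).inv ≫ z ▷ (L ⊗ P))
    (braiding_dual_evaluation (L := L) D)
  have e3 : (β_ D D).hom ▷ (L ⊗ (L ⊗ P)) ≫ (α_ _ _ _).hom ≫ D ◁ capLeft L D (L ⊗ P) ≫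
      capLeft L D P = ((α_ _ _ _).inv ≫ ((β_ D D).hom ▷ L ≫ (α_ _ _ _).hom ≫
        D ◁ (β_ D L).hom ≫ (α_ _ _ _).inv ≫ ε_ L D ▷ D ≫ (λ_ D).hom) ▷ (L ⊗ P)) ≫
          capLeft L D P := by
    rw [e1]
    monoidal
  rw [e3, e2]
  unfold capLeft
  monoidal

include hL in
-- A cap followed by a cup is the inverse crossing: the cup is moved below the cap,
-- `braiding_evaluation` exchanges the legs of the cap, and a zigzag straightens the result.
theorem braiding_evaluation_coevaluation :
    (β_ L D).hom ≫ ε_ L D ≫ η_ L D = 𝟙 _ := by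
  have h := braiding_evaluation D hL
  have h2 : ε_ L D ▷ L = (β_ L D).inv ▷ L ≫ (α_ _ _ _).hom ≫ L ◁ ε_ L D ≫ (ρ_ L).hom ≫
      (λ_ L).inv := by
    rw [← reassoc_of% h, ← comp_whiskerRight_assoc, Iso.inv_hom_id]
    simp
  have h3 : ε_ L D ≫ η_ L D = (β_ L D).inv := by
    have h4 : ε_ L D ≫ η_ L D = (ρ_ _).inv ≫ (D ⊗ L) ◁ η_ L D ≫ ε_ L D ▷ (L ⊗ D) ≫
        (λ_ _).hom := by
      rw [whisker_exchange_assoc]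
      simp [unitors_equal]
    have h5 : ε_ L D ▷ (L ⊗ D) = (α_ _ _ _).inv ≫ (ε_ L D ▷ L) ▷ D ≫ (α_ _ _ _).hom := by
      simp
    have h6 : (D ⊗ L) ◁ η_ L D ≫ (α_ _ _ _).inv ≫ (β_ L D).inv ▷ L ▷ D =
        (β_ L D).inv ▷ _ ≫ (L ⊗ D) ◁ η_ L D ≫ (α_ _ _ _).inv := by
      rw [← whisker_exchange_assoc]
      simp
    have h7 := congrArg (fun z => (ρ_ _).inv ≫ (α_ _ _ _).hom ≫ L ◁ z ≫ L ◁ (λ_ _).hom)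
      (ExactPairing.coevaluation_evaluation L D)
    rw [h4, h5, h2]
    simp only [comp_whiskerRight, Category.assoc]
    rw [reassoc_of% h6]
    have h8 : (ρ_ (D ⊗ L)).inv ≫ (β_ L D).inv ▷ 𝟙_ C = (β_ L D).inv ≫ (ρ_ _).inv := by simp
    rw [reassoc_of% h8]
    refine Eq.trans (congrArg ((β_ L D).inv ≫ ·) ?_) (Category.comp_id _)
    refine Eq.trans ?_ (h7.trans ?_)
    · monoidal
    · monoidal
  rw [h3, Iso.hom_inv_id]

include hL in
/-- If `c : L ⊗ D ⟶ 𝟙` is a cap for which the circle is trivial, then it straightens like the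
cap `ε_ L D`. -/
theorem cap_whiskerRight (c : L ⊗ D ⟶ 𝟙_ C) (hc : η_ L D ≫ c = 𝟙 _) :
    c ▷ L ≫ (λ_ L).hom = (α_ _ _ _).hom ≫ L ◁ ε_ L D ≫ (ρ_ L).hom := by
  have h1 := braiding_evaluation_coevaluation D hL
  have h2 : c = (β_ L D).hom ≫ ε_ L D := by
    -- Composition with `c` closes the cup to a circle of value 1, so that `c` is the crossing
    -- followed by the standard cap.
    have := congrArg (· ≫ c) h1
    simpa [hc] using this.symm
  rw [h2, ← braiding_evaluation D hL]
  simp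

include hL in
theorem cap_capLeft (c : L ⊗ D ⟶ 𝟙_ C) (hc : η_ L D ≫ c = 𝟙 _) (P : C) :
    c ▷ (L ⊗ P) ≫ (λ_ _).hom = (α_ _ _ _).hom ≫ L ◁ capLeft L D P := by
  have h := congrArg (fun z => (α_ _ _ _).inv ≫ z ▷ P) (cap_whiskerRight D hL c hc)
  have h1 : c ▷ (L ⊗ P) ≫ (λ_ _).hom = (α_ _ _ _).inv ≫ (c ▷ L ≫ (λ_ L).hom) ▷ P := by
    monoidal
  rw [h1, h]
  unfold capLeft
  monoidal

end SelfSymmetric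

end CategoryTheory

/-! ### Diagrams through mixed sequences, and standard diagrams -/

namespace MOYCat

open Quantum Tm

variable {R : Type u} [CommRing R] {n : ℕ} {t : Rˣ}

/-- The linear combinations of morphisms that factor through sequences with a strand of colour
smaller than `n`. -/
def thru (X Y : MOY R n t) : Submodule R (X ⟶ Y) :=
  Submodule.span R {h | ∃ (Z : MOY R n t) (f : X ⟶ Z) (g : Z ⟶ Y), Mixed Z ∧ h = f ≫ g}

theorem Mixed.tensor_left {X : MOY R n t} (h : Mixed X) (Y : MOY R n t) : Mixed (Y ⊗ X) :=
  h.imp fun _ hx => ⟨List.mem_append_right _ hx.1, hx.2⟩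

theorem Mixed.tensor_right {X : MOY R n t} (h : Mixed X) (Y : MOY R n t) : Mixed (X ⊗ Y) :=
  h.imp fun _ hx => ⟨List.mem_append_left _ hx.1, hx.2⟩

section Thru

variable {X Y Z : MOY R n t}

/-- Together with the following lemmas this makes `thru` an ideal that is stable under strands on
the left, so that computations can be made modulo it. -/
theorem comp_mem_thru_of_mixed (h : Mixed Y) (f : X ⟶ Y) (g : Y ⟶ Z) : f ≫ g ∈ thru X Z :=
  Submodule.subset_span ⟨Y, f, g, h, rfl⟩

theorem comp_mem_thru {g : Y ⟶ Z} (hg : g ∈ thru Y Z) (f : X ⟶ Y) : f ≫ g ∈ thru X Z := by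
  have h : thru Y Z ≤ (thru X Z).comap (Linear.leftComp R Z f) := by
    refine Submodule.span_le.2 ?_
    rintro _ ⟨W, a, b, hW, rfl⟩
    change f ≫ a ≫ b ∈ thru X Z
    rw [← Category.assoc]
    exact comp_mem_thru_of_mixed hW _ _
  exact h hg

theorem thru_comp_mem {f : X ⟶ Y} (hf : f ∈ thru X Y) (g : Y ⟶ Z) : f ≫ g ∈ thru X Z := by
  have h : thru X Y ≤ (thru X Z).comap (Linear.rightComp R X g) := by
    refine Submodule.span_le.2 ?_
    rintro _ ⟨W, a, b, hW, rfl⟩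
    change (a ≫ b) ≫ g ∈ thru X Z
    rw [Category.assoc]
    exact comp_mem_thru_of_mixed hW _ _
  exact h hf

theorem whiskerLeft_mem_thru {f : X ⟶ Y} (hf : f ∈ thru X Y) (Z : MOY R n t) :
    Z ◁ f ∈ thru (Z ⊗ X) (Z ⊗ Y) := by
  induction hf using Submodule.span_induction with
  | mem f hf =>
    obtain ⟨W, a, b, hW, rfl⟩ := hf
    rw [MonoidalCategory.whiskerLeft_comp]
    exact comp_mem_thru_of_mixed (hW.tensor_left Z) _ _
  | zero =>
    rw [MonoidalPreadditive.whiskerLeft_zero]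
    exact Submodule.zero_mem _
  | add f g _ _ hf hg =>
    rw [MonoidalPreadditive.whiskerLeft_add]
    exact Submodule.add_mem _ hf hg
  | smul r f _ hf =>
    rw [MonoidalLinear.whiskerLeft_smul]
    exact Submodule.smul_mem _ _ hf

end Thru

/-- The strand of colour `n`. -/
def top (hn : 0 < n) (b : Bool) : Strand n := ⟨n, b, hn, le_rfl⟩

/-- `N` parallel upward strands of colour `n`. -/
def pw (hn : 0 < n) : ℕ → MOY R n t
  | 0 => 𝟙_ _
  | N + 1 => sg (top hn true) ⊗ pw hn N

/-- Adding a strand of colour `n` to parallel upward strands. -/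
inductive Step (hn : 0 < n) :
    (x : Strand n) → (K M : ℕ) → ((sg x ⊗ pw hn K : MOY R n t) ⟶ pw hn M) → Prop
  | up (K : ℕ) : Step hn (top hn true) K (K + 1) (𝟙 (sg (top hn true) ⊗ pw hn K))
  | down (K : ℕ) : Step hn (top hn false) (K + 1) K
      (capLeft (sg (top hn true)) (sg (top hn true) : MOY R n t)ᘁ (pw hn K))

/-- The standard diagram from `X` and `N` parallel strands to `M` parallel strands. -/
def Lam (hn : 0 < n) (N : ℕ) : (X : MOY R n t) → (M : ℕ) → ((X ⊗ pw hn N : MOY R n t) ⟶ pw hn M) →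
    Prop
  | [], M, g => ∃ h : N = M, g = (λ_ (pw hn N)).hom ≫ eqToHom (congrArg (pw hn) h)
  | x :: X, M, g => ∃ (K : ℕ) (g' : ((X : MOY R n t) ⊗ pw hn N : MOY R n t) ⟶ pw hn K)
      (s : (sg x ⊗ pw hn K : MOY R n t) ⟶ pw hn M), Lam hn N X K g' ∧ Step hn x K M s ∧
        g = (α_ (sg x) (X : MOY R n t) (pw hn N)).hom ≫ sg x ◁ g' ≫ s

section Lam

variable {hn : 0 < n}

theorem sg_tensor_comp (x : Strand n) {X Y P Q Q' Q'' : MOY R n t} (g : Y ⊗ P ⟶ Q)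
    (g' : X ⊗ Q ⟶ Q') (s : sg x ⊗ Q' ⟶ Q'') :
    (α_ (sg x ⊗ X) Y P).hom ≫ (sg x ⊗ X) ◁ g ≫ (α_ (sg x) X Q).hom ≫ sg x ◁ g' ≫ s =
      (α_ (sg x) (X ⊗ Y) P).hom ≫ sg x ◁ ((α_ X Y P).hom ≫ X ◁ g ≫ g') ≫ s := by
  have h : (α_ (sg x ⊗ X) Y P).hom ≫ (sg x ⊗ X) ◁ g ≫ (α_ (sg x) X Q).hom ≫ sg x ◁ g' ≫ s =
      (α_ (sg x) X Y).hom ▷ P ≫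
        (α_ (sg x) (X ⊗ Y) P).hom ≫ sg x ◁ ((α_ X Y P).hom ≫ X ◁ g ≫ g') ≫ s := by
    simp
  -- With a single letter on the left, both bracketings are the same list by unfolding, and the
  -- associator is the identity.
  have h2 : (α_ (sg x) X Y).hom ▷ P = 𝟙 _ := id_whiskerRight _ _
  rw [h]
  exact (congrArg (· ≫ _) h2).trans (Category.id_comp _)

theorem sg_nil_comp (x : Strand n) {P Q : MOY R n t} (s : sg x ⊗ P ⟶ Q) :
    (α_ (sg x) (𝟙_ _) P).hom ≫ sg x ◁ (λ_ P).hom ≫ s = s := by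
  change 𝟙 (sg x ⊗ P) ≫ sg x ◁ 𝟙 P ≫ s = s
  simp

theorem nil_comp {X P Q : MOY R n t} (g : X ⊗ P ⟶ Q) :
    (α_ (𝟙_ _) X P).hom ≫ 𝟙_ _ ◁ g ≫ (λ_ Q).hom = g := by
  rw [nil_whiskerLeft]
  change 𝟙 (X ⊗ P) ≫ g ≫ 𝟙 Q = g
  simp

theorem Lam.nil (N : ℕ) : Lam hn N (𝟙_ (MOY R n t)) N (λ_ _).hom :=
  ⟨rfl, (Category.comp_id _).symm⟩

theorem Lam.sg {x : Strand n} {K M : ℕ} {s : (sg x ⊗ pw hn K : MOY R n t) ⟶ pw hn M}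
    (h : Step hn x K M s) : Lam hn K (sg x) M s := by
  exact ⟨K, (λ_ _).hom, s, Lam.nil K, h, (sg_nil_comp _ _).symm⟩

theorem Lam.tensor {N K M : ℕ} {X Y : MOY R n t} {g : (Y ⊗ pw hn N : MOY R n t) ⟶ pw hn K}
    (h : Lam hn N Y K g) {g' : (X ⊗ pw hn K : MOY R n t) ⟶ pw hn M} (h' : Lam hn K X M g') :
    Lam hn N (X ⊗ Y) M ((α_ X Y _).hom ≫ X ◁ g ≫ g') := by
  induction X generalizing M with
  | nil =>
    obtain ⟨rfl, rfl⟩ := h'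
    rw [eqToHom_refl, Category.comp_id]
    exact Eq.mp (congrArg (Lam hn N Y K) (nil_comp g).symm) h
  | cons x X ih =>
    obtain ⟨K', g1, s, h1, h2, rfl⟩ := h'
    refine ⟨K', _, s, ih h1, h2, ?_⟩
    exact sg_tensor_comp x g g1 s

theorem Lam.exists_of_tensor {N M : ℕ} {X Y : MOY R n t}
    {g : ((X ⊗ Y) ⊗ pw hn N : MOY R n t) ⟶ pw hn M} (h : Lam hn N (X ⊗ Y) M g) :
    ∃ (K : ℕ) (g' : (Y ⊗ pw hn N : MOY R n t) ⟶ pw hn K)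
      (g'' : (X ⊗ pw hn K : MOY R n t) ⟶ pw hn M),
      Lam hn N Y K g' ∧ Lam hn K X M g'' ∧ g = (α_ X Y _).hom ≫ X ◁ g' ≫ g'' := by
  induction X generalizing M with
  | nil =>
    exact ⟨M, g, _, h, Lam.nil M, (nil_comp (X := Y) g).symm⟩
  | cons x X ih =>
    obtain ⟨K, g1, s, h1, h2, rfl⟩ := h
    obtain ⟨K', a, b, h3, h4, rfl⟩ := ih h1
    refine ⟨K', a, _, h3, ⟨K, b, s, h4, h2, rfl⟩, ?_⟩
    exact (sg_tensor_comp x a b s).symm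

theorem Step.le {x : Strand n} {K M : ℕ} {s : (sg x ⊗ pw hn K : MOY R n t) ⟶ pw hn M}
    (h : Step hn x K M s) : K ≤ M + 1 := by
  cases h <;> omega

/-- Each letter uses up at most one parallel strand. This determines how many must be present
initially for a given number to be left. -/
theorem Lam.le {N K : ℕ} {X : MOY R n t} {g : (X ⊗ pw hn N : MOY R n t) ⟶ pw hn K}
    (h : Lam hn N X K g) : N ≤ K + (show Word n from X).length := by
  induction X generalizing K with
  | nil => exact h.1.le
  | cons x X ih =>
    obtain ⟨K', g1, s, h1, h2, rfl⟩ := h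
    have := ih h1
    have := h2.le
    simp only [List.length_cons] at *
    omega

end Lam

/-- The linear combinations of standard diagrams, up to diagrams with a strand of smaller colour. -/
def reach (hn : 0 < n) (N : ℕ) (X : MOY R n t) (M : ℕ) :
    Submodule R ((X ⊗ pw hn N : MOY R n t) ⟶ pw hn M) :=
  Submodule.span R {g | Lam hn N X M g} ⊔ thru _ _

/-- Next to sufficiently many parallel strands, `f` preserves the combinations of standard
diagrams. -/
def Red (hn : 0 < n) {X Y : MOY R n t} (f : X ⟶ Y) : Prop :=
  ∃ N₀, ∀ N, N₀ ≤ N → ∀ (M : ℕ) (g : (Y ⊗ pw hn N : MOY R n t) ⟶ pw hn M), Lam hn N Y M g →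
    f ▷ pw hn N ≫ g ∈ reach hn N X M

section Reach

variable {hn : 0 < n} {N M K : ℕ} {X Y Z : MOY R n t}

theorem Lam.mem_reach {g : (X ⊗ pw hn N : MOY R n t) ⟶ pw hn M} (h : Lam hn N X M g) :
    g ∈ reach hn N X M := Submodule.mem_sup_left (Submodule.subset_span h)

theorem thru_le_reach : thru _ _ ≤ reach hn N X M := le_sup_right

/-- Linear maps preserve combinations of standard diagrams if they preserve standard diagrams and
combinations of diagrams with a strand of smaller colour. -/
theorem reach_le {p : Submodule R ((X ⊗ pw hn N : MOY R n t) ⟶ pw hn M)}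
    (h : ∀ g, Lam hn N X M g → g ∈ p) (h' : ∀ g ∈ thru _ _, g ∈ p) : reach hn N X M ≤ p :=
  sup_le (Submodule.span_le.2 h) h'

theorem whiskerRight_comp_mem_reach {f : X ⟶ Y}
    (hf : ∀ g : (Y ⊗ pw hn N : MOY R n t) ⟶ pw hn M, Lam hn N Y M g →
      f ▷ pw hn N ≫ g ∈ reach hn N X M) {g : (Y ⊗ pw hn N : MOY R n t) ⟶ pw hn M}
    (hg : g ∈ reach hn N Y M) : f ▷ pw hn N ≫ g ∈ reach hn N X M :=
  reach_le (p := (reach hn N X M).comap (Linear.leftComp R _ (f ▷ pw hn N))) hf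
    (fun _ h => thru_le_reach (comp_mem_thru h _)) hg

theorem whiskerLeft_comp_mem_reach {g : (X ⊗ pw hn N : MOY R n t) ⟶ pw hn K}
    (hg : g ∈ reach hn N X K) {g' : (Z ⊗ pw hn K : MOY R n t) ⟶ pw hn M} (h : Lam hn K Z M g') :
    (α_ Z X _).hom ≫ Z ◁ g ≫ g' ∈ reach hn N (Z ⊗ X) M := by
  let F : (X ⊗ pw hn N ⟶ pw hn K) →ₗ[R] ((Z ⊗ X) ⊗ pw hn N ⟶ pw hn M) :=
    { toFun := fun g => (α_ Z X _).hom ≫ Z ◁ g ≫ g'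
      map_add' := fun a b => by simp
      map_smul' := fun r a => by simp }
  refine reach_le (p := (reach hn N (Z ⊗ X) M).comap F) (fun a ha => ?_) (fun a ha => ?_) hg
  · exact (Lam.tensor ha h).mem_reach
  · change (α_ Z X _).hom ≫ Z ◁ a ≫ g' ∈ reach hn N (Z ⊗ X) M
    exact thru_le_reach (comp_mem_thru (thru_comp_mem (whiskerLeft_mem_thru ha Z) g') _)

theorem comp_mem_reach {g : (Z ⊗ pw hn N : MOY R n t) ⟶ pw hn K} (h : Lam hn N Z K g)
    {g' : (X ⊗ pw hn K : MOY R n t) ⟶ pw hn M} (hg : g' ∈ reach hn K X M) :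
    (α_ X Z _).hom ≫ X ◁ g ≫ g' ∈ reach hn N (X ⊗ Z) M := by
  let F : (X ⊗ pw hn K ⟶ pw hn M) →ₗ[R] ((X ⊗ Z) ⊗ pw hn N ⟶ pw hn M) :=
    { toFun := fun g' => (α_ X Z _).hom ≫ X ◁ g ≫ g'
      map_add' := fun a b => by simp
      map_smul' := fun r a => by simp }
  refine reach_le (p := (reach hn N (X ⊗ Z) M).comap F) (fun a ha => ?_) (fun a ha => ?_) hg
  · exact (Lam.tensor h ha).mem_reach
  · change (α_ X Z _).hom ≫ X ◁ g ≫ a ∈ reach hn N (X ⊗ Z) M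
    exact thru_le_reach (comp_mem_thru (comp_mem_thru ha _) _)

end Reach

namespace Red

variable {hn : 0 < n} {X Y Z X' Y' : MOY R n t}

theorem zero : Red hn (0 : X ⟶ Y) := ⟨0, fun N _ M g _ => by simp⟩

theorem id : Red hn (𝟙 X) := ⟨0, fun N _ M g h => by simpa using h.mem_reach⟩

theorem eqToHom (h : X = Y) : Red hn (eqToHom h) := by
  subst h
  exact id

theorem add {f g : X ⟶ Y} (hf : Red hn f) (hg : Red hn g) : Red hn (f + g) := by
  obtain ⟨a, ha⟩ := hf
  obtain ⟨b, hb⟩ := hg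
  refine ⟨max a b, fun N hN M g h => ?_⟩
  rw [MonoidalPreadditive.add_whiskerRight, Preadditive.add_comp]
  exact Submodule.add_mem _ (ha N (le_of_max_le_left hN) M g h)
    (hb N (le_of_max_le_right hN) M g h)

theorem smul (r : R) {f : X ⟶ Y} (hf : Red hn f) : Red hn (r • f) := by
  obtain ⟨a, ha⟩ := hf
  refine ⟨a, fun N hN M g h => ?_⟩
  rw [MonoidalLinear.smul_whiskerRight, Linear.smul_comp]
  exact Submodule.smul_mem _ r (ha N hN M g h)

theorem comp {f : X ⟶ Y} {g : Y ⟶ Z} (hf : Red hn f) (hg : Red hn g) : Red hn (f ≫ g) := by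
  obtain ⟨a, ha⟩ := hf
  obtain ⟨b, hb⟩ := hg
  refine ⟨max a b, fun N hN M h hh => ?_⟩
  rw [comp_whiskerRight, Category.assoc]
  exact whiskerRight_comp_mem_reach (ha N (le_of_max_le_left hN) M)
    (hb N (le_of_max_le_right hN) M h hh)

theorem comp_of_mixed (hY : Mixed Y) (f : X ⟶ Y) (g : Y ⟶ Z) : Red hn (f ≫ g) := by
  refine ⟨0, fun N _ M h _ => ?_⟩
  rw [comp_whiskerRight, Category.assoc]
  exact thru_le_reach (comp_mem_thru_of_mixed (hY.tensor_right _) _ _)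

theorem whiskerLeft {f : X ⟶ Y} (hf : Red hn f) (Z : MOY R n t) : Red hn (Z ◁ f) := by
  obtain ⟨a, ha⟩ := hf
  refine ⟨a, fun N hN M g hg => ?_⟩
  obtain ⟨K, g', g'', h1, h2, rfl⟩ := hg.exists_of_tensor
  have e : (Z ◁ f) ▷ pw hn N ≫ (α_ Z Y _).hom ≫ Z ◁ g' ≫ g'' =
      (α_ Z X _).hom ≫ Z ◁ (f ▷ pw hn N ≫ g') ≫ g'' := by simp
  rw [e]
  exact whiskerLeft_comp_mem_reach (ha N hN K g' h1) h2

theorem whiskerRight {f : X ⟶ Y} (hf : Red hn f) (Z : MOY R n t) : Red hn (f ▷ Z) := by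
  obtain ⟨a, ha⟩ := hf
  -- The letters of `Z` are treated before `f` and may use up one parallel strand each; at least `a`
  -- of them must then remain.
  refine ⟨a + (show Word n from Z).length, fun N hN M g hg => ?_⟩
  obtain ⟨K, g', g'', h1, h2, rfl⟩ := hg.exists_of_tensor
  have e : (f ▷ Z) ▷ pw hn N ≫ (α_ Y Z _).hom ≫ Y ◁ g' ≫ g'' =
      (α_ X Z _).hom ≫ X ◁ g' ≫ f ▷ pw hn K ≫ g'' := by
    rw [whisker_exchange_assoc]
    simp
  have := h1.le
  rw [e]
  exact comp_mem_reach h1 (ha K (by omega) M g'' h2)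

theorem tensor {f : X ⟶ Y} {g : X' ⟶ Y'} (hf : Red hn f) (hg : Red hn g) : Red hn (f ⊗ₘ g) := by
  rw [MonoidalCategory.tensorHom_def]
  exact (hf.whiskerRight _).comp (hg.whiskerLeft _)

end Red

/-- This is the bubble relation for `k = 0` and `l = n`: the circle has the value `[n choose n] =
1`. -/
theorem rightTrace_id_top : rightTrace (𝟙 (col n : MOY R n t)) = 𝟙 _ := by
  have e : (col 0 ⊗ 𝟙_ _ : MOY R n t) = col 0 := List.append_nil (str n 0)
  have h : eqToHom e.symm ≫
      col 0 ◁ η_ (col n) (col n : MOY R n t)ᘁ ≫ (α_ (col 0) (col n) (col n : MOY R n t)ᘁ).inv ≫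
        (mg 0 n ≫ sp 0 n) ▷ (col n : MOY R n t)ᘁ ≫ (α_ (col 0) (col n) (col n : MOY R n t)ᘁ).hom ≫
          col 0 ◁ ((PivotalCategory.pivot (col n)).hom ▷ (col n : MOY R n t)ᘁ ≫
            ε_ (col n : MOY R n t)ᘁ (col n : MOY R n t)ᘁᘁ) ≫ eqToHom e =
      qbinom (t ^ n) (n - 0) n • 𝟙 (col 0 : MOY R n t) := by
    rw [← toHom_eqv e, ← toHom_eqv e.symm]
    exact mk_eq (Rel.bubble_right 0 n (by omega))
  rw [zero_whiskerLeft_of_eq col_zero, zero_whiskerLeft_of_eq col_zero, mg_zero_left, sp_zero_left,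
    associator_hom_eq, associator_inv_eq, Nat.sub_zero, qbinom_self, one_smul] at h
  simp only [eqToHom_trans, eqToHom_trans_assoc, Category.assoc, eqToHom_refl] at h
  rw [eqToHom_comp_iff] at h
  unfold rightTrace
  rw [id_whiskerRight, Category.id_comp]
  have h2 := congrArg (· ≫ eqToHom col_zero) h
  simpa using h2

section

variable (hn : 0 < n)

theorem braiding_top :
    (β_ (sg (top hn true)) (sg (top hn true) : MOY R n t)).hom = 𝟙 _ := by
  have h := braiding_col_top (R := R) (n := n) (t := t)
  rwa [col_eq hn le_rfl] at h

theorem circle_right : η_ (sg (top hn true)) (sg (top hn true) : MOY R n t)ᘁ ≫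
    ε_ (sg (top hn false)) (sg (top hn false) : MOY R n t)ᘁ = 𝟙 _ := by
  have h := rightTrace_id_top (R := R) (n := n) (t := t)
  rw [col_eq hn le_rfl] at h
  unfold rightTrace at h
  rw [pivot_hom_eq] at h
  rw [id_whiskerRight, Category.id_comp] at h
  exact (congrArg (η_ (sg (top hn true)) (sg (top hn true) : MOY R n t)ᘁ ≫ ·)
    ((congrArg (· ≫ ε_ (sg (top hn false)) (sg (top hn false) : MOY R n t)ᘁ)
      (id_whiskerRight _ _)).trans (Category.id_comp _))).symm.trans h

/-- Sphericality transfers the value of the circle to the other orientation. -/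
theorem circle_left : η_ (sg (top hn false)) (sg (top hn false) : MOY R n t)ᘁ ≫
    ε_ (sg (top hn true)) (sg (top hn true) : MOY R n t)ᘁ = 𝟙 _ := by
  have h := (SphericalCategory.leftTrace_eq_rightTrace (𝟙 (col n : MOY R n t))).trans
    rightTrace_id_top
  rw [col_eq hn le_rfl] at h
  unfold leftTrace at h
  rw [pivot_inv_eq] at h
  rw [MonoidalCategory.whiskerLeft_id, Category.id_comp] at h
  exact (congrArg (η_ (sg (top hn false)) (sg (top hn false) : MOY R n t)ᘁ ≫ ·)
    ((congrArg (· ≫ ε_ (sg (top hn true)) (sg (top hn true) : MOY R n t)ᘁ)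
      (MonoidalCategory.whiskerLeft_id _ _)).trans (Category.id_comp _))).symm.trans h

end

section

variable {hn : 0 < n}

theorem Step.up_inv {K M : ℕ} {s : (sg (top hn true) ⊗ pw hn K : MOY R n t) ⟶ pw hn M}
    (h : Step hn (top hn true) K M s) : ∃ e : K + 1 = M, s = eqToHom (congrArg (pw hn) e) := by
  cases h
  exact ⟨rfl, rfl⟩

theorem Step.down_inv {K M : ℕ} {s : (sg (top hn false) ⊗ pw hn K : MOY R n t) ⟶ pw hn M}
    (h : Step hn (top hn false) K M s) : ∃ e : K = M + 1,
      s = sg (top hn false) ◁ eqToHom (congrArg (pw hn) e) ≫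
        capLeft (sg (top hn true)) (sg (top hn true) : MOY R n t)ᘁ (pw hn M) := by
  cases h
  refine ⟨rfl, ?_⟩
  exact ((congrArg (· ≫ _) (MonoidalCategory.whiskerLeft_id _ _)).trans (Category.id_comp _)).symm

theorem Step.unique {x : Strand n} {K M M' : ℕ} {s : (sg x ⊗ pw hn K : MOY R n t) ⟶ pw hn M}
    {s' : (sg x ⊗ pw hn K : MOY R n t) ⟶ pw hn M'} (h : Step hn x K M s)
    (h' : Step hn x K M' s') : ∃ e : M = M', s' = s ≫ eqToHom (congrArg (pw hn) e) := by
  cases h with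
  | up K =>
    obtain ⟨rfl, rfl⟩ := h'.up_inv
    exact ⟨rfl, (Category.comp_id _).symm⟩
  | down K =>
    obtain ⟨e, rfl⟩ := h'.down_inv
    obtain rfl : _ = M' := Nat.succ.inj e
    refine ⟨rfl, ?_⟩
    refine Eq.trans ?_ (Category.comp_id _).symm
    exact (congrArg (· ≫ _) (MonoidalCategory.whiskerLeft_id _ _)).trans (Category.id_comp _)

/-- Each letter determines its step: an upward strand is added, a downward one is capped off. So the
word and `N` leave no choice for the diagram. -/
theorem Lam.unique {N M M' : ℕ} {X : MOY R n t} {g : (X ⊗ pw hn N : MOY R n t) ⟶ pw hn M}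
    {g' : (X ⊗ pw hn N : MOY R n t) ⟶ pw hn M'} (h : Lam hn N X M g) (h' : Lam hn N X M' g') :
    ∃ e : M = M', g' = g ≫ eqToHom (congrArg (pw hn) e) := by
  induction X generalizing M M' with
  | nil =>
    obtain ⟨rfl, rfl⟩ := h
    obtain ⟨rfl, rfl⟩ := h'
    exact ⟨rfl, (Category.comp_id _).symm⟩
  | cons x X ih =>
    obtain ⟨K, a, s, h1, h2, rfl⟩ := h
    obtain ⟨K', a', s', h1', h2', rfl⟩ := h'
    obtain ⟨rfl, rfl⟩ := ih h1 h1'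
    obtain ⟨rfl, rfl⟩ := h2.unique h2'
    refine ⟨rfl, ?_⟩
    rw [eqToHom_refl, Category.comp_id, eqToHom_refl, Category.comp_id]
    exact (Category.comp_id _).symm

/-- By `Lam.unique` one matching pair of standard diagrams for each number of parallel strands is
enough. Two parallel strands suffice for the generators, which have at most two letters at each end.
-/
theorem red_of_lam {X Y : MOY R n t} {f : X ⟶ Y} (h : ∀ P, ∃ (M : ℕ)
    (g : (X ⊗ pw hn (P + 2) : MOY R n t) ⟶ pw hn M) (g' : (Y ⊗ pw hn (P + 2) : MOY R n t) ⟶ pw hn M),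
    Lam hn (P + 2) X M g ∧ Lam hn (P + 2) Y M g' ∧ f ▷ _ ≫ g' = g) : Red hn f := by
  refine ⟨2, fun N hN M k hk => ?_⟩
  obtain ⟨P, rfl⟩ := Nat.exists_eq_add_of_le' hN
  obtain ⟨M', g, g', h1, h2, h3⟩ := h P
  obtain ⟨rfl, rfl⟩ := h2.unique hk
  rw [eqToHom_refl, Category.comp_id, h3]
  exact h1.mem_reach

/-- Two upward strands cross trivially. For opposite directions a strand slides across a cap
(`braiding_capLeft`, `braiding_capLeft'`), and for two downward strands the crossing is absorbed by
nested caps (`braiding_dual_capLeft`). -/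
theorem exists_lam_braiding (b b' : Bool) (P : ℕ) :
    ∃ (M : ℕ) (g : ((sg (top hn b) ⊗ sg (top hn b')) ⊗ pw hn (P + 2) : MOY R n t) ⟶ pw hn M)
      (g' : ((sg (top hn b') ⊗ sg (top hn b)) ⊗ pw hn (P + 2) : MOY R n t) ⟶ pw hn M),
      Lam hn (P + 2) (sg (top hn b) ⊗ sg (top hn b') : MOY R n t) M g ∧
      Lam hn (P + 2) (sg (top hn b') ⊗ sg (top hn b) : MOY R n t) M g' ∧
      (β_ _ _).hom ▷ _ ≫ g' = g := by
  have hL := braiding_top (R := R) (t := t) hn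
  have H : ∀ X : MOY R n t, (β_ X X).hom = 𝟙 _ → ∀ Q : MOY R n t,
      ((β_ Xᘁ X).hom ▷ (X ⊗ Q) ≫ (α_ _ _ _).hom ≫ X ◁ capLeft X Xᘁ Q ≫ 𝟙 (X ⊗ Q) =
        (α_ _ _ _).hom ≫ (Xᘁ : MOY R n t) ◁ 𝟙 (X ⊗ (X ⊗ Q)) ≫ capLeft X Xᘁ (X ⊗ Q)) ∧
      ((β_ X Xᘁ).hom ▷ (X ⊗ Q) ≫ (α_ _ _ _).hom ≫ (Xᘁ : MOY R n t) ◁ 𝟙 (X ⊗ (X ⊗ Q)) ≫ capLeft X Xᘁ (X ⊗ Q) =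
        (α_ _ _ _).hom ≫ X ◁ capLeft X Xᘁ Q ≫ 𝟙 (X ⊗ Q)) := by
    intro X hX Q
    rw [MonoidalCategory.whiskerLeft_id, Category.comp_id, Category.id_comp]
    exact ⟨braiding_capLeft' Xᘁ hX Q, braiding_capLeft Xᘁ hX Q⟩
  cases b <;> cases b'
  · refine ⟨P, _, _, Lam.tensor (Lam.sg (Step.down (P + 1))) (Lam.sg (Step.down P)),
      Lam.tensor (Lam.sg (Step.down (P + 1))) (Lam.sg (Step.down P)), ?_⟩
    exact braiding_dual_capLeft (L := sg (top hn true)) (sg (top hn true) : MOY R n t)ᘁ hL (pw hn P)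
  · refine ⟨P + 2, _, _, Lam.tensor (Lam.sg (Step.up (P + 2))) (Lam.sg (Step.down (P + 2))),
      Lam.tensor (Lam.sg (Step.down (P + 1))) (Lam.sg (Step.up (P + 1))), ?_⟩
    exact (H _ hL _).1
  · refine ⟨P + 2, _, _, Lam.tensor (Lam.sg (Step.down (P + 1))) (Lam.sg (Step.up (P + 1))),
      Lam.tensor (Lam.sg (Step.up (P + 2))) (Lam.sg (Step.down (P + 2))), ?_⟩
    exact (H _ hL _).2
  · refine ⟨P + 4, _, _, Lam.tensor (Lam.sg (Step.up (P + 2))) (Lam.sg (Step.up (P + 3))),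
      Lam.tensor (Lam.sg (Step.up (P + 2))) (Lam.sg (Step.up (P + 3))), ?_⟩
    rw [hL, id_whiskerRight, Category.id_comp]

end

section

variable {hn : 0 < n}

theorem eq_top (hn : 0 < n) {x : Strand n} (hx : x.color = n) : x = top hn x.up := by
  rcases x with ⟨c, b, h0, h1⟩
  obtain rfl : c = n := hx
  rfl

/-- All strands of the sequence have colour `n`. -/
abbrev Pure (X : MOY R n t) : Prop := HasColors (n := n) (· = n) X

theorem pure_or_mixed (X : MOY R n t) : Pure X ∨ Mixed X := by
  by_cases h : Pure X
  · exact Or.inl h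
  · unfold Pure HasColors at h
    push Not at h
    obtain ⟨s, hs, hc⟩ := h
    exact Or.inr ⟨s, hs, lt_of_le_of_ne s.color_le hc⟩

theorem Pure.tensor_left {X Y : MOY R n t} (h : Pure (X ⊗ Y)) : Pure X :=
  fun s hs => h s (List.mem_append_left _ hs)

theorem Pure.tensor_right {X Y : MOY R n t} (h : Pure (X ⊗ Y)) : Pure Y :=
  fun s hs => h s (List.mem_append_right _ hs)

/-- The empty sequence. -/
def emp : MOY R n t := ([] : Word n)

theorem Pure.induction (hn : 0 < n) {p : MOY R n t → Prop} (nil : p emp)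
    (cons : ∀ (b : Bool) (X : MOY R n t), Pure X → p X → p (sg (top hn b) ⊗ X)) (X : MOY R n t)
    (hX : Pure X) : p X := by
  induction X with
  | nil => exact nil
  | cons x X ih =>
    have h : Pure (R := R) (t := t) X := fun s hs => hX s (List.mem_cons_of_mem _ hs)
    rw [eq_top hn (hX x (List.mem_cons_self ..))]
    exact cons _ X h (ih h)

theorem coevaluation_comp_evaluation_emp :
    η_ (emp : MOY R n t) (emp : MOY R n t)ᘁ ≫ ε_ (emp : MOY R n t) (emp : MOY R n t)ᘁ =
      𝟙 (emp : MOY R n t) := by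
  have h : ∀ c e : 𝟙_ (MOY R n t) ⟶ 𝟙_ (MOY R n t), 𝟙_ _ ◁ c ≫ 𝟙 (𝟙_ _) ≫ e ▷ 𝟙_ _ =
      𝟙 (𝟙_ _) ≫ 𝟙 (𝟙_ _) → c ≫ e = 𝟙 _ := by
    intro c e h
    rw [nil_whiskerLeft, Category.comp_id] at h
    refine Eq.trans (congrArg (c ≫ ·) ?_) h
    refine Eq.trans ?_ (Category.id_comp _).symm
    rw [whiskerRight_nil]
    exact ((Category.id_comp _).trans (Category.comp_id _)).symm
  exact h _ _ (ExactPairing.coevaluation_evaluation (emp : MOY R n t) (emp : MOY R n t)ᘁ)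

/-- The formula for the cap over parallel strands, applied to no strands, makes this cap idempotent,
and a zigzag gives it a one-sided inverse. The auxiliary statement concerns arbitrary endomorphisms
of the unit because the dual of `emp` is the unit only by unfolding. -/
theorem evaluation_emp : ε_ (emp : MOY R n t) (emp : MOY R n t)ᘁ = 𝟙 (emp : MOY R n t) := by
  have h : ∀ c e : 𝟙_ (MOY R n t) ⟶ 𝟙_ (MOY R n t), c ≫ e = 𝟙 _ →
      e = 𝟙 (𝟙_ _) ≫ 𝟙_ _ ◁ e ▷ 𝟙_ _ ≫ e → e = 𝟙 _ := by
    intro c e h h'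
    have h2 : e ▷ 𝟙_ _ = e := by
      rw [whiskerRight_nil]
      exact (Category.id_comp _).trans (Category.comp_id _)
    have h3 : e = e ≫ e := by
      refine h'.trans ((Category.id_comp _).trans (congrArg (· ≫ e) ?_))
      exact (nil_whiskerLeft (e ▷ 𝟙_ _)).trans h2
    have h4 := congrArg (c ≫ ·) h3
    rw [reassoc_of% h, h] at h4
    exact h4.symm
  exact h _ _ coevaluation_comp_evaluation_emp (evaluation_tensor (emp : MOY R n t) emp)

theorem coevaluation_emp : η_ (emp : MOY R n t) (emp : MOY R n t)ᘁ = 𝟙 (emp : MOY R n t) :=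
  ((Category.comp_id _).symm.trans (congrArg (η_ (emp : MOY R n t) (emp : MOY R n t)ᘁ ≫ ·)
    evaluation_emp.symm)).trans coevaluation_comp_evaluation_emp

namespace Red

theorem associator_hom (X Y Z : MOY R n t) : Red hn (α_ X Y Z).hom := by
  rw [associator_hom_eq]
  exact Red.eqToHom _

theorem associator_inv (X Y Z : MOY R n t) : Red hn (α_ X Y Z).inv := by
  rw [associator_inv_eq]
  exact Red.eqToHom _

theorem rightUnitor_hom (X : MOY R n t) : Red hn (ρ_ X).hom := by
  rw [rightUnitor_hom_eq]
  exact Red.eqToHom _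

theorem rightUnitor_inv (X : MOY R n t) : Red hn (ρ_ X).inv := by
  rw [rightUnitor_inv_eq]
  exact Red.eqToHom _

theorem leftUnitor_hom (X : MOY R n t) : Red hn (λ_ X).hom := Red.id (X := X)

theorem leftUnitor_inv (X : MOY R n t) : Red hn (λ_ X).inv := Red.id (X := X)

theorem braiding_top (b b' : Bool) :
    Red hn (β_ (sg (top hn b)) (sg (top hn b') : MOY R n t)).hom ∧
      Red hn (β_ (sg (top hn b)) (sg (top hn b') : MOY R n t)).inv := by
  refine ⟨red_of_lam (exists_lam_braiding b b'), red_of_lam fun P => ?_⟩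
  obtain ⟨M, g, g', h1, h2, h3⟩ := exists_lam_braiding (R := R) (t := t) (hn := hn) b b' P
  refine ⟨M, g', g, h2, h1, ?_⟩
  rw [← h3, ← comp_whiskerRight_assoc, Iso.inv_hom_id, id_whiskerRight, Category.id_comp]

theorem braiding_strand (b : Bool) (Y : MOY R n t) (hY : Pure Y) :
    Red hn (β_ (sg (top hn b)) Y).hom ∧ Red hn (β_ (sg (top hn b)) Y).inv := by
  refine Pure.induction hn (p := fun Y => Red hn (β_ (sg (top hn b)) Y).hom ∧
    Red hn (β_ (sg (top hn b)) Y).inv) ⟨?_, ?_⟩ (fun b' Y _ ih => ⟨?_, ?_⟩) Y hY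
  · change Red hn (β_ (sg (top hn b)) (𝟙_ _)).hom
    rw [braiding_tensorUnit_right]
    exact (rightUnitor_hom _).comp (leftUnitor_inv _)
  · change Red hn (β_ (sg (top hn b)) (𝟙_ _)).inv
    rw [braiding_inv_tensorUnit_right]
    exact (leftUnitor_hom _).comp (rightUnitor_inv _)
  · rw [BraidedCategory.braiding_tensor_right_hom]
    exact (associator_inv _ _ _).comp (((braiding_top _ _).1.whiskerRight _).comp
      ((associator_hom _ _ _).comp ((ih.1.whiskerLeft _).comp (associator_inv _ _ _))))
  · rw [BraidedCategory.braiding_tensor_right_inv]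
    exact (associator_hom _ _ _).comp ((ih.2.whiskerLeft _).comp
      ((associator_inv _ _ _).comp (((braiding_top _ _).2.whiskerRight _).comp
        (associator_hom _ _ _))))

theorem braiding (X Y : MOY R n t) (hX : Pure X) (hY : Pure Y) :
    Red hn (β_ X Y).hom ∧ Red hn (β_ X Y).inv := by
  refine Pure.induction hn (p := fun X => Red hn (β_ X Y).hom ∧ Red hn (β_ X Y).inv) ⟨?_, ?_⟩
    (fun b X _ ih => ⟨?_, ?_⟩) X hX
  · change Red hn (β_ (𝟙_ _) Y).hom
    rw [braiding_tensorUnit_left]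
    exact (leftUnitor_hom _).comp (rightUnitor_inv _)
  · change Red hn (β_ (𝟙_ _) Y).inv
    rw [braiding_inv_tensorUnit_left]
    exact (rightUnitor_hom _).comp (leftUnitor_inv _)
  · rw [BraidedCategory.braiding_tensor_left_hom]
    exact (associator_hom _ _ _).comp ((ih.1.whiskerLeft _).comp
      ((associator_inv _ _ _).comp (((braiding_strand _ Y hY).1.whiskerRight _).comp
        (associator_hom _ _ _))))
  · rw [BraidedCategory.braiding_tensor_left_inv]
    exact (associator_inv _ _ _).comp (((braiding_strand _ Y hY).2.whiskerRight _).comp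
      ((associator_hom _ _ _).comp ((ih.2.whiskerLeft _).comp (associator_inv _ _ _))))

/-- The cap over an upward strand is the one used in standard diagrams. The other cap differs from
it by a crossing, and `cap_capLeft` applies because the circle is 1. -/
theorem evaluation_top (b : Bool) :
    Red hn (ε_ (sg (top hn b)) (sg (top hn b) : MOY R n t)ᘁ) := by
  refine red_of_lam fun P => ?_
  cases b
  · refine ⟨_, _, _, Lam.tensor (Lam.sg (Step.down (P + 1))) (Lam.sg (Step.up (P + 1))),
      Lam.nil _, ?_⟩
    have h := cap_capLeft (L := sg (top hn true)) (sg (top hn true) : MOY R n t)ᘁ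
      (MOYCat.braiding_top hn) (ε_ (sg (top hn false)) (sg (top hn false) : MOY R n t)ᘁ)
      (circle_right hn) (pw hn (P + 1))
    rw [← Category.comp_id (_ ◁ capLeft _ _ _)] at h
    exact h
  · refine ⟨_, _, _, Lam.tensor (Lam.sg (Step.up (P + 2))) (Lam.sg (Step.down (P + 2))),
      Lam.nil _, ?_⟩
    have h : ∀ X Q : MOY R n t, ε_ X Xᘁ ▷ Q ≫ (λ_ Q).hom =
        (α_ _ _ _).hom ≫ (Xᘁ : MOY R n t) ◁ 𝟙 (X ⊗ Q) ≫ capLeft X Xᘁ Q := by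
      intro X Q
      simp [capLeft]
    exact h _ _

theorem coevaluation_top (b : Bool) :
    Red hn (η_ (sg (top hn b)) (sg (top hn b) : MOY R n t)ᘁ) := by
  refine red_of_lam fun P => ?_
  cases b
  · refine ⟨_, _, _, Lam.nil _,
      Lam.tensor (Lam.sg (Step.up (P + 2))) (Lam.sg (Step.down (P + 2))), ?_⟩
    have h : ∀ (X Q : MOY R n t) (f : 𝟙_ (MOY R n t) ⟶ Xᘁ ⊗ X), f ≫ ε_ X Xᘁ = 𝟙 _ →
        f ▷ Q ≫ (α_ _ _ _).hom ≫ (Xᘁ : MOY R n t) ◁ 𝟙 (X ⊗ Q) ≫ capLeft X Xᘁ Q = (λ_ Q).hom := by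
      intro X Q f hf
      simp only [capLeft, MonoidalCategory.whiskerLeft_id, Category.id_comp,
        Iso.hom_inv_id_assoc]
      rw [← comp_whiskerRight_assoc, hf]
      simp
    exact h (sg (top hn true)) _ _ (circle_left hn)
  · refine ⟨_, _, _, Lam.nil _,
      Lam.tensor (Lam.sg (Step.down (P + 1))) (Lam.sg (Step.up (P + 1))), ?_⟩
    have h := coevaluation_capLeft (sg (top hn true)) (sg (top hn true) : MOY R n t)ᘁ
      (pw hn (P + 1))
    rw [← Category.comp_id (_ ◁ capLeft _ _ _)] at h
    exact h

theorem evaluation (X : MOY R n t) (hX : Pure X) : Red hn (ε_ X Xᘁ) := by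
  refine Pure.induction hn (p := fun X => Red hn (ε_ X Xᘁ)) ?_ (fun b X _ ih => ?_) X hX
  · rw [evaluation_emp]
    exact Red.id (X := emp)
  · rw [evaluation_tensor]
    exact (Red.eqToHom _).comp ((((evaluation_top _).whiskerRight _).whiskerLeft _).comp ih)

theorem coevaluation (X : MOY R n t) (hX : Pure X) : Red hn (η_ X Xᘁ) := by
  refine Pure.induction hn (p := fun X => Red hn (η_ X Xᘁ)) ?_ (fun b X _ ih => ?_) X hX
  · rw [coevaluation_emp]
    exact Red.id (X := emp)
  · rw [coevaluation_tensor]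
    exact (coevaluation_top _).comp (((ih.whiskerRight _).whiskerLeft _).comp (Red.eqToHom _))

end Red

theorem not_pure_str {k l : ℕ} (hk : 0 < k) (hl : 0 < l) (h : k + l ≤ n) :
    ¬ Pure (col k ⊗ col l : MOY R n t) := fun hp => by
  have h1 := hp.tensor_left
  rw [col_eq hk (by omega)] at h1
  have : k = n := h1 _ (List.mem_singleton_self _)
  omega

/-- Between sequences of colour `n`, every diagram is a combination of standard diagrams, up to
diagrams that factor through sequences with a strand of smaller colour. -/
theorem red_toHom (hn : 0 < n) {X Y : Word n} (f : Tm R n X Y) (hX : Pure (R := R) (t := t) X)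
    (hY : Pure (R := R) (t := t) Y) : Red hn (toHom t f) := by
  induction f with
  | zero => exact Red.zero
  | add f g ihf ihg => exact (ihf hX hY).add (ihg hX hY)
  | smul r f ih => exact (ih hX hY).smul r
  | eqv h =>
    subst h
    exact Red.id
  | comp f g ihf ihg =>
    rename_i X Z Y
    rcases pure_or_mixed (R := R) (t := t) Z with hZ | hZ
    · exact (ihf hX hZ).comp (ihg hZ hY)
    · exact Red.comp_of_mixed hZ (toHom t f) (toHom t g)
  | tensor f g ihf ihg =>
    exact (ihf hX.tensor_left hY.tensor_left).tensor (ihg hX.tensor_right hY.tensor_right)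
  -- Both legs of a vertex have colours smaller than `n`, so no vertex has two ends that consist of
  -- strands of colour `n`.
  | merge k l hk hl h => exact absurd hX (not_pure_str hk hl h)
  | split k l hk hl h => exact absurd hY (not_pure_str hk hl h)
  | braid X Y => exact (Red.braiding X Y hX.tensor_left hX.tensor_right).1
  | braidInv X Y => exact (Red.braiding X Y hY.tensor_left hY.tensor_right).2
  | ev X => exact Red.evaluation X hX.tensor_right
  | coev X => exact Red.coevaluation X hY.tensor_left

end

end MOYCat

/-! ### Closed diagrams -/

namespace CategoryTheory

theorem whiskerRight_tensor_eq_conjBraid {C : Type u} [Category.{v} C] [MonoidalCategory C]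
    [BraidedCategory C] {W : C} (f : W ⟶ W) (A B : C) :
    f ▷ (A ⊗ B) = conjBraid W A (f ▷ B) := by
  unfold conjBraid
  have h : f ▷ A = (β_ W A).hom ≫ A ◁ f ≫ (β_ W A).inv := by
    rw [← BraidedCategory.braiding_naturality_left_assoc]
    simp
  have h2 := congrArg (· ▷ B) h
  simp only [comp_whiskerRight] at h2
  rw [whiskerRight_tensor, h2]
  simp

end CategoryTheory

namespace MOYCat

open Quantum Tm

variable {R : Type u} [CommRing R] {n : ℕ} {t : Rˣ}

theorem whiskerRight_mem_thru_of_retract {A P Q : MOY R n t} {f : A ⟶ A} {a : P ⟶ Q} {b : Q ⟶ P}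
    (hab : a ≫ b = 𝟙 _) (h : f ▷ Q ∈ thru _ _) : f ▷ P ∈ thru _ _ := by
  have e : f ▷ P = A ◁ a ≫ f ▷ Q ≫ A ◁ b := by
    rw [whisker_exchange_assoc, ← MonoidalCategory.whiskerLeft_comp, hab]
    simp
  rw [e]
  exact comp_mem_thru (thru_comp_mem h _) _

/-- The endomorphism `f` is carried across `B` by crossings and thus acts next to `P`, where it is
known to lie in the ideal. -/
theorem whiskerRight_tensor_mem_thru {A B P : MOY R n t} {f : A ⟶ A} (h : f ▷ P ∈ thru _ _) :
    f ▷ (B ⊗ P) ∈ thru _ _ := by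
  rw [whiskerRight_tensor_eq_conjBraid]
  unfold conjBraid
  exact comp_mem_thru (comp_mem_thru (comp_mem_thru (thru_comp_mem (whiskerLeft_mem_thru h _) _)
    _) _) _

theorem coevaluation_capLeft_of_circle {X P : MOY R n t} (c : 𝟙_ (MOY R n t) ⟶ Xᘁ ⊗ X)
    (h : c ≫ ε_ X Xᘁ = 𝟙 _) :
    ((λ_ P).inv ≫ c ▷ P ≫ (α_ _ _ _).hom) ≫ capLeft X Xᘁ P = 𝟙 _ := by
  simp only [capLeft, Category.assoc, Iso.hom_inv_id_assoc]
  rw [← comp_whiskerRight_assoc, h]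
  simp

/-- The parallel strands are removed one at a time: as the circle of colour `n` is 1, `pw hn N` is a
retract of a downward strand next to `pw hn (N + 1)`. -/
theorem mem_thru_of_whiskerRight_pw {hn : 0 < n} {f : 𝟙_ (MOY R n t) ⟶ 𝟙_ (MOY R n t)} (N : ℕ)
    (h : f ▷ pw hn N ∈ thru _ _) : f ∈ thru _ _ := by
  induction N with
  | zero =>
    have e : f = (ρ_ _).inv ≫ f ▷ 𝟙_ _ ≫ (ρ_ _).hom := by simp
    rw [e]
    exact comp_mem_thru (thru_comp_mem h _) _
  | succ N ih =>
    exact ih (whiskerRight_mem_thru_of_retract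
      (coevaluation_capLeft_of_circle (X := sg (top hn true)) _ (circle_left hn))
      (whiskerRight_tensor_mem_thru h))

/-- A closed diagram is a multiple of the empty diagram, up to diagrams that factor through
sequences with a strand of colour smaller than `n`. -/
theorem exists_add_smul_id_mem_thru (hn : 0 < n) (f : 𝟙_ (MOY R n t) ⟶ 𝟙_ (MOY R n t)) :
    ∃ r : R, f + r • 𝟙 _ ∈ thru (𝟙_ (MOY R n t)) (𝟙_ _) := by
  obtain ⟨g, rfl⟩ := mk_surj f
  have hp : Pure (𝟙_ (MOY R n t)) := fun s hs => by cases hs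
  obtain ⟨N, hN⟩ := red_toHom hn g hp hp
  have h := hN N le_rfl N _ (Lam.nil N)
  obtain ⟨a, ha, b, hb, hab⟩ := Submodule.mem_sup.1 h
  -- On the empty word the only standard diagram consists of the `N` parallel strands themselves.
  have hs : Submodule.span R {g | Lam hn N (𝟙_ (MOY R n t)) N g} ≤
      Submodule.span R {(λ_ (pw hn N)).hom} := by
    refine Submodule.span_mono fun k hk => ?_
    obtain ⟨_, hk⟩ := hk
    rw [eqToHom_refl, Category.comp_id] at hk
    exact hk
  obtain ⟨r, rfl⟩ := Submodule.mem_span_singleton.1 (hs ha)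
  refine ⟨-r, mem_thru_of_whiskerRight_pw (hn := hn) N ?_⟩
  have e : (toHom t g + (-r) • 𝟙 (𝟙_ (MOY R n t))) ▷ pw hn N = b ≫ (λ_ _).inv := by
    rw [MonoidalPreadditive.add_whiskerRight, MonoidalLinear.smul_whiskerRight, id_whiskerRight,
      Iso.eq_comp_inv, Preadditive.add_comp, ← hab, Linear.smul_comp, Category.id_comp, neg_smul]
    abel
  have h2 := thru_comp_mem hb (λ_ (pw hn N)).inv
  rw [← e] at h2
  exact h2

section

variable (hn : 2 ≤ n) (hunit : ∀ k : ℕ, 1 ≤ k → k < n → IsUnit (qint (t ^ n) k))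

include hn hunit

/-- At a mixed sequence `Z`, a pair `W` can be created and absorbed, and next to `W` the sequence
`Z` can be exploded. The diagram is then cut at `W` next to the exploded `Z`, a nonempty sequence of
small colours, and both halves have a nonempty end. The morphisms `v` and `k` need no colour bounds,
since they are parts of these halves. -/
theorem isColorLE_of_mem_thru {f : 𝟙_ (MOY R n t) ⟶ 𝟙_ (MOY R n t)} (h : f ∈ thru _ _) :
    IsColorLE (n - 1) f := by
  have hn1 : 1 ≤ n := by omega
  have hW := undoes_top (R := R) (t := t) hn hunit
  have key : thru (𝟙_ (MOY R n t)) (𝟙_ _) ≤ colorLE (n - 1) _ _ := by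
    refine Submodule.span_le.2 ?_
    rintro _ ⟨Z, f, g, hZ, rfl⟩
    have hZn : ColorsLE n Z := fun s _ => s.color_le
    have hE := hW.colors.tensor (low_wordExpl hn le_rfl hunit Z hZn).colors
    obtain ⟨v, -, hv⟩ := absorbs_of_mixed hunit hn1 hZn hZ
    obtain ⟨k, -, e⟩ := undone_wordExpl hn le_rfl hunit hW Z hZn
    have e2 : f ≫ g = (η_ (sg ⟨1, false, one_pos, hn1⟩)
        (sg ⟨1, false, one_pos, hn1⟩ : MOY R n t)ᘁ ≫ (ρ_ _).inv ≫ _ ◁ (f ≫ (wordExpl n Z).s) ≫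
        k) ≫ (_ ◁ (wordExpl n Z).p ≫ v ≫ g) := by
      simp only [MonoidalCategory.whiskerLeft_comp, Category.assoc]
      rw [reassoc_of% e, rightUnitor_inv_naturality_assoc, ← whisker_exchange_assoc,
        reassoc_of% hv]
      simp [unitors_equal]
    change IsColorLE (n - 1) (f ≫ g)
    rw [e2]
    exact (isColorLE_of_right_ne_nil hn hunit colorsLE_unit hE (List.cons_ne_nil _ _) _).comp
      (isColorLE_of_left_ne_nil hn hunit hE colorsLE_unit (List.cons_ne_nil _ _) _)
  exact key h

theorem isColorLE_closed (f : 𝟙_ (MOY R n t) ⟶ 𝟙_ (MOY R n t)) : IsColorLE (n - 1) f := by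
  obtain ⟨r, hr⟩ := exists_add_smul_id_mem_thru (by omega) f
  have h := (isColorLE_of_mem_thru hn hunit hr).add ((isColorLE_id colorsLE_unit).smul (-r))
  rwa [neg_smul, add_neg_cancel_right] at h

theorem isColorLE_pred_top {X Y : MOY R n t} (hX : ColorsLE (n - 1) X) (hY : ColorsLE (n - 1) Y)
    (f : X ⟶ Y) : IsColorLE (n - 1) f := by
  by_cases h : X = 𝟙_ _
  · by_cases h' : Y = 𝟙_ _
    · subst h h'
      exact isColorLE_closed hn hunit f
    · exact isColorLE_of_right_ne_nil hn hunit hX hY h' f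
  · exact isColorLE_of_left_ne_nil hn hunit hX hY h f

end

/-- Interior edges of colour `i` can be expanded. -/
theorem isColorLE_pred {i : ℕ} (hi : 2 ≤ i) (hin : i ≤ n)
    (hunit : ∀ k : ℕ, 1 ≤ k → k < n → IsUnit (qint (t ^ n) k))
    {X Y : MOY R n t} (hX : ColorsLE (i - 1) X) (hY : ColorsLE (i - 1) Y) {f : X ⟶ Y}
    (hf : IsColorLE i f) : IsColorLE (i - 1) f := by
  rcases hin.lt_or_eq with h | rfl
  · exact isColorLE_pred_of_lt hi h hunit hX hY hf
  · exact isColorLE_pred_top hi hunit hX hY f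

/-! ### The functor -/

section

variable {i : ℕ} (hi : 2 ≤ i) (hin : i ≤ n)
  (hunit : ∀ k : ℕ, 1 ≤ k → k < n → IsUnit (qint (t ^ n) k))

theorem isColorLE_sub (hi : 2 ≤ i) (hin : i ≤ n)
    (hunit : ∀ k : ℕ, 1 ≤ k → k < n → IsUnit (qint (t ^ n) k)) {X Y : MOYSub R n t i} (f : X ⟶ Y) :
    IsColorLE (max (i - 1) 1) f.1 := by
  have h : IsColorLE (max i 1) f.1 := f.2
  have hc : ∀ Z : MOYSub R n t i, ColorsLE (i - 1) Z.word := fun Z s hs =>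
    (Z.color_eq_one s hs).le.trans (by omega)
  exact (isColorLE_pred hi hin hunit (hc X) (hc Y) (h.mono (max_le le_rfl (by omega)))).mono
    (le_max_left _ _)

/-- The functor that expands the edges of colour `i`. -/
def expand : MOYSub R n t i ⥤ MOYSub R n t (i - 1) where
  obj X := ⟨X.word, X.color_eq_one⟩
  map f := ⟨f.1, isColorLE_sub hi hin hunit f⟩
  map_id _ := rfl
  map_comp _ _ := rfl

/-- The monoidal structure of `expand`, given by identities. -/
def expandCore : (expand (R := R) hi hin hunit).CoreMonoidal where
  εIso := Iso.refl _
  μIso _ _ := Iso.refl _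
  μIso_hom_natural_left {X Y} f Z := by
    refine Subtype.ext ?_
    have h : f.1 ▷ Z.word ≫ 𝟙 _ = 𝟙 _ ≫ f.1 ▷ Z.word := by simp
    exact h
  μIso_hom_natural_right {X Y} Z f := by
    refine Subtype.ext ?_
    have h : Z.word ◁ f.1 ≫ 𝟙 _ = 𝟙 _ ≫ Z.word ◁ f.1 := by simp
    exact h
  associativity X Y Z := by
    refine Subtype.ext ?_
    have h : 𝟙 (X.word ⊗ Y.word) ▷ Z.word ≫ 𝟙 _ ≫ (α_ X.word Y.word Z.word).hom =
      (α_ X.word Y.word Z.word).hom ≫ X.word ◁ 𝟙 (Y.word ⊗ Z.word) ≫ 𝟙 _ := by simp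
    exact h
  left_unitality X := by
    refine Subtype.ext ?_
    have h : (λ_ X.word).hom = 𝟙 (𝟙_ _) ▷ X.word ≫ 𝟙 _ ≫ (λ_ X.word).hom := by simp
    exact h
  right_unitality X := by
    refine Subtype.ext ?_
    have h : (ρ_ X.word).hom = X.word ◁ 𝟙 (𝟙_ _) ≫ 𝟙 _ ≫ (ρ_ X.word).hom := by simp
    exact h

instance : (expand (R := R) hi hin hunit).Monoidal := (expandCore hi hin hunit).toMonoidal

instance : (expand (R := R) hi hin hunit).Braided where
  braided X Y := by
    refine Subtype.ext ?_
    have h : 𝟙 _ ≫ (β_ X.word Y.word).hom = (β_ X.word Y.word).hom ≫ 𝟙 _ := by simp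
    exact h

instance : (expand (R := R) hi hin hunit).Additive where
  map_add := rfl

instance : (expand (R := R) hi hin hunit).Linear R where
  map_smul _ _ := rfl

instance : (expand (R := R) hi hin hunit).IsEquivalence where
  faithful := ⟨fun {X Y f g} h => Subtype.ext (by
    have h := congrArg (fun m => m.1) h
    exact h)⟩
  full := ⟨fun g => ⟨⟨g.1, IsColorLE.mono (max_le_max_right 1 (Nat.sub_le i 1)) g.2⟩, rfl⟩⟩
  essSurj := ⟨fun Y => ⟨⟨Y.word, Y.color_eq_one⟩, ⟨Iso.refl _⟩⟩⟩

theorem mapDualIso_expand (X : MOYSub R n t i) :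
    mapDualIso (expand hi hin hunit) X = Iso.refl ((expand hi hin hunit).obj Xᘁ) := by
  refine Iso.ext (rightDualIso_hom_eq _ _ _ (Subtype.ext ?_))
  have h : 𝟙 (X.word)ᘁ ▷ X.word ≫ 𝟙 _ ≫ ε_ X.word (X.word)ᘁ ≫ 𝟙 _ = ε_ X.word (X.word)ᘁ := by
    simp
  exact h

theorem preservesPivotal_expand : PreservesPivotal (expand (R := R) hi hin hunit) := by
  intro X
  rw [mapDualIso_expand, mapDualIso_expand]
  have e : ((Iso.refl ((expand hi hin hunit).obj Xᘁ)).hom)ᘁ = 𝟙 _ := rightAdjointMate_id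
  refine (congrArg (fun a => _ ≫ _ ≫ a) e).trans (Subtype.ext ?_)
  have h : (PivotalCategory.pivot X.word).hom ≫ 𝟙 _ ≫ 𝟙 _ = (PivotalCategory.pivot X.word).hom := by
    simp
  exact h

theorem incl_comp_expand :
    incl R n t (Nat.sub_le i 1) ⋙ expand hi hin hunit = 𝟭 (MOYSub R n t (i - 1)) := rfl

end

end MOYCat

theorem mainTheorem4 (R : Type u) [CommRing R] [IsDomain R] (n i : ℕ) (hi : 2 ≤ i) (hin : i ≤ n)
    (t : Rˣ)
    (hunit : ∀ k : ℕ, 1 ≤ k → k < n → IsUnit (Quantum.qint (t ^ n) k))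
    (hroot : IsOfFinOrder (t ^ n) → ∀ p : ℕ, p.Prime → p ∣ orderOf (t ^ n) → n < p) :
    ∃ (φ : MOYCat.MOYSub R n t i ⥤ MOYCat.MOYSub R n t (i - 1))
      (_ : φ.Additive) (_ : φ.Linear R) (_ : φ.Braided),
      φ.IsEquivalence ∧ PreservesPivotal φ ∧
      MOYCat.incl R n t (Nat.sub_le i 1) ⋙ φ = 𝟭 (MOYCat.MOYSub R n t (i - 1)) ∧
      ∀ (j k : ℕ) (hj : 1 ≤ j) (hj' : j < i) (hk : 1 ≤ k) (hk' : k < i),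
        (MOYCat.edgeExpansion (n := n) t i j k hj hj' hk hk').ColorLE (i - 1) ∧
        ∀ (X Y : MOYCat.MOYSub R n t i) (f g : X ⟶ Y) (U V : MOYCat.MOY R n t)
          (a : X.word ⟶ U ⊗ (MOYCat.str n j ++ MOYCat.str n (i - j) : MOYCat.Word n) ⊗ V)
          (b : U ⊗ (MOYCat.str n k ++ MOYCat.str n (i - k) : MOYCat.Word n) ⊗ V ⟶ Y.word),
          f.1 = a ≫ U ◁ (MOYCat.toHom t (MOYCat.edgeWeb R n i j k hj' hk') ▷ V) ≫ b →
          g.1 = a ≫ U ◁ (MOYCat.toHom t (MOYCat.edgeExpansion t i j k hj hj' hk hk') ▷ V) ≫ b →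
          φ.map f = φ.map g := by
  refine ⟨MOYCat.expand hi hin hunit, inferInstance, inferInstance, inferInstance, inferInstance,
    MOYCat.preservesPivotal_expand hi hin hunit, MOYCat.incl_comp_expand hi hin hunit,
    fun j k hj hj' hk hk' => ⟨MOYCat.colorLE_edgeExpansion hi hj hj' hk hk',
      fun X Y f g U V a b hf hg => ?_⟩⟩
  -- The web and its expansion are equal in MOY(SL_n), so `f` and `g` coincide before the functor is
  -- applied.
  rw [MOYCat.edgeExpansion_eq_edgeWeb hi hin hunit hj hj' hk hk'] at hf
  exact congrArg _ (Subtype.ext (hf.trans hg.symm))
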